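/- Let $\mathbf C^3_1$ be $\mathbf C^3$ with the Hermitian form $b(z,w)=-\bar z_1w_1+\bar z_2w_2+\bar z_3w_3$, let $S^5_2(1)=\{z\in\mathbf C^3: b(z,z)=1\}$, and let $\pi:S^5_2(1)\to CP^2_1(4)$, $z\mapsto z\cdot\mathbf C^*$, be the Hopf fibration onto the Lorentzian complex projective plane, which carries its standard complex structure $J$ and the pseudo-Riemannian metric $\langle\cdot,\cdot\rangle$ for which $\pi$ is a pseudo-Riemannian submersion ($S^5_2(1)$ having the metric induced by $\operatorname{Re} b$). Let $M$ be a connected smooth surface and let $L:M\to CP^2_1(4)$ be a smooth immersion whose induced metric is Lorentzian. Assume that $L$ is slant, i.e. its Wirtinger angle is a constant $\theta$: at each point the tangent plane has a basis $e_1,e_2$ with $\langle e_1,e_1\rangle=\langle e_2,e_2\rangle=0$, $\langle e_1,e_2\rangle=-1$ such that the tangential components of $Je_1,Je_2$ are $\sinh\theta\,e_1$ and $-\sinh\theta\,e_2$. Assume also that $L$ is minimal (its mean curvature vector vanishes) and flat (the induced metric has zero curvature). Then $L$ is Lagrangian, i.e. $J$ maps every tangent plane of $L$ into the normal plane. Moreover,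 $L$ is congruent to $\pi\circ\tilde L$, where for some nonzero real number $a$ $$\tilde L(x,y)=\frac1{\sqrt3}\Big(\sqrt2\,e^{\frac{i}{2a}(x-a^2y)}\sinh\big(\tfrac{\sqrt3}{2a}(x+a^2y)\big),\ e^{\frac{i}{a}(a^2y-x)},\ \sqrt2\,e^{\frac{i}{2a}(x-a^2y)}\cosh\big(\tfrac{\sqrt3}{2a}(x+a^2y)\big)\Big)\in S^5_2(1).$$ That is, there are a real number $a\neq0$ and an isometry $\Phi$ of $CP^2_1(4)$ induced by a complex linear automorphism of $\mathbf C^3$ preserving $b$ such that every point of $M$ has an open neighbourhood with smooth coordinates $(x,y)$ on which $L=\Phi\circ\pi\circ\tilde L(x,y)$. -/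

import Mathlib

open scoped Manifold ContDiff ComplexConjugate

noncomputable section

namespace SlantCP

/-! ### Pseudo-Riemannian geometry in coordinates

A metric on an open subset of a real vector space `E` is a field of bilinear forms. All the
functions below are only used at interior points of the domain, where the field is smooth and
nondegenerate. -/

section Coordinates

variable {E : Type*} [NormedAddCommGroup E] [NormedSpace ℝ E]
variable {F : Type*} [NormedAddCommGroup F] [NormedSpace ℝ F]

/-- The Levi-Civita connection of `G` on constant vector fields: `christoffel G x v w = ∇_v w`
is the vector characterized by the Koszul formula
`G x (∇_v w) u = (1/2) (∂_v (G w u) + ∂_w (G v u) - ∂_u (G v w))` for all `u`. -/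
def christoffel (G : E → E →L[ℝ] E →L[ℝ] ℝ) (x v w : E) : E :=
  (G x).inverse ((1 / 2 : ℝ) •
    (fderiv ℝ G x v w + fderiv ℝ G x w v - ((fderiv ℝ G x).flip v).flip w))

/-- The Riemann curvature tensor `R(v, w) z = ∇_v ∇_w z - ∇_w ∇_v z` of the Levi-Civita connection
of `G`, on constant vector fields `v`, `w`, `z`. -/
def curvature (G : E → E →L[ℝ] E →L[ℝ] ℝ) (x v w z : E) : E :=
  fderiv ℝ (fun y => christoffel G y w z) x v - fderiv ℝ (fun y => christoffel G y v z) x w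
    + christoffel G x v (christoffel G x w z) - christoffel G x w (christoffel G x v z)

/-- The metric induced by `g` through the map `f`. -/
def inducedMetric (g : F → F →L[ℝ] F →L[ℝ] ℝ) (f : E → F) (x : E) : E →L[ℝ] E →L[ℝ] ℝ :=
  (g (f x)).bilinearComp (fderiv ℝ f x) (fderiv ℝ f x)

/-- The second fundamental form `h(v, w) = ∇̃_v (df w) - df (∇_v w)` of the immersion `f`
(formula of Gauss), where `∇̃` is the Levi-Civita connection of the ambient metric `g` and `∇` the
one of the induced metric. -/
def secondFundamentalForm (g : F → F →L[ℝ] F →L[ℝ] ℝ) (f : E → F) (x v w : E) : F :=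
  fderiv ℝ (fun y => fderiv ℝ f y w) x v
    + christoffel g (f x) (fderiv ℝ f x v) (fderiv ℝ f x w)
    - fderiv ℝ f x (christoffel (inducedMetric g f) x v w)

/-- The mean curvature vector `H = (1/2) trace h = (1/2) ∑ᵢⱼ Gⁱʲ h(∂ᵢ, ∂ⱼ)` of a surface, where
`Gⁱʲ` is the inverse of the matrix of the induced metric. -/
def meanCurvature (g : F → F →L[ℝ] F →L[ℝ] ℝ) (f : EuclideanSpace ℝ (Fin 2) → F)
    (x : EuclideanSpace ℝ (Fin 2)) : F :=
  (1 / 2 : ℝ) • ∑ i : Fin 2, ∑ j : Fin 2,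
    (Matrix.of fun k l : Fin 2 => inducedMetric g f x
        (EuclideanSpace.single k 1) (EuclideanSpace.single l 1))⁻¹ i j •
      secondFundamentalForm g f x (EuclideanSpace.single i 1) (EuclideanSpace.single j 1)

end Coordinates

/-! ### The Lorentzian complex projective plane -/

/-- The Hermitian form `b(z, w) = - z̄₁ w₁ + z̄₂ w₂ + z̄₃ w₃` on `ℂ³`. -/
def herm (z w : Fin 3 → ℂ) : ℂ :=
  -(conj (z 0) * w 0) + conj (z 1) * w 1 + conj (z 2) * w 2

/-- The real part of `herm`, a flat metric on `ℂ³`, as a bilinear form. -/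
def reHerm : (Fin 3 → ℂ) →L[ℝ] (Fin 3 → ℂ) →L[ℝ] ℝ :=
  (LinearMap.mk₂ ℝ (fun z w => (herm z w).re)
    (by intros; simp [herm]; ring) (by intros; simp [herm]; ring)
    (by intros; simp [herm]; ring) (by intros; simp [herm]; ring)).toContinuousBilinearMap

/-- The pseudosphere `S⁵₂(1) = {z ∈ ℂ³ : b(z, z) = 1}`. -/
def S52 : Type := {z : Fin 3 → ℂ // herm z z = 1}

instance : TopologicalSpace S52 := inferInstanceAs (TopologicalSpace {z : Fin 3 → ℂ // herm z z = 1})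

/-- Two points of the pseudosphere are related if they span the same complex line. -/
instance hopfSetoid : Setoid S52 where
  r z w := ∃ c : ℂ, c ≠ 0 ∧ w.1 = c • z.1
  iseqv :=
    ⟨fun z => ⟨1, one_ne_zero, by simp⟩,
      fun {z w} ⟨c, hc, h⟩ => ⟨c⁻¹, inv_ne_zero hc, by rw [h, smul_smul, inv_mul_cancel₀ hc, one_smul]⟩,
      fun {z w u} ⟨c, hc, h⟩ ⟨d, hd, h'⟩ => ⟨d * c, mul_ne_zero hd hc, by rw [h', h, smul_smul]⟩⟩

/-- The Lorentzian complex projective plane `CP²₁(4)`, as the set of complex lines spanned by the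
points of the pseudosphere, with the quotient topology. -/
def CP21 : Type := Quotient hopfSetoid

instance : TopologicalSpace CP21 := inferInstanceAs (TopologicalSpace (Quotient hopfSetoid))

/-- The Hopf fibration `π : S⁵₂(1) → CP²₁(4)`. -/
def hopf (z : S52) : CP21 := Quotient.mk hopfSetoid z

/-- The linear embedding of `ℂ²` as the coordinate plane `z₂ = 0` (`k = 0`) or `z₃ = 0`
(`k = 1`) of `ℂ³`. -/
def planeIncl : Fin 2 → (ℂ × ℂ →ₗ[ℂ] Fin 3 → ℂ)
  | 0 => { toFun := fun w => ![w.1, 0, w.2]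
           map_add' := by intro v w; ext i; fin_cases i <;> simp
           map_smul' := by intro c w; ext i; fin_cases i <;> simp }
  | 1 => { toFun := fun w => ![w.1, w.2, 0]
           map_add' := by intro v w; ext i; fin_cases i <;> simp
           map_smul' := by intro c w; ext i; fin_cases i <;> simp }

/-- The homogeneous coordinates `(w₁, 1, w₂)` (`k = 0`) or `(w₁, w₂, 1)` (`k = 1`) of the point
with affine coordinates `w`. -/
def homog (k : Fin 2) (w : ℂ × ℂ) : Fin 3 → ℂ := planeIncl k w + Pi.single k.succ 1

/-- The affine coordinates of the line through `z`: `(z₁/z₂, z₃/z₂)` for `k = 0` and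
`(z₁/z₃, z₂/z₃)` for `k = 1`. -/
def affineOf : Fin 2 → (Fin 3 → ℂ) → ℂ × ℂ
  | 0, z => (z 0 / z 1, z 2 / z 1)
  | 1, z => (z 0 / z 2, z 1 / z 2)

/-- The squared length `b(homog k w, homog k w)`. -/
def lenSq (k : Fin 2) (w : ℂ × ℂ) : ℝ := (herm (homog k w) (homog k w)).re

lemma herm_self (z : Fin 3 → ℂ) : herm z z = ((herm z z).re : ℂ) := by
  apply Complex.ext <;> simp [herm]
  ring

lemma herm_smul_smul (c : ℂ) (z w : Fin 3 → ℂ) :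
    herm (c • z) (c • w) = (conj c * c) * herm z w := by
  simp [herm]; ring

lemma homog_succ (k : Fin 2) (w : ℂ × ℂ) : homog k w k.succ = 1 := by
  fin_cases k <;> simp [homog, planeIncl]

lemma affineOf_smul (k : Fin 2) {c : ℂ} (hc : c ≠ 0) (z : Fin 3 → ℂ) :
    affineOf k (c • z) = affineOf k z := by
  fin_cases k <;> simp [affineOf, mul_div_mul_left _ _ hc]

lemma affineOf_homog (k : Fin 2) (w : ℂ × ℂ) : affineOf k (homog k w) = w := by
  fin_cases k <;> simp [affineOf, homog, planeIncl]

lemma homog_affineOf (k : Fin 2) {z : Fin 3 → ℂ} (hz : z k.succ ≠ 0) :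
    homog k (affineOf k z) = (z k.succ)⁻¹ • z := by
  ext i
  fin_cases k <;> fin_cases i <;>
    simp_all [affineOf, homog, planeIncl, div_eq_inv_mul]

/-- The point of the pseudosphere on the ray through `homog k w`, when there is one. -/
def unitPoint (k : Fin 2) (w : ℂ × ℂ) : S52 :=
  if h : 0 < lenSq k w then
    ⟨((Real.sqrt (lenSq k w) : ℂ)⁻¹) • homog k w, by
      rw [herm_smul_smul, herm_self]
      change _ * ((lenSq k w : ℝ) : ℂ) = 1
      rw [map_inv₀, Complex.conj_ofReal, ← mul_inv, ← Complex.ofReal_mul,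
        Real.mul_self_sqrt h.le]
      exact inv_mul_cancel₀ (by exact_mod_cast h.ne')⟩
  else ⟨Pi.single 1 1, by simp [herm]⟩

lemma unitPoint_val (k : Fin 2) {w : ℂ × ℂ} (h : 0 < lenSq k w) :
    (unitPoint k w).1 = ((Real.sqrt (lenSq k w) : ℂ)⁻¹) • homog k w := by
  simp [unitPoint, h]

/-- The lines on which the coordinate `z₂` (`k = 0`) or `z₃` (`k = 1`) does not vanish. -/
def affineDomain (k : Fin 2) : Set CP21 := {l | ∃ z : S52, hopf z = l ∧ z.1 k.succ ≠ 0}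

/-- The affine coordinates on `CP²₁(4)`, meaningful on `affineDomain k`. -/
def affineCoord (k : Fin 2) : CP21 → ℂ × ℂ :=
  Quotient.lift (fun z : S52 => affineOf k z.1) (by
    rintro z w ⟨c, hc, h⟩
    rw [h, affineOf_smul k hc])

lemma hopf_mem_affineDomain (k : Fin 2) (z : S52) :
    hopf z ∈ affineDomain k ↔ z.1 k.succ ≠ 0 := by
  constructor
  · rintro ⟨w, hw, h⟩
    obtain ⟨c, hc, h'⟩ := Quotient.exact hw
    rw [h']
    simpa using ⟨hc, h⟩
  · exact fun h => ⟨z, rfl, h⟩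

lemma continuous_hopf : Continuous hopf := continuous_quotient_mk'

lemma isQuotientMap_hopf : Topology.IsQuotientMap hopf := isQuotientMap_quotient_mk'

lemma continuous_S52_val : Continuous (fun z : S52 => z.1) := continuous_subtype_val

lemma isOpen_affineDomain (k : Fin 2) : IsOpen (affineDomain k) := by
  rw [← isQuotientMap_hopf.isOpen_preimage]
  have : hopf ⁻¹' affineDomain k = {z : S52 | z.1 k.succ ≠ 0} := by
    ext z; exact hopf_mem_affineDomain k z
  rw [this]
  exact isOpen_ne_fun ((continuous_apply _).comp continuous_S52_val) continuous_const

lemma contDiff_homog (k : Fin 2) : ContDiff ℝ ∞ (homog k) := by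
  rw [contDiff_pi]
  intro i
  fin_cases k <;> fin_cases i <;> simp [homog, planeIncl] <;> fun_prop

lemma continuous_lenSq (k : Fin 2) : Continuous (lenSq k) := by
  have h := (contDiff_homog k).continuous
  have h' : ∀ i, Continuous fun w => homog k w i := fun i => (continuous_apply i).comp h
  unfold lenSq herm
  have h0 := h' 0
  have h1 := h' 1
  have h2 := h' 2
  fun_prop

lemma lenSq_affineOf_pos (k : Fin 2) (z : S52) (hz : z.1 k.succ ≠ 0) :
    0 < lenSq k (affineOf k z.1) := by
  rw [lenSq, homog_affineOf k hz, herm_smul_smul, z.2, mul_one, Complex.conj_mul']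
  have : 0 < ‖(z.1 k.succ)⁻¹‖ := norm_pos_iff.mpr (inv_ne_zero hz)
  norm_cast
  positivity

/-- The affine charts of `CP²₁(4)`; the two domains cover it. -/
def affineChart (k : Fin 2) : OpenPartialHomeomorph CP21 (ℂ × ℂ) where
  toFun := affineCoord k
  invFun w := hopf (unitPoint k w)
  source := affineDomain k
  target := {w | 0 < lenSq k w}
  map_source' := by
    rintro _ ⟨z, rfl, hz⟩
    exact lenSq_affineOf_pos k z hz
  map_target' := by
    intro w hw
    have hw : 0 < lenSq k w := hw
    rw [hopf_mem_affineDomain, unitPoint_val k hw]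
    simpa [homog_succ] using (Real.sqrt_pos.mpr hw).ne'
  left_inv' := by
    rintro _ ⟨z, rfl, hz⟩
    have hp := lenSq_affineOf_pos k z hz
    refine Quotient.sound (Setoid.symm ⟨(Real.sqrt (lenSq k (affineOf k z.1)) : ℂ)⁻¹ * (z.1 k.succ)⁻¹,
      mul_ne_zero (inv_ne_zero ?_) (inv_ne_zero hz), ?_⟩)
    · exact_mod_cast (Real.sqrt_pos.mpr hp).ne'
    · refine (unitPoint_val k hp).trans ?_
      rw [homog_affineOf k hz, smul_smul]
  right_inv' := by
    intro w hw
    have hw : 0 < lenSq k w := hw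
    change affineOf k (unitPoint k w).1 = w
    rw [unitPoint_val k hw, affineOf_smul, affineOf_homog]
    exact inv_ne_zero (by exact_mod_cast (Real.sqrt_pos.mpr hw).ne')
  open_source := isOpen_affineDomain k
  open_target := isOpen_lt continuous_const (continuous_lenSq k)
  continuousOn_toFun := by
    rw [isQuotientMap_hopf.continuousOn_isOpen_iff (isOpen_affineDomain k)]
    have hc : ∀ i, ContinuousOn (fun z : S52 => z.1 i) (hopf ⁻¹' affineDomain k) := fun i =>
      ((continuous_apply i).comp continuous_S52_val).continuousOn
    have hne : ∀ z ∈ hopf ⁻¹' affineDomain k, z.1 k.succ ≠ 0 := fun z hz =>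
      (hopf_mem_affineDomain k z).mp hz
    fin_cases k
    · exact ((hc 0).div (hc 1) hne).prodMk ((hc 2).div (hc 1) hne)
    · exact ((hc 0).div (hc 2) hne).prodMk ((hc 1).div (hc 2) hne)
  continuousOn_invFun := by
    refine continuous_hopf.comp_continuousOn ?_
    rw [continuousOn_iff_continuous_domRestrict]
    refine Continuous.subtype_mk (f := fun w : {w | 0 < lenSq k w} => (unitPoint k w.1).1) ?_ _
    have : (fun w : {w | 0 < lenSq k w} => (unitPoint k w.1).1)
        = fun w => ((Real.sqrt (lenSq k w.1) : ℂ)⁻¹) • homog k w.1 :=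
      funext fun w => unitPoint_val k w.2
    rw [this]
    have hs : Continuous fun w : {w | 0 < lenSq k w} => ((Real.sqrt (lenSq k w.1) : ℝ) : ℂ) :=
      Complex.continuous_ofReal.comp
        (Real.continuous_sqrt.comp ((continuous_lenSq k).comp continuous_subtype_val))
    have hi : Continuous fun w : {w | 0 < lenSq k w} => ((Real.sqrt (lenSq k w.1) : ℝ) : ℂ)⁻¹ :=
      hs.inv₀ fun w => by exact_mod_cast (Real.sqrt_pos.mpr w.2).ne'
    exact hi.smul ((contDiff_homog k).continuous.comp continuous_subtype_val)

lemma exists_mem_affineDomain (l : CP21) : ∃ k, l ∈ affineDomain k := by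
  obtain ⟨z, rfl⟩ := isQuotientMap_hopf.surjective l
  by_contra! h
  have h1 : z.1 1 = 0 := by simpa using (hopf_mem_affineDomain 0 z).not.mp (h 0)
  have h2 : z.1 2 = 0 := by simpa using (hopf_mem_affineDomain 1 z).not.mp (h 1)
  have h3 := congrArg Complex.re z.2
  simp [herm, h1, h2] at h3
  nlinarith [mul_self_nonneg (z.1 0).re, mul_self_nonneg (z.1 0).im]

instance : ChartedSpace (ℂ × ℂ) CP21 where
  atlas := Set.range affineChart
  chartAt l := affineChart (exists_mem_affineDomain l).choose
  mem_chart_source l := (exists_mem_affineDomain l).choose_spec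
  chart_mem_atlas _ := Set.mem_range_self _

instance : IsManifold 𝓘(ℝ, ℂ × ℂ) ∞ CP21 := by
  apply isManifold_of_contDiffOn
  rintro _ _ ⟨k, rfl⟩ ⟨l, rfl⟩
  have key : ∀ w ∈ ((affineChart k).symm ≫ₕ affineChart l).source,
      ((affineChart k).symm ≫ₕ affineChart l) w = affineOf l (homog k w) ∧
        homog k w l.succ ≠ 0 := by
    intro w hw
    rw [OpenPartialHomeomorph.trans_source] at hw
    have hw1 : 0 < lenSq k w := hw.1
    have hw2 : (unitPoint k w).1 l.succ ≠ 0 := (hopf_mem_affineDomain l _).mp hw.2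
    have hc : ((Real.sqrt (lenSq k w) : ℂ)⁻¹) ≠ 0 :=
      inv_ne_zero (by exact_mod_cast (Real.sqrt_pos.mpr hw1).ne')
    refine ⟨?_, ?_⟩
    · change affineOf l (unitPoint k w).1 = _
      rw [unitPoint_val k hw1, affineOf_smul l hc]
    · rw [unitPoint_val k hw1] at hw2
      exact fun h0 => hw2 (by simp [h0])
  have hsm : ∀ i, ContDiff ℝ ∞ fun w => homog k w i := contDiff_pi.mp (contDiff_homog k)
  simp only [modelWithCornersSelf_coe, modelWithCornersSelf_coe_symm, Function.id_comp,
    Function.comp_id, Set.preimage_id, Set.range_id, Set.inter_univ]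
  refine ContDiffOn.congr (f := fun w => affineOf l (homog k w)) ?_ fun w hw => (key w hw).1
  have hne := fun w hw => (key w hw).2
  have hdiv : ∀ i, ContDiffOn ℝ ∞ (fun w => homog k w i / homog k w l.succ)
      ((affineChart k).symm ≫ₕ affineChart l).source := fun i => by
    simp only [div_eq_mul_inv]
    exact (hsm i).contDiffOn.mul ((hsm l.succ).contDiffOn.inv hne)
  fin_cases l
  · exact (hdiv 0).prodMk (hdiv 2)
  · exact (hdiv 0).prodMk (hdiv 1)

/-- The horizontal lift of the coordinate vector `v` at `w` to the point `z = s / √N` of the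
pseudosphere over `w`, where `s = homog k w` and `N = b(s, s)`: the vector of `ℂ³` that is
`b`-orthogonal to `z` and is sent to `v` by the differential of `z ↦ affineOf k z`. -/
def horizontalLift (k : Fin 2) (w : ℂ × ℂ) : ℂ × ℂ →L[ℝ] Fin 3 → ℂ :=
  (LinearMap.toContinuousLinearMap
    ({ toFun := fun v => ((Real.sqrt (lenSq k w) : ℂ)⁻¹) •
        (planeIncl k v - (herm (homog k w) (planeIncl k v) / lenSq k w) • homog k w)
       map_add' := by
        intro u v
        ext i
        simp [herm]
        ring
       map_smul' := by
        intro c v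
        ext i
        simp [herm]
        ring } : ℂ × ℂ →ₗ[ℂ] Fin 3 → ℂ)).restrictScalars ℝ

/-- The metric of `CP²₁(4)` in the chart `affineChart k`, for which the Hopf fibration is a
pseudo-Riemannian submersion. -/
def fubiniStudy (k : Fin 2) (w : ℂ × ℂ) : ℂ × ℂ →L[ℝ] ℂ × ℂ →L[ℝ] ℝ :=
  reHerm.bilinearComp (horizontalLift k w) (horizontalLift k w)

/-- The complex linear automorphisms of `ℂ³` preserving the form `b`. -/
structure U12 where
  toEquiv : (Fin 3 → ℂ) ≃ₗ[ℂ] (Fin 3 → ℂ)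
  map_herm : ∀ z w, herm (toEquiv z) (toEquiv w) = herm z w

/-- The holomorphic isometry of `CP²₁(4)` induced by an element of `U(1,2)`. -/
def U12.congruence (A : U12) : CP21 → CP21 :=
  Quotient.map (fun z : S52 => (⟨A.toEquiv z.1, (A.map_herm _ _).trans z.2⟩ : S52)) (by
    rintro z w ⟨c, hc, h⟩
    exact ⟨c, hc, by simp [h]⟩)

/-! ### Surfaces in the Lorentzian complex projective plane -/

section Surfaces

variable {M : Type*} [TopologicalSpace M] [ChartedSpace (EuclideanSpace ℝ (Fin 2)) M]

/-- The property `P` of a metric and a parametrized surface at a point of its domain holds for all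
the expressions of `L` in the charts of the surface `M` and the affine charts of `CP²₁(4)`. -/
def InCharts (L : M → CP21)
    (P : (ℂ × ℂ → ℂ × ℂ →L[ℝ] ℂ × ℂ →L[ℝ] ℝ) → (EuclideanSpace ℝ (Fin 2) → ℂ × ℂ) →
      EuclideanSpace ℝ (Fin 2) → Prop) : Prop :=
  ∀ φ ∈ IsManifold.maximalAtlas (𝓡 2) ∞ M, ∀ k : Fin 2, ∀ u ∈ φ.target,
    L (φ.symm u) ∈ (affineChart k).source →
      P (fubiniStudy k) (fun y => affineChart k (L (φ.symm y))) u

/-- `e₁, e₂` is a pseudo-orthonormal frame at `u` for the metric induced by `g` through `f`, and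
`P e₁ = sinh α • e₁`, `P e₂ = - sinh α • e₂`, where `P X` is the tangential part of `J X`; that is,
`α` is the Wirtinger angle. Here `J` is the multiplication by `i` in affine coordinates. -/
def IsWirtingerAngle (α : ℝ) (g : ℂ × ℂ → ℂ × ℂ →L[ℝ] ℂ × ℂ →L[ℝ] ℝ)
    (f : EuclideanSpace ℝ (Fin 2) → ℂ × ℂ) (u : EuclideanSpace ℝ (Fin 2)) : Prop :=
  ∃ e₁ e₂ : EuclideanSpace ℝ (Fin 2),
    inducedMetric g f u e₁ e₁ = 0 ∧ inducedMetric g f u e₂ e₂ = 0 ∧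
    inducedMetric g f u e₁ e₂ = -1 ∧
    (∀ X, g (f u) (Complex.I • fderiv ℝ f u e₁ - fderiv ℝ f u (Real.sinh α • e₁))
      (fderiv ℝ f u X) = 0) ∧
    (∀ X, g (f u) (Complex.I • fderiv ℝ f u e₂ - fderiv ℝ f u (-Real.sinh α • e₂))
      (fderiv ℝ f u X) = 0)

/-- A slant surface: a Lorentzian surface with constant Wirtinger angle. -/
def IsSlant (L : M → CP21) : Prop := ∃ θ : ℝ, InCharts L (IsWirtingerAngle θ)

/-- The mean curvature vector vanishes identically. -/
def IsMinimal (L : M → CP21) : Prop := InCharts L fun g f u => meanCurvature g f u = 0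

/-- The curvature tensor of the induced metric vanishes identically. -/
def IsFlat (L : M → CP21) : Prop :=
  InCharts L fun g f u => ∀ X Y Z, curvature (inducedMetric g f) u X Y Z = 0

/-- `J` maps each tangent plane of the surface into the normal plane. -/
def IsLagrangian (L : M → CP21) : Prop :=
  InCharts L fun g f u => ∀ X Y, g (f u) (Complex.I • fderiv ℝ f u X) (fderiv ℝ f u Y) = 0

end Surfaces

/-- The explicit map
`(x, y) ↦ (1/√3) (√2 e^{i(x-a²y)/(2a)} sinh (√3(x+a²y)/(2a)), e^{i(a²y-x)/a},
  √2 e^{i(x-a²y)/(2a)} cosh (√3(x+a²y)/(2a)))` into the pseudosphere. -/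
def Ltilde (a x y : ℝ) : S52 :=
  ⟨((1 / Real.sqrt 3 : ℝ) : ℂ) •
    ![((Real.sqrt 2 : ℝ) : ℂ) * Complex.exp ((((x - a ^ 2 * y) / (2 * a) : ℝ) : ℂ) * Complex.I)
        * ((Real.sinh (Real.sqrt 3 * (x + a ^ 2 * y) / (2 * a)) : ℝ) : ℂ),
      Complex.exp ((((a ^ 2 * y - x) / a : ℝ) : ℂ) * Complex.I),
      ((Real.sqrt 2 : ℝ) : ℂ) * Complex.exp ((((x - a ^ 2 * y) / (2 * a) : ℝ) : ℂ) * Complex.I)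
        * ((Real.cosh (Real.sqrt 3 * (x + a ^ 2 * y) / (2 * a)) : ℝ) : ℂ)], by
    have h3 : (1 / Real.sqrt 3) * (1 / Real.sqrt 3) = 1 / 3 := by
      rw [div_mul_div_comm, Real.mul_self_sqrt (by norm_num)]; norm_num
    have h2 : Real.sqrt 2 * Real.sqrt 2 = 2 := Real.mul_self_sqrt (by norm_num)
    have hcs := Real.cosh_sq (Real.sqrt 3 * (x + a ^ 2 * y) / (2 * a))
    rw [herm_smul_smul, Complex.conj_ofReal, ← Complex.ofReal_mul, h3]
    generalize Real.sqrt 3 * (x + a ^ 2 * y) / (2 * a) = t at *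
    have he : ∀ s : ℝ, conj (Complex.exp ((s : ℂ) * Complex.I)) * Complex.exp ((s : ℂ) * Complex.I)
        = 1 := by
      intro s
      rw [Complex.conj_mul', Complex.norm_exp_ofReal_mul_I]; simp
    have h2' : ((Real.sqrt 2 : ℝ) : ℂ) * ((Real.sqrt 2 : ℝ) : ℂ) = 2 := by exact_mod_cast h2
    have hcs' : ((Real.cosh t : ℝ) : ℂ) ^ 2 = ((Real.sinh t : ℝ) : ℂ) ^ 2 + 1 := by
      exact_mod_cast hcs
    have e1 := he ((x - a ^ 2 * y) / (2 * a))
    have e2 := he ((a ^ 2 * y - x) / a)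
    generalize Complex.exp ((((x - a ^ 2 * y) / (2 * a) : ℝ) : ℂ) * Complex.I) = p at *
    generalize Complex.exp ((((a ^ 2 * y - x) / a : ℝ) : ℂ) * Complex.I) = q at *
    simp only [herm, Matrix.cons_val_zero, Matrix.cons_val_one, Matrix.cons_val, map_mul,
      Complex.conj_ofReal]
    push_cast at hcs' h2' ⊢
    linear_combination (1 / 3 : ℂ) * (Complex.cosh t ^ 2 - Complex.sinh t ^ 2) *
      ((((Real.sqrt 2 : ℝ) : ℂ) * ((Real.sqrt 2 : ℝ) : ℂ)) * e1 + h2') + (1 / 3 : ℂ) * e2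
      + (2 / 3 : ℂ) * hcs'⟩

end SlantCP

end


/-!
Where the surface lies in an affine chart, flat null coordinates `x, y` and the Hopf fibration
give a lift `z` to the pseudosphere. The horizontal parts `X, Y` of `∂₁z, ∂₂z` are null, and `β =
b(X, Y) = -1 ± i sinh θ` is constant. Minimality makes the covariant derivatives of `X` along `∂₂`
and of `Y` along `∂₁` vertical, so that the second fundamental form has only two coefficients, `p`
along `∂₁, ∂₁` and `q` along `∂₂, ∂₂`. The Gauss equations for `X` and `Y` read `pq = β - 2 β̄`
and `pq = β̄ - 2 β`; hence `β` is real, `sinh θ = 0` and `pq = 1`. The Codazzi equations then make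
`p` and `q` constant, a rescaling `(s x, s⁻¹ y)` normalizes them to `i` and `-i`, and after a
change of phase the lift solves the same linear system with constant coefficients as `Ltilde 1`.
So both differ by a unitary map. On overlaps, parameters of the model can only be changed by a
symmetry of this system, which allows the unitary map to be continued along the connected surface.
-/

open scoped Manifold ContDiff ComplexConjugate

noncomputable section

namespace SlantCP

local notation "ℝ²" => EuclideanSpace ℝ (Fin 2)

local notation "𝐞₀" => EuclideanSpace.single (0 : Fin 2) (1 : ℝ)

local notation "𝐞₁" => EuclideanSpace.single (1 : Fin 2) (1 : ℝ)

/-! ### The Hermitian form -/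

lemma herm_add_left (x y z : Fin 3 → ℂ) : herm (x + y) z = herm x z + herm y z := by
  simp only [herm, Pi.add_apply, map_add]; ring

lemma herm_add_right (x y z : Fin 3 → ℂ) : herm x (y + z) = herm x y + herm x z := by
  simp only [herm, Pi.add_apply]; ring

lemma herm_smul_left (c : ℂ) (x y : Fin 3 → ℂ) : herm (c • x) y = conj c * herm x y := by
  simp only [herm, Pi.smul_apply, smul_eq_mul, map_mul]; ring

lemma herm_smul_right (c : ℂ) (x y : Fin 3 → ℂ) : herm x (c • y) = c * herm x y := by
  simp only [herm, Pi.smul_apply, smul_eq_mul]; ring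

lemma herm_real_smul_left (c : ℝ) (x y : Fin 3 → ℂ) : herm (c • x) y = c * herm x y := by
  rw [← Complex.coe_smul, herm_smul_left, Complex.conj_ofReal]

lemma herm_real_smul_right (c : ℝ) (x y : Fin 3 → ℂ) : herm x (c • y) = c * herm x y := by
  rw [← Complex.coe_smul, herm_smul_right]

/-- `herm` as a continuous real bilinear map. -/
def hermL : (Fin 3 → ℂ) →L[ℝ] (Fin 3 → ℂ) →L[ℝ] ℂ :=
  (LinearMap.mk₂ ℝ herm herm_add_left (fun c x y => by rw [herm_real_smul_left, Complex.real_smul])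
    herm_add_right (fun c x y => by rw [herm_real_smul_right, Complex.real_smul])
    ).toContinuousBilinearMap

@[simp] lemma hermL_apply (x y : Fin 3 → ℂ) : hermL x y = herm x y := rfl

lemma herm_sub_left (x y z : Fin 3 → ℂ) : herm (x - y) z = herm x z - herm y z :=
  hermL.map_sub₂ x y z

lemma herm_sub_right (x y z : Fin 3 → ℂ) : herm x (y - z) = herm x y - herm x z :=
  (hermL x).map_sub y z

lemma herm_neg_left (x y : Fin 3 → ℂ) : herm (-x) y = -herm x y :=
  hermL.map_neg₂ x y

lemma herm_neg_right (x y : Fin 3 → ℂ) : herm x (-y) = -herm x y :=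
  (hermL x).map_neg y

@[simp] lemma herm_zero_right (x : Fin 3 → ℂ) : herm x 0 = 0 :=
  (hermL x).map_zero

lemma conj_herm (x y : Fin 3 → ℂ) : conj (herm x y) = herm y x := by
  simp only [herm, map_add, map_neg, map_mul, Complex.conj_conj]; ring

lemma herm_re_comm (x y : Fin 3 → ℂ) : (herm x y).re = (herm y x).re := by
  rw [← conj_herm, Complex.conj_re]

lemma eq_zero_of_forall_herm_eq_zero {v : Fin 3 → ℂ} (hv : ∀ w, herm w v = 0) : v = 0 := by
  ext i
  have hi := hv (Pi.single i 1)
  fin_cases i <;> simpa [herm] using hi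

/-- A basis `z, X, Y` of `ℂ³` whose only nonzero products under `herm` are `b(z, z) = 1` and
`b(X, Y) = β`, for some `β ≠ 0`: a point of the pseudosphere together with the horizontal lifts of
two null vectors. -/
structure IsNullFrame (β : ℂ) (z X Y : Fin 3 → ℂ) : Prop where
  ne_zero : β ≠ 0
  zz : herm z z = 1
  zX : herm z X = 0
  zY : herm z Y = 0
  XX : herm X X = 0
  YY : herm Y Y = 0
  XY : herm X Y = β

namespace IsNullFrame

variable {β : ℂ} {z X Y : Fin 3 → ℂ}

lemma Xz (h : IsNullFrame β z X Y) : herm X z = 0 := by rw [← conj_herm, h.zX, map_zero]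

lemma Yz (h : IsNullFrame β z X Y) : herm Y z = 0 := by rw [← conj_herm, h.zY, map_zero]

lemma YX (h : IsNullFrame β z X Y) : herm Y X = conj β := by rw [← conj_herm, h.XY]

lemma herm_combination (h : IsNullFrame β z X Y) (a b c : ℂ) :
    herm z (a • z + b • X + c • Y) = a ∧ herm X (a • z + b • X + c • Y) = c * β ∧
      herm Y (a • z + b • X + c • Y) = b * conj β := by
  simp only [herm_add_right, herm_smul_right, h.zz, h.zX, h.zY, h.XX, h.YY, h.XY, h.Xz, h.Yz, h.YX]
  exact ⟨by ring, by ring, by ring⟩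

lemma linearIndependent (h : IsNullFrame β z X Y) : LinearIndependent ℂ ![z, X, Y] := by
  have hβ := h.ne_zero
  refine Fintype.linearIndependent_iff.mpr fun g hg => ?_
  obtain ⟨hz, hX, hY⟩ := h.herm_combination (g 0) (g 1) (g 2)
  have hsum : g 0 • z + g 1 • X + g 2 • Y = 0 := by simpa [Fin.sum_univ_three] using hg
  rw [hsum, herm_zero_right] at hz hX hY
  intro i
  fin_cases i
  · exact hz.symm
  · simpa [hβ] using hY.symm
  · simpa [hβ] using hX.symm

lemma exists_eq_combination (h : IsNullFrame β z X Y) (v : Fin 3 → ℂ) :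
    ∃ a b c : ℂ, a • z + b • X + c • Y = v := by
  have hspan := h.linearIndependent.span_eq_top_of_card_eq_finrank (by simp)
  have hv : v ∈ Submodule.span ℂ (Set.range ![z, X, Y]) := hspan ▸ Submodule.mem_top
  obtain ⟨g, hg⟩ := (Submodule.mem_span_range_iff_exists_fun ℂ).mp hv
  exact ⟨g 0, g 1, g 2, by simpa [Fin.sum_univ_three] using hg⟩

lemma eq_zero (h : IsNullFrame β z X Y) {v : Fin 3 → ℂ} (hz : herm z v = 0) (hX : herm X v = 0)
    (hY : herm Y v = 0) : v = 0 := by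
  have hβ := h.ne_zero
  obtain ⟨a, b, c, rfl⟩ := h.exists_eq_combination v
  obtain ⟨hz', hX', hY'⟩ := h.herm_combination a b c
  obtain rfl : a = 0 := hz'.symm.trans hz
  obtain rfl : b = 0 := by simpa [hβ] using hY'.symm.trans hY
  obtain rfl : c = 0 := by simpa [hβ] using hX'.symm.trans hX
  simp

lemma ext (h : IsNullFrame β z X Y) {v w : Fin 3 → ℂ} (hz : herm z v = herm z w)
    (hX : herm X v = herm X w) (hY : herm Y v = herm Y w) : v = w :=
  sub_eq_zero.mp (h.eq_zero (by rw [herm_sub_right, hz, sub_self])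
    (by rw [herm_sub_right, hX, sub_self]) (by rw [herm_sub_right, hY, sub_self]))

lemma expand (h : IsNullFrame (-1) z X Y) (v : Fin 3 → ℂ) :
    herm z v • z - herm Y v • X - herm X v • Y = v := by
  apply h.ext <;>
    simp [herm_sub_right, herm_smul_right, h.zz, h.zX, h.zY, h.XX, h.YY, h.XY, h.Xz, h.Yz, h.YX]

lemma herm_eq (h : IsNullFrame (-1) z X Y) (v w : Fin 3 → ℂ) :
    herm v w = conj (herm z v) * herm z w - conj (herm Y v) * herm X w
      - conj (herm X v) * herm Y w := by
  conv_lhs => rw [← h.expand w]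
  simp only [herm_sub_right, herm_smul_right, conj_herm]
  ring

end IsNullFrame

/-- The element of the unitary group given by a linear map that preserves `herm`; such a map is
injective because `herm` is nondegenerate. -/
def U12.ofMapHerm (A : (Fin 3 → ℂ) →ₗ[ℂ] (Fin 3 → ℂ)) (hA : ∀ v w, herm (A v) (A w) = herm v w) :
    U12 where
  toEquiv := LinearEquiv.ofInjectiveEndo A ((injective_iff_map_eq_zero A).mpr fun v hv =>
    eq_zero_of_forall_herm_eq_zero fun w => by rw [← hA, hv, herm_zero_right])
  map_herm := hA

lemma U12.ofMapHerm_apply (A : (Fin 3 → ℂ) →ₗ[ℂ] (Fin 3 → ℂ))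
    (hA : ∀ v w, herm (A v) (A w) = herm v w) (v : Fin 3 → ℂ) :
    (U12.ofMapHerm A hA).toEquiv v = A v := rfl

lemma U12.congruence_hopf (A : U12) (z : S52) :
    A.congruence (hopf z) = hopf ⟨A.toEquiv z.1, (A.map_herm _ _).trans z.2⟩ := rfl

lemma hopf_eq_iff {z w : S52} : hopf z = hopf w ↔ ∃ c : ℂ, c ≠ 0 ∧ w.1 = c • z.1 :=
  Quotient.eq (r := hopfSetoid)

/-! ### Partial derivatives in the plane -/

section Partials

variable {E : Type*} [NormedAddCommGroup E] [NormedSpace ℝ E]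
variable {E' : Type*} [NormedAddCommGroup E'] [NormedSpace ℝ E']
variable {E'' : Type*} [NormedAddCommGroup E''] [NormedSpace ℝ E'']

lemma eq_smul_add_smul (v : ℝ²) : v = v 0 • 𝐞₀ + v 1 • 𝐞₁ := by
  ext i; fin_cases i <;> simp

lemma map_eq_smul_add_smul (A : ℝ² →L[ℝ] E) (v : ℝ²) : A v = v 0 • A 𝐞₀ + v 1 • A 𝐞₁ := by
  conv_lhs => rw [eq_smul_add_smul v]
  simp

/-- The linear map on the plane with values `P` and `Q` on the two basis vectors, that is, the
derivative `P dx + Q dy`. -/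
def ofPartials (P Q : E) : ℝ² →L[ℝ] E :=
  (EuclideanSpace.proj (𝕜 := ℝ) (0 : Fin 2)).smulRight P
    + (EuclideanSpace.proj (𝕜 := ℝ) (1 : Fin 2)).smulRight Q

lemma ofPartials_apply (P Q : E) (v : ℝ²) : ofPartials P Q v = v 0 • P + v 1 • Q := rfl

@[simp] lemma ofPartials_zero_left_right : ofPartials (0 : E) 0 = 0 := by
  ext v; simp [ofPartials_apply]

@[simp] lemma ofPartials_single_zero (P Q : E) : ofPartials P Q 𝐞₀ = P := by
  simp [ofPartials_apply]

@[simp] lemma ofPartials_single_one (P Q : E) : ofPartials P Q 𝐞₁ = Q := by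
  simp [ofPartials_apply]

lemma ofPartials_map_single (A : ℝ² →L[ℝ] E) : ofPartials (A 𝐞₀) (A 𝐞₁) = A := by
  ext v
  rw [ofPartials_apply, ← map_eq_smul_add_smul]

/-- `F` is differentiable at `u`, with partial derivatives `P` and `Q`. -/
def HasPartialsAt (F : ℝ² → E) (P Q : E) (u : ℝ²) : Prop :=
  HasFDerivAt F (ofPartials P Q) u

variable {F G : ℝ² → E} {P Q P' Q' : E} {u : ℝ²}

namespace HasPartialsAt

lemma congr (h : HasPartialsAt F P Q u) (hP : P = P') (hQ : Q = Q') : HasPartialsAt F P' Q' u := by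
  rwa [← hP, ← hQ]

lemma fderiv_single_zero (h : HasPartialsAt F P Q u) : fderiv ℝ F u 𝐞₀ = P := by
  rw [HasFDerivAt.fderiv h, ofPartials_single_zero]

lemma fderiv_single_one (h : HasPartialsAt F P Q u) : fderiv ℝ F u 𝐞₁ = Q := by
  rw [HasFDerivAt.fderiv h, ofPartials_single_one]

lemma unique (h : HasPartialsAt F P Q u) (h' : HasPartialsAt F P' Q' u) : P = P' ∧ Q = Q' :=
  ⟨h.fderiv_single_zero.symm.trans h'.fderiv_single_zero,
    h.fderiv_single_one.symm.trans h'.fderiv_single_one⟩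

lemma congr_of_eventuallyEq (h : HasPartialsAt F P Q u) (hG : G =ᶠ[nhds u] F) :
    HasPartialsAt G P Q u :=
  HasFDerivAt.congr_of_eventuallyEq h hG

lemma of_hasFDerivAt {A : ℝ² →L[ℝ] E} (h : HasFDerivAt F A u) (hP : A 𝐞₀ = P) (hQ : A 𝐞₁ = Q) :
    HasPartialsAt F P Q u := by
  rwa [HasPartialsAt, ← hP, ← hQ, ofPartials_map_single]

lemma of_differentiableAt (h : DifferentiableAt ℝ F u) :
    HasPartialsAt F (fderiv ℝ F u 𝐞₀) (fderiv ℝ F u 𝐞₁) u :=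
  of_hasFDerivAt h.hasFDerivAt rfl rfl

lemma const (c : E) : HasPartialsAt (fun _ => c) 0 0 u :=
  of_hasFDerivAt (hasFDerivAt_const c u) rfl rfl

lemma add (h : HasPartialsAt F P Q u) (h' : HasPartialsAt G P' Q' u) :
    HasPartialsAt (fun x => F x + G x) (P + P') (Q + Q') u :=
  of_hasFDerivAt (HasFDerivAt.fun_add h h') (by simp) (by simp)

lemma sub (h : HasPartialsAt F P Q u) (h' : HasPartialsAt G P' Q' u) :
    HasPartialsAt (fun x => F x - G x) (P - P') (Q - Q') u :=
  of_hasFDerivAt (HasFDerivAt.fun_sub h h') (by simp) (by simp)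

lemma bilin (B : E →L[ℝ] E' →L[ℝ] E'') (h : HasPartialsAt F P Q u) {F' : ℝ² → E'} {R S : E'}
    (h' : HasPartialsAt F' R S u) :
    HasPartialsAt (fun x => B (F x) (F' x)) (B P (F' u) + B (F u) R) (B Q (F' u) + B (F u) S) u :=
  of_hasFDerivAt (B.hasFDerivAt_of_bilinear h h') (by simp [add_comm]) (by simp [add_comm])

lemma clm (A : E →L[ℝ] E') (h : HasPartialsAt F P Q u) :
    HasPartialsAt (fun x => A (F x)) (A P) (A Q) u :=
  of_hasFDerivAt (A.hasFDerivAt.comp u h) (by simp) (by simp)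

lemma herm {F G : ℝ² → Fin 3 → ℂ} {P Q P' Q' : Fin 3 → ℂ} (h : HasPartialsAt F P Q u)
    (h' : HasPartialsAt G P' Q' u) :
    HasPartialsAt (fun x => herm (F x) (G x)) (SlantCP.herm P (G u) + SlantCP.herm (F u) P')
      (SlantCP.herm Q (G u) + SlantCP.herm (F u) Q') u :=
  h.bilin hermL h'

lemma smul [NormedSpace ℂ E] {c : ℝ² → ℂ} {c₁ c₂ : ℂ} (hc : HasPartialsAt c c₁ c₂ u)
    (h : HasPartialsAt F P Q u) :
    HasPartialsAt (fun x => c x • F x) (c₁ • F u + c u • P) (c₂ • F u + c u • Q) u :=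
  hc.bilin (ContinuousLinearMap.lsmul ℝ ℂ (E := E)) h

lemma const_smul [NormedSpace ℂ E] (c : ℂ) (h : HasPartialsAt F P Q u) :
    HasPartialsAt (fun x => c • F x) (c • P) (c • Q) u :=
  h.clm (ContinuousLinearMap.lsmul ℝ ℂ (E := E) c)

lemma mul {c d : ℝ² → ℂ} {c₁ c₂ d₁ d₂ : ℂ} (hc : HasPartialsAt c c₁ c₂ u)
    (hd : HasPartialsAt d d₁ d₂ u) :
    HasPartialsAt (fun x => c x * d x) (c₁ * d u + c u * d₁) (c₂ * d u + c u * d₂) u :=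
  hc.smul hd

lemma comp {T : ℝ² → ℝ²} {p q : ℝ²} (h : HasPartialsAt F P Q (T u)) (hT : HasPartialsAt T p q u) :
    HasPartialsAt (fun x => F (T x)) (p 0 • P + p 1 • Q) (q 0 • P + q 1 • Q) u :=
  of_hasFDerivAt (HasFDerivAt.comp u h hT) (by simp [ofPartials_apply]) (by simp [ofPartials_apply])

lemma eq_zero_of_const {D : Set ℝ²} (hD : IsOpen D) {c : E} (h : HasPartialsAt F P Q u)
    (hu : u ∈ D) (hc : ∀ v ∈ D, F v = c) : P = 0 ∧ Q = 0 :=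
  h.unique ((const c).congr_of_eventuallyEq (Filter.eventually_of_mem (hD.mem_nhds hu) hc))

end HasPartialsAt

lemma hasPartialsAt_of_contDiffOn {D : Set ℝ²} (hF : ContDiffOn ℝ ∞ F D) (hD : IsOpen D)
    (hu : u ∈ D) : HasPartialsAt F (fderiv ℝ F u 𝐞₀) (fderiv ℝ F u 𝐞₁) u :=
  .of_differentiableAt ((hF.contDiffAt (hD.mem_nhds hu)).differentiableAt (by simp))

lemma hasFDerivAt_ofPartials {P Q : ℝ² → E} {P₁ P₂ Q₁ Q₂ : E} (hP : HasPartialsAt P P₁ P₂ u)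
    (hQ : HasPartialsAt Q Q₁ Q₂ u) :
    HasFDerivAt (fun x => ofPartials (P x) (Q x))
      (ofPartials (ofPartials P₁ Q₁) (ofPartials P₂ Q₂)) u := by
  let inclusion (i : Fin 2) := ContinuousLinearMap.smulRightL ℝ ℝ² E (EuclideanSpace.proj i)
  refine HasFDerivAt.congr_fderiv (HasFDerivAt.add ((inclusion 0).hasFDerivAt.comp u hP)
    ((inclusion 1).hasFDerivAt.comp u hQ)) ?_
  ext v w
  simp [inclusion, ofPartials_apply]
  module

lemma HasPartialsAt.mixed_eq {D : Set ℝ²} (hD : IsOpen D) {P Q : ℝ² → E}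
    (hF : ∀ x ∈ D, HasPartialsAt F (P x) (Q x) x) (hu : u ∈ D) {P₁ P₂ Q₁ Q₂ : E}
    (hP : HasPartialsAt P P₁ P₂ u) (hQ : HasPartialsAt Q Q₁ Q₂ u) : P₂ = Q₁ := by
  have hsymm := second_derivative_symmetric_of_eventually
    (Filter.eventually_of_mem (hD.mem_nhds hu) hF) (hasFDerivAt_ofPartials hP hQ) 𝐞₁ 𝐞₀
  simpa using hsymm

lemma eq_of_partials_eq_zero {D : Set ℝ²} (hD : Convex ℝ D) (hF : ∀ u ∈ D, HasPartialsAt F 0 0 u)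
    {u v : ℝ²} (hu : u ∈ D) (hv : v ∈ D) : F u = F v := by
  have hle := hD.norm_image_sub_le_of_norm_hasFDerivWithin_le (C := 0)
    (fun x hx => HasFDerivAt.hasFDerivWithinAt (hF x hx)) (fun x _ => by simp) hv hu
  simpa [sub_eq_zero] using hle

lemma exists_potential [CompleteSpace E] {D : Set ℝ²} (hconv : Convex ℝ D) (hD : IsOpen D)
    {P Q R : ℝ² → E} {P₁ Q₂ : ℝ² → E} (hP : ∀ u ∈ D, HasPartialsAt P (P₁ u) (R u) u)
    (hQ : ∀ u ∈ D, HasPartialsAt Q (R u) (Q₂ u) u) :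
    ∃ F : ℝ² → E, ∀ u ∈ D, HasPartialsAt F (P u) (Q u) u := by
  have hderiv := fun u hu => hasFDerivAt_ofPartials (hP u hu) (hQ u hu)
  refine hconv.exists_forall_hasFDerivAt_of_fderiv_symmetric hD
    (fun u hu => (hderiv u hu).differentiableAt.differentiableWithinAt) fun u hu v w => ?_
  rw [(hderiv u hu).fderiv]
  simp only [ofPartials_apply, add_apply, smul_apply]
  module

end Partials

/-! ### The structure equations of the model surface -/

/-- The functions `F, X, Y` solve the structure equations of `Ltilde 1` on the set `D`. -/
structure IsModelSolution (D : Set ℝ²) (F X Y : ℝ² → Fin 3 → ℂ) : Prop where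
  frame : ∀ u ∈ D, IsNullFrame (-1) (F u) (X u) (Y u)
  dF : ∀ u ∈ D, HasPartialsAt F (X u) (Y u) u
  dX : ∀ u ∈ D, HasPartialsAt X (Complex.I • Y u) (F u) u
  dY : ∀ u ∈ D, HasPartialsAt Y (F u) (-Complex.I • X u) u

/-- The linear map that sends the null frame `F₀, X₀, Y₀` to `F, X, Y`. -/
def frameTransfer (F₀ X₀ Y₀ F X Y : Fin 3 → ℂ) : (Fin 3 → ℂ) →ₗ[ℂ] (Fin 3 → ℂ) where
  toFun v := herm F₀ v • F - herm Y₀ v • X - herm X₀ v • Y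
  map_add' v w := by simp only [herm_add_right, add_smul]; abel
  map_smul' c v := by simp only [herm_smul_right, mul_smul, smul_sub, RingHom.id_apply]

lemma frameTransfer_apply (F₀ X₀ Y₀ F X Y v : Fin 3 → ℂ) :
    frameTransfer F₀ X₀ Y₀ F X Y v = herm F₀ v • F - herm Y₀ v • X - herm X₀ v • Y := rfl

namespace IsNullFrame

variable {F X Y F₀ X₀ Y₀ : Fin 3 → ℂ}

lemma frameTransfer_self (h₀ : IsNullFrame (-1) F₀ X₀ Y₀) :
    frameTransfer F₀ X₀ Y₀ F X Y F₀ = F := by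
  simp [frameTransfer_apply, h₀.zz, h₀.Xz, h₀.Yz]

lemma herm_frameTransfer (h : IsNullFrame (-1) F X Y) (h₀ : IsNullFrame (-1) F₀ X₀ Y₀)
    (v w : Fin 3 → ℂ) :
    herm (frameTransfer F₀ X₀ Y₀ F X Y v) (frameTransfer F₀ X₀ Y₀ F X Y w) = herm v w := by
  rw [h₀.herm_eq v w]
  simp only [frameTransfer_apply, herm_sub_left, herm_sub_right, herm_smul_left, herm_smul_right,
    h.zz, h.zX, h.zY, h.XX, h.YY, h.XY, h.Xz, h.Yz, h.YX, map_neg, map_one]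
  ring

end IsNullFrame

namespace IsModelSolution

variable {D : Set ℝ²} {F X Y F₀ X₀ Y₀ : ℝ² → Fin 3 → ℂ}

lemma frameTransfer_const (hD : Convex ℝ D) (h : IsModelSolution D F X Y)
    (h₀ : IsModelSolution D F₀ X₀ Y₀) {u v : ℝ²} (hu : u ∈ D) (hv : v ∈ D) :
    frameTransfer (F₀ u) (X₀ u) (Y₀ u) (F u) (X u) (Y u)
      = frameTransfer (F₀ v) (X₀ v) (Y₀ v) (F v) (X v) (Y v) := by
  refine LinearMap.ext fun x => eq_of_partials_eq_zero
    (F := fun u => frameTransfer (F₀ u) (X₀ u) (Y₀ u) (F u) (X u) (Y u) x) hD (fun w hw => ?_) hu hv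
  have hx := HasPartialsAt.const (u := w) x
  refine HasPartialsAt.congr (((((h₀.dF w hw).herm hx).smul (h.dF w hw)).sub
    (((h₀.dY w hw).herm hx).smul (h.dX w hw))).sub (((h₀.dX w hw).herm hx).smul (h.dY w hw))) ?_ ?_
  · simp only [herm_zero_right, add_zero, herm_smul_left, smul_smul, Complex.conj_I]
    module
  · simp only [herm_zero_right, add_zero, herm_smul_left, smul_smul, map_neg, Complex.conj_I]
    module

lemma exists_unitary (hD : Convex ℝ D) (h : IsModelSolution D F X Y)
    (h₀ : IsModelSolution D F₀ X₀ Y₀) (hne : D.Nonempty) :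
    ∃ A : U12, ∀ u ∈ D, F u = A.toEquiv (F₀ u) := by
  obtain ⟨u₀, hu₀⟩ := hne
  refine ⟨U12.ofMapHerm _ ((h.frame u₀ hu₀).herm_frameTransfer (h₀.frame u₀ hu₀)), fun u hu => ?_⟩
  rw [U12.ofMapHerm_apply, h.frameTransfer_const hD h₀ hu₀ hu, (h₀.frame u hu).frameTransfer_self]

lemma eqOn (hD : Convex ℝ D) (h : IsModelSolution D F X Y) (h₀ : IsModelSolution D F₀ X₀ Y₀)
    {u₀ : ℝ²} (hu₀ : u₀ ∈ D) (hF : F u₀ = F₀ u₀) (hX : X u₀ = X₀ u₀) (hY : Y u₀ = Y₀ u₀) :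
    Set.EqOn F F₀ D := by
  intro u hu
  rw [← (h₀.frame u hu).frameTransfer_self (F := F u) (X := X u) (Y := Y u),
    h.frameTransfer_const hD h₀ hu hu₀, hF, hX, hY, frameTransfer_apply,
    (h₀.frame u₀ hu₀).expand]

end IsModelSolution

/-! ### The model surface -/

lemma hasPartialsAt_coord_zero (u : ℝ²) : HasPartialsAt (fun u => ((u 0 : ℝ) : ℂ)) 1 0 u :=
  .of_hasFDerivAt (Complex.ofRealCLM.comp (EuclideanSpace.proj (0 : Fin 2))).hasFDerivAt
    (by simp) (by simp)

lemma hasPartialsAt_coord_one (u : ℝ²) : HasPartialsAt (fun u => ((u 1 : ℝ) : ℂ)) 0 1 u :=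
  .of_hasFDerivAt (Complex.ofRealCLM.comp (EuclideanSpace.proj (1 : Fin 2))).hasFDerivAt
    (by simp) (by simp)

lemma HasPartialsAt.cexp {c : ℝ² → ℂ} {c₁ c₂ : ℂ} {u : ℝ²} (h : HasPartialsAt c c₁ c₂ u) :
    HasPartialsAt (fun u => Complex.exp (c u)) (Complex.exp (c u) * c₁) (Complex.exp (c u) * c₂)
      u :=
  of_hasFDerivAt (HasFDerivAt.cexp h) (by simp) (by simp)

lemma HasPartialsAt.vec3 {c d e : ℝ² → ℂ} {c₁ c₂ d₁ d₂ e₁ e₂ : ℂ} {u : ℝ²}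
    (hc : HasPartialsAt c c₁ c₂ u) (hd : HasPartialsAt d d₁ d₂ u) (he : HasPartialsAt e e₁ e₂ u) :
    HasPartialsAt (fun u => ![c u, d u, e u]) ![c₁, d₁, e₁] ![c₂, d₂, e₂] u := by
  refine hasFDerivAt_pi'.mpr fun i => ?_
  fin_cases i
  · exact HasFDerivAt.congr_fderiv hc (by ext v; simp [ofPartials_apply])
  · exact HasFDerivAt.congr_fderiv hd (by ext v; simp [ofPartials_apply])
  · exact HasFDerivAt.congr_fderiv he (by ext v; simp [ofPartials_apply])

/-- The function `e^{μx + μ̄y}`. -/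
def planeExp (μ : ℂ) (u : ℝ²) : ℂ :=
  Complex.exp (μ * (u 0 : ℝ) + conj μ * (u 1 : ℝ))

lemma hasPartialsAt_planeExp (μ : ℂ) (u : ℝ²) :
    HasPartialsAt (planeExp μ) (μ * planeExp μ u) (conj μ * planeExp μ u) u :=
  (((hasPartialsAt_coord_zero u).const_smul μ).add
    ((hasPartialsAt_coord_one u).const_smul (conj μ))).cexp.congr
      (by simp [planeExp, mul_comm]) (by simp [planeExp, mul_comm])

lemma conj_planeExp_mul (μ : ℂ) (u : ℝ²) : conj (planeExp μ u) * planeExp (-conj μ) u = 1 := by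
  rw [planeExp, planeExp, ← Complex.exp_conj, ← Complex.exp_add, Complex.exp_eq_one_iff]
  exact ⟨0, by simp; ring⟩

lemma mul_conj_eq_one_of_pow_three_eq_I {μ : ℂ} (hμ : μ ^ 3 = Complex.I) : μ * conj μ = 1 := by
  have hnorm : ‖μ‖ = 1 := by
    rw [← pow_eq_one_iff_of_nonneg (norm_nonneg μ) three_ne_zero, ← norm_pow, hμ, Complex.norm_I]
  rw [Complex.mul_conj', hnorm]; simp

lemma sq_eq_of_pow_three_eq_I {μ : ℂ} (hμ : μ ^ 3 = Complex.I) : μ ^ 2 = Complex.I * conj μ := by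
  linear_combination conj μ * hμ - μ ^ 2 * mul_conj_eq_one_of_pow_three_eq_I hμ

lemma conj_sq_eq_of_pow_three_eq_I {μ : ℂ} (hμ : μ ^ 3 = Complex.I) :
    conj μ ^ 2 = -Complex.I * μ := by
  simpa using congrArg conj (sq_eq_of_pow_three_eq_I hμ)

/-- The cube root `e^{iπ/6}` of `i`; the other two are `-conj modelRoot` and `-i`. -/
def modelRoot : ℂ := (((Real.sqrt 3 : ℝ) : ℂ) + Complex.I) / 2

lemma ofReal_sqrt_three_sq : ((Real.sqrt 3 : ℝ) : ℂ) ^ 2 = 3 := by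
  rw [← Complex.ofReal_pow, Real.sq_sqrt (by norm_num)]; norm_num

lemma ofReal_sqrt_two_sq : ((Real.sqrt 2 : ℝ) : ℂ) ^ 2 = 2 := by
  rw [← Complex.ofReal_pow, Real.sq_sqrt (by norm_num)]; norm_num

lemma conj_modelRoot : conj modelRoot = (((Real.sqrt 3 : ℝ) : ℂ) - Complex.I) / 2 := by
  simp [modelRoot, sub_eq_add_neg, Complex.conj_ofNat]

lemma modelRoot_pow_three : modelRoot ^ 3 = Complex.I := by
  rw [modelRoot]
  linear_combination (((Real.sqrt 3 : ℝ) : ℂ) + 3 * Complex.I) / 8 * ofReal_sqrt_three_sq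
    + (3 * ((Real.sqrt 3 : ℝ) : ℂ) + Complex.I) / 8 * Complex.I_sq

/-- The combination with coefficients `c, d, e` of the three exponentials `e^{μx + μ̄y}` with
`μ³ = i`, along a fixed basis of `ℂ³` that makes `modelCurve 1 1 1` equal to `Ltilde 1`. -/
def modelCurve (c d e : ℂ) (u : ℝ²) : Fin 3 → ℂ :=
  ((1 / Real.sqrt 3 : ℝ) : ℂ) •
    ![((Real.sqrt 2 : ℝ) : ℂ) / 2 * (c * planeExp modelRoot u - d * planeExp (-conj modelRoot) u),
      e * planeExp (-Complex.I) u,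
      ((Real.sqrt 2 : ℝ) : ℂ) / 2 * (c * planeExp modelRoot u + d * planeExp (-conj modelRoot) u)]

lemma smul_modelCurve (a c d e : ℂ) (u : ℝ²) :
    a • modelCurve c d e u = modelCurve (a * c) (a * d) (a * e) u := by
  ext i; fin_cases i <;> simp [modelCurve] <;> ring

lemma hasPartialsAt_modelCurve (c d e : ℂ) (u : ℝ²) :
    HasPartialsAt (modelCurve c d e)
      (modelCurve (modelRoot * c) (-conj modelRoot * d) (-Complex.I * e) u)
      (modelCurve (conj modelRoot * c) (-modelRoot * d) (Complex.I * e) u) u := by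
  have hc := (hasPartialsAt_planeExp modelRoot u).const_smul c
  have hd := (hasPartialsAt_planeExp (-conj modelRoot) u).const_smul d
  have he := (hasPartialsAt_planeExp (-Complex.I) u).const_smul e
  refine ((((hc.sub hd).const_smul _).vec3 he ((hc.add hd).const_smul _)).const_smul _).congr
      ?_ ?_ <;>
  · rw [modelCurve]
    congr 1
    ext i; fin_cases i <;> simp <;> ring

lemma herm_modelCurve (c d e c' d' e' : ℂ) (u : ℝ²) :
    herm (modelCurve c d e u) (modelCurve c' d' e' u)
      = (conj c * d' + conj d * c' + conj e * e') / 3 := by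
  have hcd := conj_planeExp_mul modelRoot u
  have hdc := conj_planeExp_mul (-conj modelRoot) u
  have hee := conj_planeExp_mul (-Complex.I) u
  have hthird : ((1 / Real.sqrt 3 : ℝ) : ℂ) * ((1 / Real.sqrt 3 : ℝ) : ℂ) = 1 / 3 := by
    rw [← sq, Complex.ofReal_div, div_pow, ofReal_sqrt_three_sq]; simp
  simp only [map_neg, Complex.conj_conj, Complex.conj_I, neg_neg] at hdc hee
  rw [modelCurve, modelCurve, herm_smul_smul, Complex.conj_ofReal, hthird]
  simp only [herm, Matrix.cons_val_zero, Matrix.cons_val_one, Matrix.cons_val, map_mul, map_sub,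
    map_add, map_div₀, Complex.conj_ofReal, Complex.conj_ofNat]
  linear_combination (conj c * d' / 3) * hcd + (conj d * c' / 3) * hdc + conj e * e' / 3 * hee
    + (conj c * d' * conj (planeExp modelRoot u) * planeExp (-conj modelRoot) u
      + conj d * c' * conj (planeExp (-conj modelRoot) u) * planeExp modelRoot u) / 6
      * ofReal_sqrt_two_sq

lemma modelCurve_eq_Ltilde (u : ℝ²) : modelCurve 1 1 1 u = (Ltilde 1 (u 0) (u 1)).1 := by
  have hroot : planeExp modelRoot u
      = Complex.exp ((((u 0 - 1 ^ 2 * u 1) / (2 * 1) : ℝ) : ℂ) * Complex.I)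
        * Complex.exp (((Real.sqrt 3 * (u 0 + 1 ^ 2 * u 1) / (2 * 1) : ℝ) : ℂ)) := by
    rw [planeExp, ← Complex.exp_add, conj_modelRoot, modelRoot]
    congr 1; push_cast; ring
  have hneg_conj : planeExp (-conj modelRoot) u
      = Complex.exp ((((u 0 - 1 ^ 2 * u 1) / (2 * 1) : ℝ) : ℂ) * Complex.I)
        * Complex.exp (-((Real.sqrt 3 * (u 0 + 1 ^ 2 * u 1) / (2 * 1) : ℝ) : ℂ)) := by
    rw [planeExp, ← Complex.exp_add, map_neg, Complex.conj_conj, conj_modelRoot, modelRoot]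
    congr 1; push_cast; ring
  have hneg_I : planeExp (-Complex.I) u
      = Complex.exp ((((1 ^ 2 * u 1 - u 0) / 1 : ℝ) : ℂ) * Complex.I) := by
    rw [planeExp, map_neg, Complex.conj_I]
    congr 1; push_cast; ring
  simp only [modelCurve, Ltilde, hroot, hneg_conj, hneg_I, Complex.ofReal_sinh,
    Complex.ofReal_cosh, Complex.sinh, Complex.cosh]
  congr 1
  ext i
  fin_cases i
  · simp only [Fin.zero_eta, Matrix.cons_val_zero]; ring
  · simp
  · simp only [Fin.reduceFinMk, Matrix.cons_val]; ring

lemma isModelSolution_modelCurve (D : Set ℝ²) :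
    IsModelSolution D (modelCurve 1 1 1)
      (modelCurve modelRoot (-conj modelRoot) (-Complex.I))
      (modelCurve (conj modelRoot) (-modelRoot) Complex.I) where
  frame u _ := by
    constructor
    · norm_num
    all_goals
      rw [herm_modelCurve]
      simp only [map_neg, map_one, Complex.conj_I, Complex.conj_conj]
      try rw [conj_modelRoot, modelRoot]
    · norm_num
    · ring
    · ring
    · linear_combination -1 / 6 * ofReal_sqrt_three_sq - Complex.I_sq / 2
    · linear_combination -1 / 6 * ofReal_sqrt_three_sq - Complex.I_sq / 2
    · linear_combination -1 / 6 * ofReal_sqrt_three_sq + Complex.I_sq / 2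
  dF u _ := (hasPartialsAt_modelCurve _ _ _ u).congr (by simp) (by simp)
  dX u _ := by
    refine (hasPartialsAt_modelCurve _ _ _ u).congr ?_ ?_
    · rw [smul_modelCurve]
      congr 1
      · linear_combination sq_eq_of_pow_three_eq_I modelRoot_pow_three
      · linear_combination conj_sq_eq_of_pow_three_eq_I modelRoot_pow_three
      · ring
    · congr 1
      · linear_combination mul_conj_eq_one_of_pow_three_eq_I modelRoot_pow_three
      · linear_combination mul_conj_eq_one_of_pow_three_eq_I modelRoot_pow_three
      · linear_combination -Complex.I_sq
  dY u _ := by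
    refine (hasPartialsAt_modelCurve _ _ _ u).congr ?_ ?_
    · congr 1
      · linear_combination mul_conj_eq_one_of_pow_three_eq_I modelRoot_pow_three
      · linear_combination mul_conj_eq_one_of_pow_three_eq_I modelRoot_pow_three
      · linear_combination -Complex.I_sq
    · rw [smul_modelCurve]
      congr 1
      · linear_combination conj_sq_eq_of_pow_three_eq_I modelRoot_pow_three
      · linear_combination sq_eq_of_pow_three_eq_I modelRoot_pow_three
      · ring

/-! ### Minimal slant surfaces in flat null coordinates -/

lemma contDiffOn_fderiv_apply_const {E F : Type*} [NormedAddCommGroup E] [NormedSpace ℝ E]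
    [NormedAddCommGroup F] [NormedSpace ℝ F] {D : Set E} {f : E → F} (hf : ContDiffOn ℝ ∞ f D)
    (hD : IsOpen D) (v : E) : ContDiffOn ℝ ∞ (fun u => fderiv ℝ f u v) D :=
  (hf.fderiv_of_isOpen hD (m := ∞) (by simp)).clm_apply contDiffOn_const

/-- The lift `z` to the pseudosphere of a minimal surface in flat null coordinates. The horizontal
parts of its partial derivatives are `X` and `Y`, and `a₁, a₂` are the coefficients of the pulled
back connection form of the Hopf fibration. The product `β = b(X, Y)` encodes the Wirtinger angle:
the surface is Lagrangian when `β` is real. -/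
structure IsMinimalSlantLift (D : Set ℝ²) (β : ℂ) (z X Y : ℝ² → Fin 3 → ℂ) (a₁ a₂ : ℝ² → ℂ) :
    Prop where
  isOpen : IsOpen D
  smoothX : ContDiffOn ℝ ∞ X D
  smoothY : ContDiffOn ℝ ∞ Y D
  smooth₁ : ContDiffOn ℝ ∞ a₁ D
  smooth₂ : ContDiffOn ℝ ∞ a₂ D
  frame : ∀ u ∈ D, IsNullFrame β (z u) (X u) (Y u)
  dz : ∀ u ∈ D, HasPartialsAt z (X u + a₁ u • z u) (Y u + a₂ u • z u) u
  minX : ∀ u ∈ D, herm (X u) (fderiv ℝ Y u 𝐞₀ - a₁ u • Y u) = 0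
  minY : ∀ u ∈ D, herm (Y u) (fderiv ℝ Y u 𝐞₀ - a₁ u • Y u) = 0

namespace IsMinimalSlantLift

variable {D : Set ℝ²} {β : ℂ} {z X Y : ℝ² → Fin 3 → ℂ} {a₁ a₂ : ℝ² → ℂ} {u : ℝ²}

lemma hasPartialsAt_X (h : IsMinimalSlantLift D β z X Y a₁ a₂) (hu : u ∈ D) :
    HasPartialsAt X (fderiv ℝ X u 𝐞₀) (fderiv ℝ X u 𝐞₁) u :=
  hasPartialsAt_of_contDiffOn h.smoothX h.isOpen hu

lemma hasPartialsAt_Y (h : IsMinimalSlantLift D β z X Y a₁ a₂) (hu : u ∈ D) :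
    HasPartialsAt Y (fderiv ℝ Y u 𝐞₀) (fderiv ℝ Y u 𝐞₁) u :=
  hasPartialsAt_of_contDiffOn h.smoothY h.isOpen hu

lemma hasPartialsAt_a₁ (h : IsMinimalSlantLift D β z X Y a₁ a₂) (hu : u ∈ D) :
    HasPartialsAt a₁ (fderiv ℝ a₁ u 𝐞₀) (fderiv ℝ a₁ u 𝐞₁) u :=
  hasPartialsAt_of_contDiffOn h.smooth₁ h.isOpen hu

lemma hasPartialsAt_a₂ (h : IsMinimalSlantLift D β z X Y a₁ a₂) (hu : u ∈ D) :
    HasPartialsAt a₂ (fderiv ℝ a₂ u 𝐞₀) (fderiv ℝ a₂ u 𝐞₁) u :=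
  hasPartialsAt_of_contDiffOn h.smooth₂ h.isOpen hu

lemma conj_a₁_and_a₂ (h : IsMinimalSlantLift D β z X Y a₁ a₂) (hu : u ∈ D) :
    conj (a₁ u) = -a₁ u ∧ conj (a₂ u) = -a₂ u := by
  have hf := h.frame u hu
  have d_zz := ((h.dz u hu).herm (h.dz u hu)).eq_zero_of_const h.isOpen hu
    fun v hv => (h.frame v hv).zz
  simp only [herm_add_left, herm_add_right, herm_smul_left, herm_smul_right, hf.zz, hf.zX, hf.zY,
    hf.Xz, hf.Yz] at d_zz
  exact ⟨by linear_combination d_zz.1, by linear_combination d_zz.2⟩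

lemma dY_zero (h : IsMinimalSlantLift D β z X Y a₁ a₂) (hu : u ∈ D) :
    fderiv ℝ Y u 𝐞₀ = a₁ u • Y u - β • z u := by
  have hf := h.frame u hu
  have d_zY := (((h.dz u hu).herm (h.hasPartialsAt_Y hu)).eq_zero_of_const h.isOpen hu
    fun v hv => (h.frame v hv).zY).1
  have minX := h.minX u hu
  have minY := h.minY u hu
  simp only [herm_add_left, herm_smul_left, herm_sub_right, herm_smul_right, hf.zY, hf.XY,
    hf.YY] at d_zY minX minY
  refine hf.ext ?_ ?_ ?_ <;>
    simp only [herm_sub_right, herm_smul_right, hf.zz, hf.zY, hf.XY, hf.YY, hf.Xz, hf.Yz]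
  · linear_combination d_zY
  · linear_combination minX
  · linear_combination minY

lemma mixed_dz (h : IsMinimalSlantLift D β z X Y a₁ a₂) (hu : u ∈ D) :
    fderiv ℝ X u 𝐞₁ + (fderiv ℝ a₁ u 𝐞₁ • z u + a₁ u • (Y u + a₂ u • z u))
      = a₁ u • Y u - β • z u + (fderiv ℝ a₂ u 𝐞₀ • z u + a₂ u • (X u + a₁ u • z u)) := by
  rw [← h.dY_zero hu]
  exact HasPartialsAt.mixed_eq h.isOpen h.dz hu
    ((h.hasPartialsAt_X hu).add ((h.hasPartialsAt_a₁ hu).smul (h.dz u hu)))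
    ((h.hasPartialsAt_Y hu).add ((h.hasPartialsAt_a₂ hu).smul (h.dz u hu)))

lemma connection_curvature (h : IsMinimalSlantLift D β z X Y a₁ a₂) (hu : u ∈ D) :
    fderiv ℝ a₂ u 𝐞₀ - fderiv ℝ a₁ u 𝐞₁ = β - conj β := by
  have hf := h.frame u hu
  have d_zX := (((h.dz u hu).herm (h.hasPartialsAt_X hu)).eq_zero_of_const h.isOpen hu
    fun v hv => (h.frame v hv).zX).2
  have mixed := congrArg (herm (z u)) (h.mixed_dz hu)
  simp only [herm_add_left, herm_smul_left, hf.zX, hf.YX] at d_zX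
  simp only [herm_add_right, herm_sub_right, herm_smul_right, hf.zz, hf.zX, hf.zY] at mixed
  linear_combination -mixed + d_zX

lemma dX_one (h : IsMinimalSlantLift D β z X Y a₁ a₂) (hu : u ∈ D) :
    fderiv ℝ X u 𝐞₁ = a₂ u • X u - conj β • z u := by
  have mixed := h.mixed_dz hu
  rw [← sub_eq_zero] at mixed ⊢
  rw [← mixed, sub_eq_iff_eq_add.mp (h.connection_curvature hu)]
  module

/-- The coefficient of `Y` in the covariant derivative of `X` along the first null coordinate. -/
def coeffX (β : ℂ) (X : ℝ² → Fin 3 → ℂ) (u : ℝ²) : ℂ :=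
  β⁻¹ * herm (X u) (fderiv ℝ X u 𝐞₀)

/-- The coefficient of `X` in the covariant derivative of `Y` along the second null coordinate. -/
def coeffY (β : ℂ) (Y : ℝ² → Fin 3 → ℂ) (u : ℝ²) : ℂ :=
  (conj β)⁻¹ * herm (Y u) (fderiv ℝ Y u 𝐞₁)

lemma dX_zero (h : IsMinimalSlantLift D β z X Y a₁ a₂) (hu : u ∈ D) :
    fderiv ℝ X u 𝐞₀ = a₁ u • X u + coeffX β X u • Y u := by
  have hf := h.frame u hu
  have hβ := hf.ne_zero
  have hX := h.hasPartialsAt_X hu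
  have d_zX := (((h.dz u hu).herm hX).eq_zero_of_const h.isOpen hu
    fun v hv => (h.frame v hv).zX).1
  have d_YX := (((h.hasPartialsAt_Y hu).herm hX).eq_zero_of_const h.isOpen hu
    fun v hv => (h.frame v hv).YX).1
  rw [h.dY_zero hu] at d_YX
  simp only [herm_add_left, herm_sub_left, herm_smul_left, hf.zX, hf.XX, hf.YX,
    (h.conj_a₁_and_a₂ hu).1] at d_zX d_YX
  refine hf.ext ?_ ?_ ?_ <;>
    simp only [herm_add_right, herm_smul_right, hf.zX, hf.XX, hf.YX, hf.zY, hf.XY, hf.YY]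
  · linear_combination d_zX
  · rw [coeffX]; field_simp; ring
  · linear_combination d_YX

lemma dY_one (h : IsMinimalSlantLift D β z X Y a₁ a₂) (hu : u ∈ D) :
    fderiv ℝ Y u 𝐞₁ = a₂ u • Y u + coeffY β Y u • X u := by
  have hf := h.frame u hu
  have hβ : conj β ≠ 0 := (map_ne_zero _).mpr hf.ne_zero
  have hY := h.hasPartialsAt_Y hu
  have d_zY := (((h.dz u hu).herm hY).eq_zero_of_const h.isOpen hu
    fun v hv => (h.frame v hv).zY).2
  have d_XY := (((h.hasPartialsAt_X hu).herm hY).eq_zero_of_const h.isOpen hu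
    fun v hv => (h.frame v hv).XY).2
  rw [h.dX_one hu] at d_XY
  simp only [herm_add_left, herm_sub_left, herm_smul_left, hf.zY, hf.YY, hf.XY,
    (h.conj_a₁_and_a₂ hu).2] at d_zY d_XY
  refine hf.ext ?_ ?_ ?_ <;>
    simp only [herm_add_right, herm_smul_right, hf.zX, hf.XX, hf.YX, hf.zY, hf.XY, hf.YY]
  · linear_combination d_zY
  · linear_combination d_XY
  · rw [coeffY]; field_simp; ring

lemma conj_coeffX (h : IsMinimalSlantLift D β z X Y a₁ a₂) (hu : u ∈ D) :
    conj (β * coeffX β X u) = -(β * coeffX β X u) := by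
  have hX := h.hasPartialsAt_X hu
  have d_XX := ((hX.herm hX).eq_zero_of_const h.isOpen hu fun v hv => (h.frame v hv).XX).1
  rw [coeffX, mul_inv_cancel_left₀ (h.frame u hu).ne_zero, conj_herm]
  linear_combination d_XX

lemma smooth_coeffX (h : IsMinimalSlantLift D β z X Y a₁ a₂) : ContDiffOn ℝ ∞ (coeffX β X) D :=
  contDiffOn_const.mul (hermL.isBoundedBilinearMap.contDiff.comp_contDiffOn
    (h.smoothX.prodMk (contDiffOn_fderiv_apply_const h.smoothX h.isOpen 𝐞₀)))

lemma smooth_coeffY (h : IsMinimalSlantLift D β z X Y a₁ a₂) : ContDiffOn ℝ ∞ (coeffY β Y) D :=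
  contDiffOn_const.mul (hermL.isBoundedBilinearMap.contDiff.comp_contDiffOn
    (h.smoothY.prodMk (contDiffOn_fderiv_apply_const h.smoothY h.isOpen 𝐞₁)))

lemma hasPartialsAt_coeffX (h : IsMinimalSlantLift D β z X Y a₁ a₂) (hu : u ∈ D) :
    HasPartialsAt (coeffX β X) (fderiv ℝ (coeffX β X) u 𝐞₀) (fderiv ℝ (coeffX β X) u 𝐞₁) u :=
  hasPartialsAt_of_contDiffOn h.smooth_coeffX h.isOpen hu

lemma hasPartialsAt_coeffY (h : IsMinimalSlantLift D β z X Y a₁ a₂) (hu : u ∈ D) :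
    HasPartialsAt (coeffY β Y) (fderiv ℝ (coeffY β Y) u 𝐞₀) (fderiv ℝ (coeffY β Y) u 𝐞₁) u :=
  hasPartialsAt_of_contDiffOn h.smooth_coeffY h.isOpen hu

lemma gauss_codazzi_X (h : IsMinimalSlantLift D β z X Y a₁ a₂) (hu : u ∈ D) :
    fderiv ℝ (coeffX β X) u 𝐞₁ = 0 ∧ coeffX β X u * coeffY β Y u = β - 2 * conj β := by
  have hf := h.frame u hu
  have hβ : conj β ≠ 0 := (map_ne_zero _).mpr hf.ne_zero
  have mixed := HasPartialsAt.mixed_eq h.isOpen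
    (fun v hv => (h.hasPartialsAt_X hv).congr (h.dX_zero hv) (h.dX_one hv)) hu
    (((h.hasPartialsAt_a₁ hu).smul (h.hasPartialsAt_X hu)).add
      ((h.hasPartialsAt_coeffX hu).smul (h.hasPartialsAt_Y hu)))
    (((h.hasPartialsAt_a₂ hu).smul (h.hasPartialsAt_X hu)).sub ((h.dz u hu).const_smul _))
  rw [h.dX_one hu, h.dX_zero hu, h.dY_one hu] at mixed
  have mixed_X := congrArg (herm (X u)) mixed
  have mixed_Y := congrArg (herm (Y u)) mixed
  simp only [herm_add_right, herm_sub_right, herm_smul_right, hf.XX, hf.YX, hf.XY, hf.YY,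
    hf.Xz, hf.Yz] at mixed_X mixed_Y
  constructor
  · exact (mul_eq_zero.mp (by linear_combination mixed_X)).resolve_right hf.ne_zero
  · apply mul_right_cancel₀ hβ
    linear_combination mixed_Y + conj β * h.connection_curvature hu

lemma gauss_codazzi_Y (h : IsMinimalSlantLift D β z X Y a₁ a₂) (hu : u ∈ D) :
    fderiv ℝ (coeffY β Y) u 𝐞₀ = 0 ∧ coeffX β X u * coeffY β Y u = conj β - 2 * β := by
  have hf := h.frame u hu
  have hβ : conj β ≠ 0 := (map_ne_zero _).mpr hf.ne_zero
  have mixed := HasPartialsAt.mixed_eq h.isOpen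
    (fun v hv => (h.hasPartialsAt_Y hv).congr (h.dY_zero hv) (h.dY_one hv)) hu
    (((h.hasPartialsAt_a₁ hu).smul (h.hasPartialsAt_Y hu)).sub ((h.dz u hu).const_smul _))
    (((h.hasPartialsAt_a₂ hu).smul (h.hasPartialsAt_Y hu)).add
      ((h.hasPartialsAt_coeffY hu).smul (h.hasPartialsAt_X hu)))
  rw [h.dY_zero hu, h.dX_zero hu, h.dY_one hu] at mixed
  have mixed_X := congrArg (herm (X u)) mixed
  have mixed_Y := congrArg (herm (Y u)) mixed
  simp only [herm_add_right, herm_sub_right, herm_smul_right, hf.XX, hf.YX, hf.XY, hf.YY,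
    hf.Xz, hf.Yz] at mixed_X mixed_Y
  constructor
  · exact (mul_eq_zero.mp (by linear_combination -mixed_Y)).resolve_right hβ
  · apply mul_right_cancel₀ hf.ne_zero
    linear_combination -mixed_X - β * h.connection_curvature hu

lemma conj_eq_self (h : IsMinimalSlantLift D β z X Y a₁ a₂) (hne : D.Nonempty) : conj β = β := by
  obtain ⟨u, hu⟩ := hne
  have hprod := (h.gauss_codazzi_X hu).2.symm.trans (h.gauss_codazzi_Y hu).2
  linear_combination -(1 / 3 : ℂ) * hprod

end IsMinimalSlantLift

/-! ### Minimal Lagrangian surfaces are congruent to the model -/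

lemma eq_im_mul_I_of_conj_eq_neg {b : ℂ} (hb : conj b = -b) : b = b.im * Complex.I := by
  have hre := congrArg Complex.re hb
  rw [Complex.conj_re, Complex.neg_re, self_eq_neg] at hre
  apply Complex.ext <;> simp [hre]

lemma exists_pow_three_mul_eq_one {l : ℝ} (hl : l ≠ 0) : ∃ s : ℝ, s ≠ 0 ∧ s ^ 3 * l = 1 := by
  wlog hpos : 0 < l generalizing l
  · obtain ⟨s, hs, hsl⟩ := this (neg_ne_zero.mpr hl) (by grind)
    exact ⟨-s, neg_ne_zero.mpr hs, by linear_combination hsl⟩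
  · have hinv := inv_pos.mpr hpos
    refine ⟨l⁻¹ ^ ((3 : ℕ)⁻¹ : ℝ), (Real.rpow_pos_of_pos hinv _).ne', ?_⟩
    rw [Real.rpow_inv_natCast_pow hinv.le (by norm_num), inv_mul_cancel₀ hl]

/-- The linear change of coordinates `(x, y) ↦ (s x, s⁻¹ y)`. -/
def planeScale (s : ℝ) (hs : s ≠ 0) : ℝ² ≃L[ℝ] ℝ² :=
  ContinuousLinearEquiv.equivOfInverse (ofPartials (s • 𝐞₀) (s⁻¹ • 𝐞₁))
    (ofPartials (s⁻¹ • 𝐞₀) (s • 𝐞₁))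
    (fun v => by ext i; fin_cases i <;> simp [ofPartials_apply, hs])
    (fun v => by ext i; fin_cases i <;> simp [ofPartials_apply, hs])

lemma hasPartialsAt_planeScale {s : ℝ} {hs : s ≠ 0} {u : ℝ²} :
    HasPartialsAt (planeScale s hs) (s • 𝐞₀) (s⁻¹ • 𝐞₁) u :=
  (ofPartials (s • 𝐞₀) (s⁻¹ • 𝐞₁)).hasFDerivAt

lemma HasPartialsAt.comp_planeScale {E : Type*} [NormedAddCommGroup E] [NormedSpace ℝ E]
    {F : ℝ² → E} {P Q : E} {s : ℝ} {hs : s ≠ 0} {u : ℝ²}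
    (h : HasPartialsAt F P Q (planeScale s hs u)) :
    HasPartialsAt (fun u => F (planeScale s hs u)) (s • P) (s⁻¹ • Q) u :=
  (h.comp hasPartialsAt_planeScale).congr (by simp) (by simp)

/-- The phases `c` for which the lift `c • z` is horizontal, where `a₁, a₂` are the coefficients of
the connection form along the lift `z`. -/
structure IsGauge (D : Set ℝ²) (a₁ a₂ c : ℝ² → ℂ) : Prop where
  unit : ∀ u ∈ D, conj (c u) * c u = 1
  partials : ∀ u ∈ D, HasPartialsAt c (-a₁ u * c u) (-a₂ u * c u) u

namespace IsMinimalSlantLift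

variable {D : Set ℝ²} {β : ℂ} {z X Y : ℝ² → Fin 3 → ℂ} {a₁ a₂ c : ℝ² → ℂ} {u : ℝ²}

lemma coeffX_mul_coeffY (h : IsMinimalSlantLift D (-1) z X Y a₁ a₂) (hu : u ∈ D) :
    coeffX (-1) X u * coeffY (-1) Y u = 1 := by
  rw [(h.gauss_codazzi_X hu).2, map_neg, map_one]
  norm_num

lemma hasPartialsAt_coeffX_zero (h : IsMinimalSlantLift D (-1) z X Y a₁ a₂) (hu : u ∈ D) :
    HasPartialsAt (coeffX (-1) X) 0 0 u := by
  have d_prod := (((h.hasPartialsAt_coeffX hu).mul (h.hasPartialsAt_coeffY hu)).eq_zero_of_const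
    h.isOpen hu fun v hv => h.coeffX_mul_coeffY hv).1
  rw [(h.gauss_codazzi_Y hu).1, mul_zero, add_zero] at d_prod
  have hY : coeffY (-1) Y u ≠ 0 := right_ne_zero_of_mul_eq_one (h.coeffX_mul_coeffY hu)
  exact (h.hasPartialsAt_coeffX hu).congr ((mul_eq_zero.mp d_prod).resolve_right hY)
    (h.gauss_codazzi_X hu).1

lemma exists_coeff (h : IsMinimalSlantLift D (-1) z X Y a₁ a₂) (hD : Convex ℝ D)
    (hne : D.Nonempty) :
    ∃ l : ℝ, l ≠ 0 ∧ ∀ u ∈ D, coeffX (-1) X u = l * Complex.I ∧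
      coeffY (-1) Y u = -((l : ℂ)⁻¹ * Complex.I) := by
  obtain ⟨u₀, hu₀⟩ := hne
  obtain ⟨l, hl⟩ : ∃ l : ℝ, coeffX (-1) X u₀ = l * Complex.I :=
    ⟨_, eq_im_mul_I_of_conj_eq_neg (by simpa [neg_eq_iff_eq_neg] using h.conj_coeffX hu₀)⟩
  have hX : ∀ u ∈ D, coeffX (-1) X u = l * Complex.I := fun u hu =>
    (eq_of_partials_eq_zero hD (fun v hv => h.hasPartialsAt_coeffX_zero hv) hu hu₀).trans hl
  have hl_ne : (l : ℂ) ≠ 0 :=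
    left_ne_zero_of_mul (hl ▸ left_ne_zero_of_mul_eq_one (h.coeffX_mul_coeffY hu₀))
  refine ⟨l, Complex.ofReal_ne_zero.mp hl_ne, fun u hu => ⟨hX u hu, ?_⟩⟩
  have hprod := h.coeffX_mul_coeffY hu
  rw [hX u hu] at hprod
  field_simp
  linear_combination -Complex.I * hprod + l * coeffY (-1) Y u * Complex.I_sq

lemma exists_gauge (h : IsMinimalSlantLift D β z X Y a₁ a₂) (hD : Convex ℝ D) :
    ∃ c, IsGauge D a₁ a₂ c := by
  have closed : ∀ u ∈ D, fderiv ℝ a₂ u 𝐞₀ = fderiv ℝ a₁ u 𝐞₁ := fun u hu => by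
    rw [← sub_eq_zero, h.connection_curvature hu, h.conj_eq_self ⟨u, hu⟩, sub_self]
  obtain ⟨f, hf⟩ := exists_potential hD h.isOpen
    (fun u hu => (h.hasPartialsAt_a₁ hu).clm Complex.imCLM)
    (fun u hu => ((h.hasPartialsAt_a₂ hu).clm Complex.imCLM).congr (by rw [closed u hu]) rfl)
  refine ⟨fun u => Complex.exp (-Complex.I * f u), fun u _ => ?_, fun u hu => ?_⟩
  · rw [← Complex.exp_conj, ← Complex.exp_add]
    simp
  · obtain ⟨ha₁, ha₂⟩ := h.conj_a₁_and_a₂ hu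
    refine (((hf u hu).clm Complex.ofRealCLM).const_smul (-Complex.I)).cexp.congr ?_ ?_
    · conv_rhs => rw [eq_im_mul_I_of_conj_eq_neg ha₁]
      simp only [Complex.ofRealCLM_apply, Complex.imCLM_apply, smul_eq_mul]
      ring
    · conv_rhs => rw [eq_im_mul_I_of_conj_eq_neg ha₂]
      simp only [Complex.ofRealCLM_apply, Complex.imCLM_apply, smul_eq_mul]
      ring

lemma gauge_dz (h : IsMinimalSlantLift D β z X Y a₁ a₂) (hc : IsGauge D a₁ a₂ c) (hu : u ∈ D) :
    HasPartialsAt (fun u => c u • z u) (c u • X u) (c u • Y u) u :=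
  ((hc.partials u hu).smul (h.dz u hu)).congr (by module) (by module)

lemma gauge_dX (h : IsMinimalSlantLift D β z X Y a₁ a₂) (hc : IsGauge D a₁ a₂ c) (hu : u ∈ D) :
    HasPartialsAt (fun u => c u • X u) (coeffX β X u • c u • Y u) (-conj β • c u • z u) u := by
  refine ((hc.partials u hu).smul (h.hasPartialsAt_X hu)).congr ?_ ?_
  · rw [h.dX_zero hu]; module
  · rw [h.dX_one hu]; module

lemma gauge_dY (h : IsMinimalSlantLift D β z X Y a₁ a₂) (hc : IsGauge D a₁ a₂ c) (hu : u ∈ D) :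
    HasPartialsAt (fun u => c u • Y u) (-β • c u • z u) (coeffY β Y u • c u • X u) u := by
  refine ((hc.partials u hu).smul (h.hasPartialsAt_Y hu)).congr ?_ ?_
  · rw [h.dY_zero hu]; module
  · rw [h.dY_one hu]; module

lemma gauge_scale_isNullFrame (h : IsMinimalSlantLift D β z X Y a₁ a₂) (hc : IsGauge D a₁ a₂ c)
    {s : ℝ} (hs : s ≠ 0) (hu : u ∈ D) :
    IsNullFrame β (c u • z u) (s • c u • X u) (s⁻¹ • c u • Y u) := by
  have hf := h.frame u hu
  have hunit := hc.unit u hu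
  have hs' : (s : ℂ) ≠ 0 := Complex.ofReal_ne_zero.mpr hs
  refine ⟨hf.ne_zero, ?_, ?_, ?_, ?_, ?_, ?_⟩ <;>
    simp only [herm_real_smul_left, herm_real_smul_right, herm_smul_left, herm_smul_right, hf.zz,
      hf.zX, hf.zY, hf.XX, hf.YY, hf.XY, mul_zero, mul_one]
  · rw [mul_comm, hunit]
  · rw [Complex.ofReal_inv, inv_mul_eq_iff_eq_mul₀ hs']
    linear_combination s * β * hunit

/-- With `s³ l = 1`, the change of scale turns the structure equations of a surface with cubic
coefficient `l` into those of the model. -/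
lemma isModelSolution_scale (h : IsMinimalSlantLift D (-1) z X Y a₁ a₂) (hc : IsGauge D a₁ a₂ c)
    {l s : ℝ} (hs : s ≠ 0) (hsl : s ^ 3 * l = 1)
    (hcoeff : ∀ u ∈ D, coeffX (-1) X u = l * Complex.I ∧
      coeffY (-1) Y u = -((l : ℂ)⁻¹ * Complex.I)) :
    IsModelSolution (planeScale s hs ⁻¹' D) (fun u => c (planeScale s hs u) • z (planeScale s hs u))
      (fun u => s • c (planeScale s hs u) • X (planeScale s hs u))
      (fun u => s⁻¹ • c (planeScale s hs u) • Y (planeScale s hs u)) := by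
  have hl_eq : (l : ℂ) = (s : ℂ)⁻¹ ^ 3 := by
    rw [inv_pow, ← Complex.ofReal_pow, ← Complex.ofReal_inv, eq_inv_of_mul_eq_one_right hsl]
  have hs' : (s : ℂ) ≠ 0 := Complex.ofReal_ne_zero.mpr hs
  refine ⟨fun u hu => h.gauge_scale_isNullFrame hc hs hu,
    fun u hu => (h.gauge_dz hc hu).comp_planeScale, fun u hu => ?_, fun u hu => ?_⟩
  · refine ((h.gauge_dX hc hu).comp_planeScale.clm
      (s • ContinuousLinearMap.id ℝ (Fin 3 → ℂ))).congr ?_ ?_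
    · simp only [(hcoeff _ hu).1, hl_eq, smul_apply, ContinuousLinearMap.id_apply]
      simp only [← Complex.coe_smul, Complex.ofReal_inv, smul_smul]
      congr 1
      field_simp
    · simp [smul_smul, hs]
  · refine ((h.gauge_dY hc hu).comp_planeScale.clm
      (s⁻¹ • ContinuousLinearMap.id ℝ (Fin 3 → ℂ))).congr ?_ ?_
    · simp [smul_smul, hs]
    · simp only [(hcoeff _ hu).2, hl_eq, smul_apply, ContinuousLinearMap.id_apply]
      simp only [← Complex.coe_smul, Complex.ofReal_inv, smul_smul]
      congr 1
      field_simp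

lemma exists_congruence (h : IsMinimalSlantLift D (-1) z X Y a₁ a₂) (hD : Convex ℝ D)
    (hne : D.Nonempty) :
    ∃ s : ℝ, ∃ hs : s ≠ 0, ∃ A : U12, ∀ u, planeScale s hs u ∈ D →
      ∃ c : ℂ, c ≠ 0 ∧ c • z (planeScale s hs u) = A.toEquiv (modelCurve 1 1 1 u) := by
  obtain ⟨l, hl, hcoeff⟩ := h.exists_coeff hD hne
  obtain ⟨c, hc⟩ := h.exists_gauge hD
  obtain ⟨s, hs, hsl⟩ := exists_pow_three_mul_eq_one hl
  have hconv : Convex ℝ (planeScale s hs ⁻¹' D) :=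
    hD.linear_preimage (planeScale s hs).toLinearEquiv.toLinearMap
  obtain ⟨A, hA⟩ := (h.isModelSolution_scale hc hs hsl hcoeff).exists_unitary hconv
    (isModelSolution_modelCurve _) (hne.preimage (planeScale s hs).surjective)
  exact ⟨s, hs, A, fun u hu =>
    ⟨c (planeScale s hs u), right_ne_zero_of_mul_eq_one (hc.unit _ hu), hA u hu⟩⟩

end IsMinimalSlantLift

/-! ### Coordinate changes between congruent pieces of the model surface -/

/-- The linear change of coordinates `(x, y) ↦ (-y, -x)`. -/
def planeNegSwap : ℝ² ≃L[ℝ] ℝ² :=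
  ContinuousLinearEquiv.equivOfInverse (ofPartials (-𝐞₁) (-𝐞₀)) (ofPartials (-𝐞₁) (-𝐞₀))
    (fun v => by ext i; fin_cases i <;> simp [ofPartials_apply])
    (fun v => by ext i; fin_cases i <;> simp [ofPartials_apply])

lemma hasPartialsAt_planeNegSwap {u : ℝ²} : HasPartialsAt planeNegSwap (-𝐞₁) (-𝐞₀) u :=
  (ofPartials (-𝐞₁) (-𝐞₀) : ℝ² →L[ℝ] ℝ²).hasFDerivAt

/-- An element of the unitary group as a continuous real linear map. -/
def U12.toCLM (A : U12) : (Fin 3 → ℂ) →L[ℝ] (Fin 3 → ℂ) :=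
  (LinearMap.toContinuousLinearMap (A.toEquiv : (Fin 3 → ℂ) →ₗ[ℂ] (Fin 3 → ℂ))).restrictScalars ℝ

namespace IsModelSolution

variable {F X Y : ℝ² → Fin 3 → ℂ} {D : Set ℝ²}

lemma map (h : IsModelSolution D F X Y) (A : U12) :
    IsModelSolution D (fun u => A.toEquiv (F u)) (fun u => A.toEquiv (X u))
      (fun u => A.toEquiv (Y u)) where
  frame u hu := by
    have hf := h.frame u hu
    refine ⟨hf.ne_zero, ?_, ?_, ?_, ?_, ?_, ?_⟩ <;> rw [A.map_herm]
    exacts [hf.zz, hf.zX, hf.zY, hf.XX, hf.YY, hf.XY]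
  dF u hu := (h.dF u hu).clm A.toCLM
  dX u hu := ((h.dX u hu).clm A.toCLM).congr (map_smul A.toEquiv _ _) rfl
  dY u hu := ((h.dY u hu).clm A.toCLM).congr rfl (map_smul A.toEquiv _ _)

lemma phase_translate (h : IsModelSolution Set.univ F X Y) {c : ℂ} (hc : conj c * c = 1) (b : ℝ²) :
    IsModelSolution Set.univ (fun u => c • F (u + b)) (fun u => c • X (u + b))
      (fun u => c • Y (u + b)) := by
  have hT : ∀ u, HasPartialsAt (fun u : ℝ² => u + b) 𝐞₀ 𝐞₁ u := fun u =>
    .of_hasFDerivAt ((hasFDerivAt_id u).add_const b) rfl rfl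
  constructor <;> intro u _
  · have hf := h.frame (u + b) trivial
    refine ⟨hf.ne_zero, ?_, ?_, ?_, ?_, ?_, ?_⟩ <;> rw [herm_smul_smul, hc, one_mul]
    exacts [hf.zz, hf.zX, hf.zY, hf.XX, hf.YY, hf.XY]
  · exact (((h.dF (u + b) trivial).comp (T := (· + b)) (hT u)).const_smul c).congr
      (by simp) (by simp)
  · exact (((h.dX (u + b) trivial).comp (T := (· + b)) (hT u)).const_smul c).congr
      (by simp [smul_comm c Complex.I]) (by simp)
  · exact (((h.dY (u + b) trivial).comp (T := (· + b)) (hT u)).const_smul c).congr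
      (by simp) (by simp [smul_comm c Complex.I])

lemma negSwap (h : IsModelSolution Set.univ F X Y) :
    IsModelSolution Set.univ (fun u => F (planeNegSwap u)) (fun u => (-1 : ℂ) • Y (planeNegSwap u))
      (fun u => (-1 : ℂ) • X (planeNegSwap u)) := by
  have hT := fun u => hasPartialsAt_planeNegSwap (u := u)
  constructor <;> intro u _
  · have hf := h.frame (planeNegSwap u) trivial
    constructor <;> simp [herm_neg_left, herm_neg_right, hf.zz, hf.zX, hf.zY, hf.XX, hf.YY, hf.YX]
  · exact ((h.dF _ trivial).comp (hT u)).congr (by simp) (by simp)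
  · exact (((h.dY _ trivial).comp (hT u)).const_smul (-1)).congr (by simp) (by simp)
  · exact (((h.dX _ trivial).comp (hT u)).const_smul (-1)).congr (by simp) (by simp)

end IsModelSolution

/-- Two solutions of the structure equations that define, over the open set `D` and up to the
coordinate change `T`, the same surface in the projective plane. -/
structure IsOverlap (D : Set ℝ²) (T : ℝ² → ℝ²) (F X Y F' X' Y' : ℝ² → Fin 3 → ℂ) : Prop where
  isOpen : IsOpen D
  smooth : ContDiffOn ℝ ∞ T D
  sol : IsModelSolution Set.univ F X Y
  sol' : IsModelSolution Set.univ F' X' Y'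
  proportional : ∀ u ∈ D, ∃ c : ℂ, F u = c • F' (T u)

namespace IsOverlap

variable {D : Set ℝ²} {T : ℝ² → ℝ²} {F X Y F' X' Y' : ℝ² → Fin 3 → ℂ} {u : ℝ²}

/-- The factor of proportionality of two lifts that differ by the coordinate change `T`. -/
def phase (T : ℝ² → ℝ²) (F F' : ℝ² → Fin 3 → ℂ) (u : ℝ²) : ℂ := herm (F' (T u)) (F u)

/-- The linear combination of `X (T u)` and `Y (T u)` with the coordinates of `v`. -/
def tangent (T : ℝ² → ℝ²) (X Y : ℝ² → Fin 3 → ℂ) (v u : ℝ²) : Fin 3 → ℂ :=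
  v 0 • X (T u) + v 1 • Y (T u)

lemma eq_phase_smul (h : IsOverlap D T F X Y F' X' Y') (hu : u ∈ D) :
    F u = phase T F F' u • F' (T u) := by
  obtain ⟨c, hc⟩ := h.proportional u hu
  rw [phase, hc, herm_smul_right, (h.sol'.frame (T u) trivial).zz, mul_one]

lemma conj_phase_mul_phase (h : IsOverlap D T F X Y F' X' Y') (hu : u ∈ D) :
    conj (phase T F F' u) * phase T F F' u = 1 := by
  have hzz := (h.sol.frame u trivial).zz
  rwa [h.eq_phase_smul hu, herm_smul_smul, (h.sol'.frame (T u) trivial).zz, mul_one] at hzz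

lemma hasPartialsAt_T (h : IsOverlap D T F X Y F' X' Y') (hu : u ∈ D) :
    HasPartialsAt T (fderiv ℝ T u 𝐞₀) (fderiv ℝ T u 𝐞₁) u :=
  hasPartialsAt_of_contDiffOn h.smooth h.isOpen hu

lemma hasPartialsAt_comp (h : IsOverlap D T F X Y F' X' Y') (hu : u ∈ D) :
    HasPartialsAt (fun u => F' (T u)) (tangent T X' Y' (fderiv ℝ T u 𝐞₀) u)
      (tangent T X' Y' (fderiv ℝ T u 𝐞₁) u) u :=
  (h.sol'.dF (T u) trivial).comp (h.hasPartialsAt_T hu)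

lemma phase_smul_partials (h : IsOverlap D T F X Y F' X' Y') (hu : u ∈ D) {c₁ c₂ : ℂ}
    (hc : HasPartialsAt (phase T F F') c₁ c₂ u) :
    X u = c₁ • F' (T u) + phase T F F' u • tangent T X' Y' (fderiv ℝ T u 𝐞₀) u ∧
      Y u = c₂ • F' (T u) + phase T F F' u • tangent T X' Y' (fderiv ℝ T u 𝐞₁) u :=
  (h.sol.dF u trivial).unique ((hc.smul (h.hasPartialsAt_comp hu)).congr_of_eventuallyEq
    (Filter.eventually_of_mem (h.isOpen.mem_nhds hu) fun _ hv => h.eq_phase_smul hv))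

lemma herm_F_tangent (h : IsOverlap D T F X Y F' X' Y') (hu : u ∈ D) (v : ℝ²) (c : ℂ) :
    herm (F u) (c • F' (T u) + phase T F F' u • tangent T X' Y' v u)
      = conj (phase T F F' u) * c := by
  have hf' := h.sol'.frame (T u) trivial
  rw [h.eq_phase_smul hu, tangent]
  simp [herm_add_right, herm_smul_right, herm_smul_left, herm_real_smul_right, hf'.zX, hf'.zY,
    hf'.zz, mul_comm]

lemma hasPartialsAt_phase (h : IsOverlap D T F X Y F' X' Y') (hu : u ∈ D) :
    HasPartialsAt (phase T F F') 0 0 u := by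
  obtain ⟨c₁, c₂, hc⟩ : ∃ c₁ c₂, HasPartialsAt (phase T F F') c₁ c₂ u :=
    ⟨_, _, (h.hasPartialsAt_comp hu).herm (h.sol.dF u trivial)⟩
  obtain ⟨hX, hY⟩ := h.phase_smul_partials hu hc
  have hf := h.sol.frame u trivial
  have hne : conj (phase T F F' u) ≠ 0 := left_ne_zero_of_mul_eq_one (h.conj_phase_mul_phase hu)
  refine hc.congr ((mul_eq_zero.mp ?_).resolve_left hne) ((mul_eq_zero.mp ?_).resolve_left hne)
  · rw [← h.herm_F_tangent hu, ← hX, hf.zX]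
  · rw [← h.herm_F_tangent hu, ← hY, hf.zY]

lemma X_eq (h : IsOverlap D T F X Y F' X' Y') (hu : u ∈ D) :
    X u = phase T F F' u • tangent T X' Y' (fderiv ℝ T u 𝐞₀) u := by
  simpa using (h.phase_smul_partials hu (h.hasPartialsAt_phase hu)).1

lemma Y_eq (h : IsOverlap D T F X Y F' X' Y') (hu : u ∈ D) :
    Y u = phase T F F' u • tangent T X' Y' (fderiv ℝ T u 𝐞₁) u := by
  simpa using (h.phase_smul_partials hu (h.hasPartialsAt_phase hu)).2

lemma herm_tangent (h' : IsModelSolution Set.univ F' X' Y') (v w : ℝ²) :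
    herm (tangent T X' Y' v u) (tangent T X' Y' w u) = -((v 0 * w 1 + v 1 * w 0 : ℝ) : ℂ) := by
  have hf' := h'.frame (T u) trivial
  simp only [tangent, herm_add_left, herm_add_right, herm_real_smul_left, herm_real_smul_right,
    hf'.XX, hf'.XY, hf'.YX, hf'.YY, map_neg, map_one]
  push_cast
  ring

lemma metric_relations (h : IsOverlap D T F X Y F' X' Y') (hu : u ∈ D) :
    fderiv ℝ T u 𝐞₀ 0 * fderiv ℝ T u 𝐞₀ 1 = 0 ∧ fderiv ℝ T u 𝐞₁ 0 * fderiv ℝ T u 𝐞₁ 1 = 0 ∧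
      fderiv ℝ T u 𝐞₀ 0 * fderiv ℝ T u 𝐞₁ 1 + fderiv ℝ T u 𝐞₀ 1 * fderiv ℝ T u 𝐞₁ 0 = 1 := by
  have hf := h.sol.frame u trivial
  have hXX := hf.XX
  have hYY := hf.YY
  have hXY := hf.XY
  rw [h.X_eq hu, herm_smul_smul, h.conj_phase_mul_phase hu, herm_tangent h.sol', one_mul,
    neg_eq_zero, Complex.ofReal_eq_zero] at hXX
  rw [h.Y_eq hu, herm_smul_smul, h.conj_phase_mul_phase hu, herm_tangent h.sol', one_mul,
    neg_eq_zero, Complex.ofReal_eq_zero] at hYY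
  rw [h.X_eq hu, h.Y_eq hu, herm_smul_smul, h.conj_phase_mul_phase hu, herm_tangent h.sol', one_mul,
    neg_inj, Complex.ofReal_eq_one] at hXY
  exact ⟨by linear_combination hXX / 2, by linear_combination hYY / 2, hXY⟩

lemma exists_I_smul_Y_eq (h : IsOverlap D T F X Y F' X' Y') (hu : u ∈ D) :
    ∃ w : ℝ², Complex.I • Y u = phase T F F' u • (tangent T X' Y' w u
      + (fderiv ℝ T u 𝐞₀ 0 • (fderiv ℝ T u 𝐞₀ 0 • Complex.I • Y' (T u)
          + fderiv ℝ T u 𝐞₀ 1 • F' (T u))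
        + fderiv ℝ T u 𝐞₀ 1 • (fderiv ℝ T u 𝐞₀ 0 • F' (T u)
          + fderiv ℝ T u 𝐞₀ 1 • -Complex.I • X' (T u)))) := by
  have hTX := hasPartialsAt_of_contDiffOn (contDiffOn_fderiv_apply_const h.smooth h.isOpen 𝐞₀)
    h.isOpen hu
  have hcoord := fun i : Fin 2 => hTX.clm (EuclideanSpace.proj (𝕜 := ℝ) i)
  have hprod := (h.hasPartialsAt_phase hu).smul
    (((hcoord 0).bilin (ContinuousLinearMap.lsmul ℝ ℝ)
      ((h.sol'.dX (T u) trivial).comp (h.hasPartialsAt_T hu))).add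
    ((hcoord 1).bilin (ContinuousLinearMap.lsmul ℝ ℝ)
      ((h.sol'.dY (T u) trivial).comp (h.hasPartialsAt_T hu))))
  have hIY := ((h.sol.dX u trivial).unique (hprod.congr_of_eventuallyEq
    (Filter.eventually_of_mem (h.isOpen.mem_nhds hu) fun v hv => h.X_eq hv))).1
  refine ⟨fderiv ℝ (fun u => fderiv ℝ T u 𝐞₀) u 𝐞₀, hIY.trans ?_⟩
  simp only [tangent, ContinuousLinearMap.lsmul_apply, PiLp.proj_apply]
  module

/-- In the model `b(X, ∂₁X) = -i` and `b(Y, ∂₂Y) = i`; comparing imaginary parts in `b(X, ∂₁X)`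
says that `T` preserves this cubic form. -/
lemma cubic_relation (h : IsOverlap D T F X Y F' X' Y') (hu : u ∈ D) :
    fderiv ℝ T u 𝐞₀ 0 ^ 3 - fderiv ℝ T u 𝐞₀ 1 ^ 3 = 1 := by
  have hf' := h.sol'.frame (T u) trivial
  obtain ⟨w, hw⟩ := h.exists_I_smul_Y_eq hu
  have hX := congrArg (herm (X u)) hw
  rw [herm_smul_right Complex.I, (h.sol.frame u trivial).XY, h.X_eq hu, herm_smul_smul,
    h.conj_phase_mul_phase hu, one_mul, herm_add_right, herm_tangent h.sol'] at hX
  simp only [tangent, herm_add_left, herm_add_right, herm_real_smul_left, herm_real_smul_right,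
    herm_smul_right, hf'.XX, hf'.XY, hf'.YX, hf'.YY, hf'.Xz, hf'.Yz, map_neg, map_one] at hX
  have him := congrArg Complex.im hX
  simp only [Complex.add_im, Complex.add_re, Complex.mul_im, Complex.mul_re, Complex.neg_im,
    Complex.neg_re, Complex.I_im, Complex.I_re, Complex.ofReal_re, Complex.ofReal_im,
    Complex.one_re, Complex.one_im, Complex.zero_re, Complex.zero_im] at him
  linear_combination him

/-- The only isometries of the null plane preserving the cubic form `dx³ - dy³` are the identity
and `(x, y) ↦ (-y, -x)`. -/
lemma jet_cases {p q : ℝ²} (hp : p 0 * p 1 = 0) (hq : q 0 * q 1 = 0)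
    (hpq : p 0 * q 1 + p 1 * q 0 = 1) (hcubic : p 0 ^ 3 - p 1 ^ 3 = 1) :
    (p = 𝐞₀ ∧ q = 𝐞₁) ∨ (p = -𝐞₁ ∧ q = -𝐞₀) := by
  have cube : ∀ t : ℝ, t ^ 3 = 1 → t = 1 := fun t ht =>
    (Odd.strictMono_pow (by decide : Odd 3)).injective (ht.trans (one_pow 3).symm)
  rcases mul_eq_zero.mp hp with hp₀ | hp₁
  · have hp₁ : -p 1 = 1 := cube _ (by rw [hp₀] at hcubic; linear_combination hcubic)
    have hq₀ : q 0 = -1 := by rw [hp₀] at hpq; linear_combination -hpq - q 0 * hp₁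
    have hq₁ : q 1 = 0 := by simpa [hq₀] using hq
    refine Or.inr ⟨?_, ?_⟩ <;> ext i <;> fin_cases i <;> simp [hp₀, hq₀, hq₁, ← hp₁]
  · have hp₀ : p 0 = 1 := cube _ (by rw [hp₁] at hcubic; linear_combination hcubic)
    have hq₁ : q 1 = 1 := by simpa [hp₀, hp₁] using hpq
    have hq₀ : q 0 = 0 := by simpa [hq₁] using hq
    refine Or.inl ⟨?_, ?_⟩ <;> ext i <;> fin_cases i <;> simp [hp₀, hp₁, hq₀, hq₁]

lemma exists_affine_change (h : IsOverlap D T F X Y F' X' Y') (hne : D.Nonempty) :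
    ∃ (R : ℝ² ≃L[ℝ] ℝ²) (b : ℝ²) (c : ℂ), c ≠ 0 ∧ ∀ u, F u = c • F' (R u + b) := by
  obtain ⟨u, hu⟩ := hne
  have hc := h.conj_phase_mul_phase hu
  have hc_ne : phase T F F' u ≠ 0 := right_ne_zero_of_mul_eq_one hc
  have hX := h.X_eq hu
  have hY := h.Y_eq hu
  obtain ⟨h_null₀, h_null₁, h_unit⟩ := h.metric_relations hu
  rcases jet_cases h_null₀ h_null₁ h_unit (h.cubic_relation hu) with ⟨hp, hq⟩ | ⟨hp, hq⟩ <;>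
    rw [hp, tangent] at hX <;> rw [hq, tangent] at hY
  · refine ⟨.refl ℝ _, T u - u, _, hc_ne, fun v => h.sol.eqOn convex_univ
      (h.sol'.phase_translate hc (T u - u)) (u₀ := u) trivial ?_ ?_ ?_ trivial⟩ <;>
      rw [add_sub_cancel]
    exacts [h.eq_phase_smul hu, by simpa using hX, by simpa using hY]
  · refine ⟨planeNegSwap, T u - planeNegSwap u, _, hc_ne, fun v => h.sol.eqOn convex_univ
      (h.sol'.phase_translate hc (T u - planeNegSwap u)).negSwap (u₀ := u) trivial ?_ ?_ ?_
      trivial⟩ <;> rw [add_sub_cancel]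
    exacts [h.eq_phase_smul hu, by simpa using hX, by simpa using hY]

end IsOverlap

/-! ### The Levi-Civita connection in coordinates -/

section Smooth

variable {E F : Type*} [NormedAddCommGroup E] [NormedSpace ℝ E] [NormedAddCommGroup F]
  [NormedSpace ℝ F] {f : E → F} {D : Set E} {x : E}

lemma hasFDerivAt_of_contDiffOn (hf : ContDiffOn ℝ ∞ f D) (hD : IsOpen D) (hx : x ∈ D) :
    HasFDerivAt f (fderiv ℝ f x) x :=
  ((hf.contDiffAt (hD.mem_nhds hx)).differentiableAt (by simp)).hasFDerivAt

lemma contDiffOn_fderiv (hf : ContDiffOn ℝ ∞ f D) (hD : IsOpen D) :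
    ContDiffOn ℝ ∞ (fderiv ℝ f) D :=
  hf.fderiv_of_isOpen hD (by simp)

lemma second_fderiv_symm (hf : ContDiffOn ℝ ∞ f D) (hD : IsOpen D) (hx : x ∈ D) (v w : E) :
    fderiv ℝ (fderiv ℝ f) x v w = fderiv ℝ (fderiv ℝ f) x w v :=
  second_derivative_symmetric_of_eventually
    (Filter.eventually_of_mem (hD.mem_nhds hx) fun _ hy => hasFDerivAt_of_contDiffOn hf hD hy)
    (hasFDerivAt_of_contDiffOn (contDiffOn_fderiv hf hD) hD hx) v w

lemma hasFDerivAt_apply {A : E → E →L[ℝ] F} {A' : E →L[ℝ] E →L[ℝ] F} (hA : HasFDerivAt A A' x)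
    (w : E) : HasFDerivAt (fun y => A y w) (A'.flip w) x :=
  (hA.clm_apply (hasFDerivAt_const w x)).congr_fderiv (by simp)

lemma fderiv_apply_apply {A : E → E →L[ℝ] F} (hA : DifferentiableAt ℝ A x) (v w : E) :
    fderiv ℝ (fun y => A y w) x v = fderiv ℝ A x v w := by
  rw [(hasFDerivAt_apply hA.hasFDerivAt w).fderiv, ContinuousLinearMap.flip_apply]

lemma exists_smooth_primitive [CompleteSpace F] (hconv : Convex ℝ D) (hD : IsOpen D)
    {α : E → E →L[ℝ] F} (hα : ContDiffOn ℝ ∞ α D)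
    (hclosed : ∀ y ∈ D, ∀ v w, fderiv ℝ α y v w = fderiv ℝ α y w v) :
    ∃ f : E → F, ContDiffOn ℝ ∞ f D ∧ ∀ y ∈ D, HasFDerivAt f (α y) y := by
  obtain ⟨f, hf⟩ := hconv.exists_forall_hasFDerivAt_of_fderiv_symmetric hD
    (hα.differentiableOn (by simp)) hclosed
  refine ⟨f, (contDiffOn_infty_iff_fderiv_of_isOpen hD).mpr ⟨fun y hy => ?_, ?_⟩, hf⟩
  · exact (hf y hy).differentiableAt.differentiableWithinAt
  · exact hα.congr fun y hy => (hf y hy).fderiv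

end Smooth

section LeviCivita

set_option maxSynthPendingDepth 6

variable {E : Type*} [NormedAddCommGroup E] [NormedSpace ℝ E]

lemma isInvertible_of_nondegenerate [FiniteDimensional ℝ E] {B : E →L[ℝ] E →L[ℝ] ℝ}
    (hB : ∀ t, (∀ u, B t u = 0) → t = 0) : B.IsInvertible := by
  have hinj : Function.Injective (B : E →ₗ[ℝ] E →L[ℝ] ℝ) :=
    (injective_iff_map_eq_zero _).mpr fun t ht => hB t fun u => congrArg (fun A => A u) ht
  have hdim : Module.finrank ℝ E = Module.finrank ℝ (E →L[ℝ] ℝ) := by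
    rw [← (LinearMap.toContinuousLinearMap : (E →ₗ[ℝ] ℝ) ≃ₗ[ℝ] (E →L[ℝ] ℝ)).finrank_eq,
      Subspace.dual_finrank_eq]
  exact ⟨(LinearEquiv.ofInjectiveOfFinrankEq _ hinj hdim).toContinuousLinearEquiv, rfl⟩

/-- The Christoffel map of `G` at `x` as a continuous bilinear map. -/
def christoffelL (G : E → E →L[ℝ] E →L[ℝ] ℝ) (x : E) : E →L[ℝ] E →L[ℝ] E :=
  (ContinuousLinearMap.compL ℝ E (E →L[ℝ] ℝ) E (G x).inverse).comp
    ((1 / 2 : ℝ) • (fderiv ℝ G x + ContinuousLinearMap.flipₗᵢ ℝ E E (E →L[ℝ] ℝ) (fderiv ℝ G x)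
      - (ContinuousLinearMap.flipₗᵢ ℝ E E ℝ : (E →L[ℝ] E →L[ℝ] ℝ) →L[ℝ] (E →L[ℝ] E →L[ℝ] ℝ)).comp
        (ContinuousLinearMap.flipₗᵢ ℝ E E (E →L[ℝ] ℝ) (fderiv ℝ G x))))

lemma christoffelL_apply (G : E → E →L[ℝ] E →L[ℝ] ℝ) (x v w : E) :
    christoffelL G x v w = christoffel G x v w := by
  simp [christoffelL, christoffel]

/-- The covariant derivative `v ↦ ∇_v p` of the vector field `p` for the Levi-Civita connection
of `G`. -/
def covariant (G : E → E →L[ℝ] E →L[ℝ] ℝ) (p : E → E) (y : E) : E →L[ℝ] E :=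
  fderiv ℝ p y + (christoffelL G y).flip (p y)

lemma covariant_apply (G : E → E →L[ℝ] E →L[ℝ] ℝ) (p : E → E) (y v : E) :
    covariant G p y v = fderiv ℝ p y v + christoffel G y v (p y) := by
  simp [covariant, christoffelL_apply]

lemma covariant_smul (G : E → E →L[ℝ] E →L[ℝ] ℝ) {p : E → E} {f : E → ℝ} {y : E}
    {f' : E →L[ℝ] ℝ} (hf : HasFDerivAt f f' y) (hp : DifferentiableAt ℝ p y) (v : E) :
    covariant G (fun y => f y • p y) y v = f' v • p y + f y • covariant G p y v := by
  simp only [covariant_apply, ← christoffelL_apply, (hf.fun_smul hp.hasFDerivAt).fderiv, map_smul,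
    add_apply, smul_apply, ContinuousLinearMap.smulRight_apply]
  module

variable {G : E → E →L[ℝ] E →L[ℝ] ℝ} {D : Set E} {x : E}

lemma christoffel_koszul (h : (G x).IsInvertible) (v w u : E) :
    G x (christoffel G x v w) u
      = (1 / 2 : ℝ) * (fderiv ℝ G x v w u + fderiv ℝ G x w v u - fderiv ℝ G x u v w) := by
  obtain ⟨e, he⟩ := h
  rw [christoffel, ← he, ContinuousLinearMap.inverse_equiv]
  simp

/-- A smooth pseudo-Riemannian metric on an open subset of a vector space; `invertible` says that
it is nondegenerate. -/
structure IsPseudoRiemannian (D : Set E) (G : E → E →L[ℝ] E →L[ℝ] ℝ) : Prop where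
  isOpen : IsOpen D
  smooth : ContDiffOn ℝ ∞ G D
  symm : ∀ y ∈ D, ∀ v w, G y v w = G y w v
  invertible : ∀ y ∈ D, (G y).IsInvertible

namespace IsPseudoRiemannian

lemma differentiableAt (h : IsPseudoRiemannian D G) (hx : x ∈ D) : DifferentiableAt ℝ G x :=
  (hasFDerivAt_of_contDiffOn h.smooth h.isOpen hx).differentiableAt

lemma fderiv_symm (h : IsPseudoRiemannian D G) (hx : x ∈ D) (u v w : E) :
    fderiv ℝ G x u v w = fderiv ℝ G x u w v := by
  have hG := h.differentiableAt hx
  have apply_apply (v w : E) : fderiv ℝ (fun y => G y v w) x u = fderiv ℝ G x u v w := by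
    rw [fderiv_apply_apply (hG.clm_apply (differentiableAt_const v)), fderiv_apply_apply hG]
  rw [← apply_apply, ← apply_apply]
  have heq : (fun y => G y v w) =ᶠ[nhds x] fun y => G y w v :=
    Filter.eventually_of_mem (h.isOpen.mem_nhds hx) fun y hy => h.symm y hy v w
  rw [heq.fderiv_eq]

lemma christoffel_symm (h : IsPseudoRiemannian D G) (hx : x ∈ D) (v w : E) :
    christoffel G x v w = christoffel G x w v := by
  have hflip : ((fderiv ℝ G x).flip v).flip w = ((fderiv ℝ G x).flip w).flip v := by
    ext u
    exact h.fderiv_symm hx u v w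
  rw [christoffel, christoffel, hflip, add_comm (fderiv ℝ G x v w)]

lemma fderiv_apply (h : IsPseudoRiemannian D G) (hx : x ∈ D) (v w u : E) :
    fderiv ℝ G x v w u = G x (christoffel G x v w) u + G x w (christoffel G x v u) := by
  rw [h.symm x hx w, christoffel_koszul (h.invertible x hx),
    christoffel_koszul (h.invertible x hx), h.fderiv_symm hx v u w]
  ring

lemma covariant_metric (h : IsPseudoRiemannian D G) {r s : E → E} (hr : ContDiffOn ℝ ∞ r D)
    (hs : ContDiffOn ℝ ∞ s D) {c : ℝ} (hc : ∀ y ∈ D, G y (r y) (s y) = c) (hx : x ∈ D) (v : E) :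
    G x (covariant G r x v) (s x) + G x (r x) (covariant G s x v) = 0 := by
  have hderiv := ((h.differentiableAt hx).hasFDerivAt.clm_apply
    (hasFDerivAt_of_contDiffOn hr h.isOpen hx)).clm_apply
    (hasFDerivAt_of_contDiffOn hs h.isOpen hx)
  have hconst := hderiv.unique ((hasFDerivAt_const c x).congr_of_eventuallyEq
    (Filter.eventually_of_mem (h.isOpen.mem_nhds hx) hc))
  have hzero : G x (r x) (fderiv ℝ s x v)
      + (G x (fderiv ℝ r x v) (s x) + fderiv ℝ G x v (r x) (s x)) = 0 := by
    simpa using congrArg (fun A => A v) hconst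
  rw [h.fderiv_apply hx] at hzero
  simp only [covariant_apply, map_add, add_apply]
  linear_combination hzero

variable [CompleteSpace E]

lemma smooth_christoffelL (h : IsPseudoRiemannian D G) : ContDiffOn ℝ ∞ (christoffelL G) D := by
  have hinverse : ContDiffOn ℝ ∞ (fun y => (G y).inverse) D := fun y hy =>
    ((h.invertible y hy).contDiffAt_map_inverse.comp y
      (h.smooth.contDiffAt (h.isOpen.mem_nhds hy))).contDiffWithinAt
  have hderiv := contDiffOn_fderiv h.smooth h.isOpen
  have hflip := (ContinuousLinearMap.flipₗᵢ ℝ E E (E →L[ℝ] ℝ)).contDiff.comp_contDiffOn hderiv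
  exact ((ContinuousLinearMap.compL ℝ E (E →L[ℝ] ℝ) E).contDiff.comp_contDiffOn hinverse).clm_comp
    (((hderiv.add hflip).sub (contDiffOn_const.clm_comp hflip)).const_smul (1 / 2 : ℝ))

lemma smooth_covariant (h : IsPseudoRiemannian D G) {p : E → E} (hp : ContDiffOn ℝ ∞ p D) :
    ContDiffOn ℝ ∞ (covariant G p) D :=
  (contDiffOn_fderiv hp h.isOpen).add
    (((ContinuousLinearMap.flipₗᵢ ℝ E E E).contDiff.comp_contDiffOn h.smooth_christoffelL).clm_apply
      hp)

lemma curvature_eq (h : IsPseudoRiemannian D G) (hx : x ∈ D) (v w z : E) :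
    curvature G x v w z = fderiv ℝ (christoffelL G) x v w z - fderiv ℝ (christoffelL G) x w v z
      + christoffelL G x v (christoffelL G x w z) - christoffelL G x w (christoffelL G x v z) := by
  have hΓ := (hasFDerivAt_of_contDiffOn h.smooth_christoffelL h.isOpen hx).differentiableAt
  have apply_apply (a b c : E) : fderiv ℝ (fun y => christoffelL G y a b) x c
      = fderiv ℝ (christoffelL G) x c a b := by
    rw [fderiv_apply_apply (hΓ.clm_apply (differentiableAt_const a)), fderiv_apply_apply hΓ]
  simp only [curvature, ← christoffelL_apply, apply_apply]

end IsPseudoRiemannian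

end LeviCivita

/-! ### Null frames -/

section NullFrame

variable {E : Type*} [NormedAddCommGroup E] [NormedSpace ℝ E]

/-- Two null vectors of the symmetric bilinear form `B` with product `-1`. -/
structure IsNullPair (B : E →L[ℝ] E →L[ℝ] ℝ) (p q : E) : Prop where
  symm : ∀ v w, B v w = B w v
  pp : B p p = 0
  qq : B q q = 0
  pq : B p q = -1

lemma apply_add_div_smul_self_eq_zero {B : E →L[ℝ] E →L[ℝ] ℝ} (hs : ∀ v w, B v w = B w v)
    {a b : E} {r : ℝ} (hr : r ≠ 0) (hroot : r ^ 2 + 2 * B a b * r + B a a * B b b = 0) :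
    B (a + (B a a / r) • b) (a + (B a a / r) • b) = 0 := by
  simp only [map_add, map_smul, add_apply, smul_apply, smul_eq_mul, hs b a]
  field_simp
  linear_combination B a a * hroot

lemma exists_smooth_root {D : Set E} (hD : IsOpen D) {β γ : E → ℝ} (hβ : ContDiffOn ℝ ∞ β D)
    (hγ : ContDiffOn ℝ ∞ γ D) {x : E} (hx : x ∈ D) (hβx : β x < 0) (hγx : γ x = 0) :
    ∃ (D' : Set E) (r : E → ℝ), IsOpen D' ∧ x ∈ D' ∧ D' ⊆ D ∧ ContDiffOn ℝ ∞ r D' ∧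
      ∀ y ∈ D', r y ≠ 0 ∧ r y ^ 2 + 2 * β y * r y + γ y = 0 := by
  have hdisc := (hβ.pow 2).sub hγ
  set D₁ : Set E := D ∩ (fun y => β y ^ 2 - γ y) ⁻¹' Set.Ioi 0
  have hD₁ : IsOpen D₁ := hdisc.continuousOn.isOpen_inter_preimage hD isOpen_Ioi
  set r : E → ℝ := fun y => -β y + √(β y ^ 2 - γ y)
  have hr : ContDiffOn ℝ ∞ r D₁ := (hβ.mono Set.inter_subset_left).neg.add
    ((hdisc.mono Set.inter_subset_left).sqrt fun y hy => ne_of_gt hy.2)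
  refine ⟨D₁ ∩ r ⁻¹' Set.Ioi 0, r, hr.continuousOn.isOpen_inter_preimage hD₁ isOpen_Ioi,
    ⟨⟨hx, ?_⟩, ?_⟩, fun y hy => hy.1.1, hr.mono Set.inter_subset_left,
    fun y hy => ⟨ne_of_gt hy.2, ?_⟩⟩
  · simpa [hγx] using sq_pos_iff.mpr hβx.ne
  · exact add_pos_of_pos_of_nonneg (neg_pos.mpr hβx) (Real.sqrt_nonneg _)
  · have hsq := Real.sq_sqrt (le_of_lt hy.1.2 : 0 ≤ β y ^ 2 - γ y)
    linear_combination hsq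

/-- A smooth symmetric bilinear form on an open set, with a smooth pair of null vectors. -/
structure IsNullFramedMetric (D : Set E) (G : E → E →L[ℝ] E →L[ℝ] ℝ) (p q : E → E) : Prop where
  isOpen : IsOpen D
  smooth : ContDiffOn ℝ ∞ G D
  smooth_p : ContDiffOn ℝ ∞ p D
  smooth_q : ContDiffOn ℝ ∞ q D
  null : ∀ y ∈ D, IsNullPair (G y) (p y) (q y)

lemma exists_isNullFramedMetric {G : E → E →L[ℝ] E →L[ℝ] ℝ} {D : Set E} (hD : IsOpen D)
    (hG : ContDiffOn ℝ ∞ G D) (hs : ∀ y ∈ D, ∀ v w, G y v w = G y w v) {x a b : E} (hx : x ∈ D)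
    (hab : IsNullPair (G x) a b) :
    ∃ D' ⊆ D, x ∈ D' ∧ ∃ p q, IsNullFramedMetric D' G p q := by
  have smooth_apply (v w : E) : ContDiffOn ℝ ∞ (fun y => G y v w) D :=
    (hG.clm_apply contDiffOn_const).clm_apply contDiffOn_const
  obtain ⟨D₁, r, hD₁, hx₁, hsub, hr, hroot⟩ := exists_smooth_root hD (smooth_apply a b)
    ((smooth_apply a a).mul (smooth_apply b b)) hx (by simp [hab.pq]) (by simp [hab.pp])
  set p : E → E := fun y => a + (G y a a / r y) • b
  set q : E → E := fun y => b + (G y b b / r y) • a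
  have hp : ContDiffOn ℝ ∞ p D₁ := contDiffOn_const.add
    ((((smooth_apply a a).mono hsub).div hr fun y hy => (hroot y hy).1).smul contDiffOn_const)
  have hq : ContDiffOn ℝ ∞ q D₁ := contDiffOn_const.add
    ((((smooth_apply b b).mono hsub).div hr fun y hy => (hroot y hy).1).smul contDiffOn_const)
  set m : E → ℝ := fun y => -G y (p y) (q y)
  have hm : ContDiffOn ℝ ∞ m D₁ := (((hG.mono hsub).clm_apply hp).clm_apply hq).neg
  have hmx : m x = 1 := by simp [m, p, q, hab.pp, hab.qq, hab.pq]
  have hpos : D₁ ∩ m ⁻¹' Set.Ioi 0 ⊆ D₁ := Set.inter_subset_left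
  refine ⟨D₁ ∩ m ⁻¹' Set.Ioi 0, hpos.trans hsub, ⟨hx₁, by simp [hmx]⟩, p, fun y => (m y)⁻¹ • q y,
    hm.continuousOn.isOpen_inter_preimage hD₁ isOpen_Ioi, hG.mono (hpos.trans hsub), hp.mono hpos,
    ((hm.mono hpos).inv fun y hy => ne_of_gt hy.2).smul (hq.mono hpos), fun y hy => ?_⟩
  obtain ⟨hr_ne, hr_root⟩ := hroot y hy.1
  have hsy := hs y (hsub hy.1)
  refine ⟨hsy, apply_add_div_smul_self_eq_zero hsy hr_ne hr_root, ?_, ?_⟩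
  · have hqq : G y (q y) (q y) = 0 := apply_add_div_smul_self_eq_zero hsy hr_ne
      (by rw [hsy b a]; linear_combination hr_root)
    simp [hqq]
  · have hpq : G y (p y) (q y) = -m y := (neg_neg _).symm
    simp [hpq, (ne_of_gt hy.2 : m y ≠ 0)]

namespace IsNullPair

variable {B : E →L[ℝ] E →L[ℝ] ℝ} {p q : E}

lemma qp (h : IsNullPair B p q) : B q p = -1 := by
  rw [h.symm, h.pq]

lemma swap (h : IsNullPair B p q) : IsNullPair B q p :=
  ⟨h.symm, h.qq, h.pp, h.qp⟩

variable {B : ℝ² →L[ℝ] ℝ² →L[ℝ] ℝ} {p q : ℝ²}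

lemma injective_ofPartials (h : IsNullPair B p q) :
    Function.Injective (ofPartials p q).toLinearMap := by
  refine (injective_iff_map_eq_zero _).mpr fun w (hw : w 0 • p + w 1 • q = 0) => ?_
  have hp := congrArg (B p) hw
  have hq := congrArg (B q) hw
  simp only [map_add, map_smul, h.pp, h.pq, h.qq, h.qp, smul_eq_mul, map_zero] at hp hq
  ext i
  fin_cases i
  exacts [by simpa using hq, by simpa using hp]

/-- The coordinates of a vector of the plane in the null basis `p`, `q`. -/
def coordinates (h : IsNullPair B p q) : ℝ² ≃L[ℝ] ℝ² :=
  (LinearEquiv.ofInjectiveEndo _ h.injective_ofPartials).toContinuousLinearEquiv.symm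

lemma coordinates_expand (h : IsNullPair B p q) (v : ℝ²) :
    h.coordinates v 0 • p + h.coordinates v 1 • q = v :=
  h.coordinates.symm_apply_apply v

lemma coordinates_zero (h : IsNullPair B p q) (v : ℝ²) : h.coordinates v 0 = -B q v := by
  conv_rhs => rw [← h.coordinates_expand v]
  simp [h.qp, h.qq]

lemma coordinates_one (h : IsNullPair B p q) (v : ℝ²) : h.coordinates v 1 = -B p v := by
  conv_rhs => rw [← h.coordinates_expand v]
  simp [h.pp, h.pq]

lemma apply_eq (h : IsNullPair B p q) (v w : ℝ²) :
    B v w = -(h.coordinates v 0 * h.coordinates w 1 + h.coordinates v 1 * h.coordinates w 0) := by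
  rw [h.coordinates_zero w, h.coordinates_one w]
  conv_lhs => rw [← h.coordinates_expand v]
  simp only [map_add, map_smul, add_apply, smul_apply, smul_eq_mul]
  ring

lemma ext (h : IsNullPair B p q) {v w : ℝ²} (hp : B p v = B p w) (hq : B q v = B q w) : v = w := by
  rw [← h.coordinates_expand v, ← h.coordinates_expand w]
  simp only [h.coordinates_zero, h.coordinates_one, hp, hq]

lemma isInvertible (h : IsNullPair B p q) : B.IsInvertible :=
  isInvertible_of_nondegenerate fun t ht =>
    h.ext (by rw [h.symm, ht, map_zero]) (by rw [h.symm, ht, map_zero])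

end IsNullPair

end NullFrame

/-! ### Flat Lorentzian metrics in the plane -/

namespace IsNullFramedMetric

variable {D D' : Set ℝ²} {G : ℝ² → ℝ² →L[ℝ] ℝ² →L[ℝ] ℝ} {p q : ℝ² → ℝ²} {y : ℝ²}

lemma mono (h : IsNullFramedMetric D G p q) (hD' : IsOpen D') (hsub : D' ⊆ D) :
    IsNullFramedMetric D' G p q where
  isOpen := hD'
  smooth := h.smooth.mono hsub
  smooth_p := h.smooth_p.mono hsub
  smooth_q := h.smooth_q.mono hsub
  null y hy := h.null y (hsub hy)

lemma swap (h : IsNullFramedMetric D G p q) : IsNullFramedMetric D G q p where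
  isOpen := h.isOpen
  smooth := h.smooth
  smooth_p := h.smooth_q
  smooth_q := h.smooth_p
  null y hy := (h.null y hy).swap

lemma isPseudoRiemannian (h : IsNullFramedMetric D G p q) : IsPseudoRiemannian D G where
  isOpen := h.isOpen
  smooth := h.smooth
  symm y hy := (h.null y hy).symm
  invertible y hy := (h.null y hy).isInvertible

/-- The connection form of the null frame `p`, `q`: `∇p = connForm ⊗ p`, `∇q = -connForm ⊗ q`. -/
def connForm (G : ℝ² → ℝ² →L[ℝ] ℝ² →L[ℝ] ℝ) (p q : ℝ² → ℝ²) (y : ℝ²) : ℝ² →L[ℝ] ℝ :=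
  -(G y (q y)).comp (covariant G p y)

lemma covariant_p (h : IsNullFramedMetric D G p q) (hy : y ∈ D) (v : ℝ²) :
    covariant G p y v = connForm G p q y v • p y := by
  have hn := h.null y hy
  have hmetric := h.isPseudoRiemannian.covariant_metric h.smooth_p h.smooth_p
    (fun y hy => (h.null y hy).pp) hy v
  rw [hn.symm] at hmetric
  refine hn.ext ?_ ?_
  · rw [map_smul, hn.pp, smul_zero]
    linarith
  · simp [hn.qp, connForm]

lemma covariant_q (h : IsNullFramedMetric D G p q) (hy : y ∈ D) (v : ℝ²) :
    covariant G q y v = -connForm G p q y v • q y := by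
  have hmetric := h.isPseudoRiemannian.covariant_metric h.smooth_p h.smooth_q
    (fun y hy => (h.null y hy).pq) hy v
  rw [(h.null y hy).symm (covariant G p y v)] at hmetric
  have hform : connForm G q p y v = -connForm G p q y v := by
    simp only [connForm, neg_apply, ContinuousLinearMap.comp_apply]
    linarith
  rw [h.swap.covariant_p hy, hform]

lemma smooth_connForm (h : IsNullFramedMetric D G p q) : ContDiffOn ℝ ∞ (connForm G p q) D :=
  ((h.smooth.clm_apply h.smooth_q).clm_comp
    (h.isPseudoRiemannian.smooth_covariant h.smooth_p)).neg

lemma fderiv_p (h : IsNullFramedMetric D G p q) (hy : y ∈ D) (v : ℝ²) :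
    fderiv ℝ p y v = connForm G p q y v • p y - christoffelL G y v (p y) := by
  rw [← h.covariant_p hy, covariant_apply, christoffelL_apply, add_sub_cancel_right]

lemma second_fderiv_p (h : IsNullFramedMetric D G p q) (hy : y ∈ D) (v w : ℝ²) :
    fderiv ℝ (fderiv ℝ p) y v w
      = fderiv ℝ (connForm G p q) y v w • p y + connForm G p q y w • fderiv ℝ p y v
        - (fderiv ℝ (christoffelL G) y v w (p y) + christoffelL G y w (fderiv ℝ p y v)) := by
  have hp := hasFDerivAt_of_contDiffOn h.smooth_p h.isOpen hy
  have hp' := hasFDerivAt_of_contDiffOn (contDiffOn_fderiv h.smooth_p h.isOpen) h.isOpen hy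
  have hΓ := hasFDerivAt_of_contDiffOn h.isPseudoRiemannian.smooth_christoffelL h.isOpen hy
  have hω := hasFDerivAt_of_contDiffOn h.smooth_connForm h.isOpen hy
  have hright := ((hasFDerivAt_apply hω w).smul hp).sub ((hasFDerivAt_apply hΓ w).clm_apply hp)
  have hunique := (hasFDerivAt_apply hp' w).unique (hright.congr_of_eventuallyEq
    (Filter.eventually_of_mem (h.isOpen.mem_nhds hy) fun x hx => h.fderiv_p hx w))
  have hv := congrArg (fun A => A v) hunique
  simp only [add_apply, sub_apply, ContinuousLinearMap.comp_apply, ContinuousLinearMap.flip_apply,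
    smul_apply, ContinuousLinearMap.smulRight_apply] at hv
  rw [hv]
  abel

/-- Cartan's second structure equation for a null frame. -/
lemma curvature_p (h : IsNullFramedMetric D G p q) (hy : y ∈ D) (v w : ℝ²) :
    curvature G y v w (p y)
      = (fderiv ℝ (connForm G p q) y v w - fderiv ℝ (connForm G p q) y w v) • p y := by
  have hsymm := second_fderiv_symm h.smooth_p h.isOpen hy v w
  rw [h.second_fderiv_p hy, h.second_fderiv_p hy, h.fderiv_p hy, h.fderiv_p hy, map_sub, map_sub,
    map_smul, map_smul] at hsymm
  rw [h.isPseudoRiemannian.curvature_eq hy]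
  linear_combination (norm := module) -hsymm

lemma connForm_closed (h : IsNullFramedMetric D G p q) (hy : y ∈ D)
    (hflat : ∀ u v w, curvature G y u v w = 0) (v w : ℝ²) :
    fderiv ℝ (connForm G p q) y v w = fderiv ℝ (connForm G p q) y w v := by
  have hp : p y ≠ 0 := fun hp => by simpa [hp] using (h.null y hy).pq
  refine sub_eq_zero.mp ((smul_eq_zero.mp ?_).resolve_right hp)
  rw [← h.curvature_p hy, hflat]

lemma exists_parallel (h : IsNullFramedMetric D G p q) (hD : Convex ℝ D)
    (hflat : ∀ y ∈ D, ∀ u v w, curvature G y u v w = 0) :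
    ∃ P Q, IsNullFramedMetric D G P Q ∧ (∀ y ∈ D, covariant G P y = 0) ∧
      ∀ y ∈ D, covariant G Q y = 0 := by
  obtain ⟨f, hf, hf'⟩ := exists_smooth_primitive hD h.isOpen h.smooth_connForm
    fun y hy => h.connForm_closed hy (hflat y hy)
  refine ⟨fun y => Real.exp (-f y) • p y, fun y => Real.exp (f y) • q y,
    ⟨h.isOpen, h.smooth, hf.neg.exp.smul h.smooth_p, hf.exp.smul h.smooth_q, fun y hy => ?_⟩,
    fun y hy => ?_, fun y hy => ?_⟩
  · have hn := h.null y hy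
    exact ⟨hn.symm, by simp [hn.pp], by simp [hn.qq], by simp [hn.pq, ← Real.exp_add]⟩
  · ext1 v
    rw [covariant_smul G (hf' y hy).fun_neg.exp
      (hasFDerivAt_of_contDiffOn h.smooth_p h.isOpen hy).differentiableAt, h.covariant_p hy]
    simp only [smul_apply, neg_apply, zero_apply, smul_eq_mul]
    module
  · ext1 v
    rw [covariant_smul G (hf' y hy).exp
      (hasFDerivAt_of_contDiffOn h.smooth_q h.isOpen hy).differentiableAt, h.covariant_q hy]
    simp only [smul_apply, zero_apply, smul_eq_mul]
    module

lemma exists_primitive (h : IsNullFramedMetric D G p q) (hD : Convex ℝ D)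
    (hp : ∀ y ∈ D, covariant G p y = 0) :
    ∃ f : ℝ² → ℝ, ContDiffOn ℝ ∞ f D ∧ ∀ y ∈ D, HasFDerivAt f (-G y (p y)) y := by
  refine exists_smooth_primitive hD h.isOpen (h.smooth.clm_apply h.smooth_p).neg
    fun y hy v w => ?_
  have hG := h.isPseudoRiemannian
  have hfderiv_p (v : ℝ²) : fderiv ℝ p y v = -christoffel G y v (p y) :=
    eq_neg_of_add_eq_zero_left (by rw [← covariant_apply, hp y hy, zero_apply])
  have hfderiv (v w : ℝ²) : fderiv ℝ (fun y => -G y (p y)) y v w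
      = -G y (p y) (christoffel G y v w) := by
    have hderiv := ((hG.differentiableAt hy).hasFDerivAt.clm_apply
      (hasFDerivAt_of_contDiffOn h.smooth_p h.isOpen hy)).fun_neg
    simp [hderiv.fderiv, hfderiv_p, hG.fderiv_apply hy]
  exact (hfderiv v w).trans (by rw [hG.christoffel_symm hy]; exact (hfderiv w v).symm)

/-- Parallel null fields are dual to exact forms, whose primitives are null coordinates. -/
lemma exists_flat_map (h : IsNullFramedMetric D G p q) (hD : Convex ℝ D)
    (hflat : ∀ y ∈ D, ∀ u v w, curvature G y u v w = 0) :
    ∃ F : ℝ² → ℝ², ContDiffOn ℝ ∞ F D ∧ ∀ y ∈ D, ∃ A : ℝ² ≃L[ℝ] ℝ²,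
      HasFDerivAt F (A : ℝ² →L[ℝ] ℝ²) y ∧
        ∀ v w, G y v w = -(A v 0 * A w 1 + A v 1 * A w 0) := by
  obtain ⟨P, Q, hPQ, hP, hQ⟩ := h.exists_parallel hD hflat
  obtain ⟨f, hf, hf'⟩ := hPQ.swap.exists_primitive hD hQ
  obtain ⟨g, hg, hg'⟩ := hPQ.exists_primitive hD hP
  refine ⟨fun y => f y • 𝐞₀ + g y • 𝐞₁, (hf.smul contDiffOn_const).add (hg.smul contDiffOn_const),
    fun y hy => ⟨(hPQ.null y hy).coordinates, ?_, (hPQ.null y hy).apply_eq⟩⟩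
  refine (((hf' y hy).smul_const _).add ((hg' y hy).smul_const _)).congr_fderiv ?_
  ext1 v
  rw [ContinuousLinearEquiv.coe_coe, eq_smul_add_smul ((hPQ.null y hy).coordinates v),
    IsNullPair.coordinates_zero, IsNullPair.coordinates_one]
  rfl

end IsNullFramedMetric

lemma exists_openPartialHomeomorph_of_contDiffOn {E : Type*} [NormedAddCommGroup E]
    [NormedSpace ℝ E] [CompleteSpace E] {F : E → E} {D : Set E} (hD : IsOpen D)
    (hF : ContDiffOn ℝ ∞ F D) (hF' : ∀ y ∈ D, ∃ A : E ≃L[ℝ] E, HasFDerivAt F (A : E →L[ℝ] E) y)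
    {x : E} (hx : x ∈ D) :
    ∃ e : OpenPartialHomeomorph E E, x ∈ e.source ∧ e.source ⊆ D ∧ ⇑e = F ∧
      ContDiffOn ℝ ∞ e.symm e.target := by
  obtain ⟨A, hA⟩ := hF' x hx
  have hFx := hF.contDiffAt (hD.mem_nhds hx)
  let e := (hFx.toOpenPartialHomeomorph F hA (by simp)).restrOpen D hD
  refine ⟨e, ⟨hFx.mem_toOpenPartialHomeomorph_source hA (by simp), hx⟩, fun y hy => hy.2, rfl,
    fun y hy => ?_⟩
  have hD_symm : e.symm y ∈ D := (e.map_target hy).2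
  obtain ⟨A', hA'⟩ := hF' _ hD_symm
  exact (e.contDiffAt_symm hy hA' (hF.contDiffAt (hD.mem_nhds hD_symm))).contDiffWithinAt

theorem exists_flat_null_coordinates {D : Set ℝ²} {G : ℝ² → ℝ² →L[ℝ] ℝ² →L[ℝ] ℝ} (hD : IsOpen D)
    (hG : ContDiffOn ℝ ∞ G D) (hs : ∀ y ∈ D, ∀ v w, G y v w = G y w v)
    (hflat : ∀ y ∈ D, ∀ u v w, curvature G y u v w = 0) {x a b : ℝ²} (hx : x ∈ D)
    (hab : IsNullPair (G x) a b) :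
    ∃ e : OpenPartialHomeomorph ℝ² ℝ², x ∈ e.source ∧ e.source ⊆ D ∧ ContDiffOn ℝ ∞ e e.source ∧
      ContDiffOn ℝ ∞ e.symm e.target ∧ ∀ y ∈ e.source, ∀ v w, G y v w
        = -(fderiv ℝ e y v 0 * fderiv ℝ e y w 1 + fderiv ℝ e y v 1 * fderiv ℝ e y w 0) := by
  obtain ⟨D', hsub, hx', p, q, h⟩ := exists_isNullFramedMetric hD hG hs hx hab
  obtain ⟨r, hr, hball⟩ := Metric.isOpen_iff.mp h.isOpen x hx'
  obtain ⟨F, hF, hF'⟩ := (h.mono Metric.isOpen_ball hball).exists_flat_map (convex_ball x r)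
    fun y hy => hflat y (hsub (hball hy))
  obtain ⟨e, hxe, he, rfl, hsymm⟩ := exists_openPartialHomeomorph_of_contDiffOn Metric.isOpen_ball
    hF (fun y hy => (hF' y hy).imp fun _ hA => hA.1) (Metric.mem_ball_self hr)
  refine ⟨e, hxe, he.trans (hball.trans hsub), hF.mono he, hsymm, fun y hy v w => ?_⟩
  obtain ⟨A, hA, hGA⟩ := hF' y (he hy)
  rw [hA.fderiv, hGA]
  rfl

/-! ### Lifts to the pseudosphere -/

section UnitLift

variable {E : Type*} [NormedAddCommGroup E] [NormedSpace ℝ E]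

/-- The pull-back by `z` of the connection form of the Hopf fibration. -/
def hopfForm (z : E → Fin 3 → ℂ) (x : E) : E →L[ℝ] ℂ := (hermL (z x)).comp (fderiv ℝ z x)

/-- The horizontal part of the derivative of `z`. -/
def hderiv (z : E → Fin 3 → ℂ) (x : E) : E →L[ℝ] Fin 3 → ℂ :=
  fderiv ℝ z x - ((ContinuousLinearMap.lsmul ℝ ℂ : ℂ →L[ℝ] _).flip (z x)).comp (hopfForm z x)

/-- The metric induced by the composition of `z` with the Hopf fibration. -/
def hmetric (z : E → Fin 3 → ℂ) (x : E) : E →L[ℝ] E →L[ℝ] ℝ :=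
  reHerm.bilinearComp (hderiv z x) (hderiv z x)

/-- The derivative in the direction `v` of the horizontal field `y ↦ hderiv z y w`, with the Hopf
connection subtracted: multiplying `z` by a phase multiplies its horizontal part by that phase. -/
def hcovariant (z : E → Fin 3 → ℂ) (x v w : E) : Fin 3 → ℂ :=
  fderiv ℝ (hderiv z) x v w - hopfForm z x v • hderiv z x w

/-- A symmetric form of `hcovariant`, from which it differs by a multiple of `z x`. -/
def hsecond (z : E → Fin 3 → ℂ) (x v w : E) : Fin 3 → ℂ :=
  fderiv ℝ (fderiv ℝ z) x v w - hopfForm z x w • hderiv z x v - hopfForm z x v • hderiv z x w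

lemma hopfForm_apply (z : E → Fin 3 → ℂ) (x v : E) :
    hopfForm z x v = herm (z x) (fderiv ℝ z x v) := rfl

lemma hderiv_apply (z : E → Fin 3 → ℂ) (x v : E) :
    hderiv z x v = fderiv ℝ z x v - hopfForm z x v • z x := rfl

lemma hmetric_apply (z : E → Fin 3 → ℂ) (x v w : E) :
    hmetric z x v w = (herm (hderiv z x v) (hderiv z x w)).re := rfl

lemma hmetric_symm (z : E → Fin 3 → ℂ) (x v w : E) : hmetric z x v w = hmetric z x w v := by
  rw [hmetric_apply, hmetric_apply, herm_re_comm]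

/-- A smooth map from an open set to the pseudosphere. -/
structure IsUnitLift (D : Set E) (z : E → Fin 3 → ℂ) : Prop where
  isOpen : IsOpen D
  smooth : ContDiffOn ℝ ∞ z D
  unit : ∀ y ∈ D, herm (z y) (z y) = 1

namespace IsUnitLift

variable {z : E → Fin 3 → ℂ} {D : Set E} {x : E}

lemma smooth_hopfForm (h : IsUnitLift D z) : ContDiffOn ℝ ∞ (hopfForm z) D :=
  (hermL.contDiff.comp_contDiffOn h.smooth).clm_comp (contDiffOn_fderiv h.smooth h.isOpen)

lemma smooth_hderiv (h : IsUnitLift D z) : ContDiffOn ℝ ∞ (hderiv z) D := by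
  have hvertical : ContDiffOn ℝ ∞ (fun y => (ContinuousLinearMap.lsmul ℝ ℂ :
      ℂ →L[ℝ] (Fin 3 → ℂ) →L[ℝ] (Fin 3 → ℂ)).flip (z y)) D :=
    (ContinuousLinearMap.contDiff _).comp_contDiffOn h.smooth
  exact (contDiffOn_fderiv h.smooth h.isOpen).sub (hvertical.clm_comp h.smooth_hopfForm)

lemma smooth_hmetric [FiniteDimensional ℝ E] (h : IsUnitLift D z) :
    ContDiffOn ℝ ∞ (hmetric z) D := by
  refine contDiffOn_clm_apply.mpr fun v => contDiffOn_clm_apply.mpr fun w => ?_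
  have hH (u : E) : ContDiffOn ℝ ∞ (fun y => hderiv z y u) D :=
    h.smooth_hderiv.clm_apply contDiffOn_const
  exact Complex.reCLM.contDiff.comp_contDiffOn
    ((hermL.contDiff.comp_contDiffOn (hH v)).clm_apply (hH w))

lemma herm_hderiv (h : IsUnitLift D z) (hx : x ∈ D) (v : E) : herm (z x) (hderiv z x v) = 0 := by
  rw [hderiv_apply, herm_sub_right, herm_smul_right, h.unit x hx, hopfForm_apply, mul_one, sub_self]

lemma hopfForm_re (h : IsUnitLift D z) (hx : x ∈ D) (v : E) : (hopfForm z x v).re = 0 := by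
  have hz := hasFDerivAt_of_contDiffOn h.smooth h.isOpen hx
  have hconst := (hermL.hasFDerivAt_of_bilinear hz hz).unique
    ((hasFDerivAt_const (1 : ℂ) x).congr_of_eventuallyEq
      (Filter.eventually_of_mem (h.isOpen.mem_nhds hx) h.unit))
  have hsum : herm (z x) (fderiv ℝ z x v) + herm (fderiv ℝ z x v) (z x) = 0 := by
    simpa using congrArg (fun A => A v) hconst
  have hre := congrArg Complex.re hsum
  rw [Complex.add_re, herm_re_comm (fderiv ℝ z x v), Complex.zero_re] at hre
  rw [hopfForm_apply]
  linarith

lemma hsecond_symm (h : IsUnitLift D z) (hx : x ∈ D) (v w : E) :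
    hsecond z x v w = hsecond z x w v := by
  rw [hsecond, hsecond, second_fderiv_symm h.smooth h.isOpen hx, sub_right_comm]

lemma exists_hcovariant_eq (h : IsUnitLift D z) (hx : x ∈ D) (v w : E) :
    ∃ c : ℂ, hcovariant z x v w = hsecond z x v w + c • z x := by
  have hH := hasFDerivAt_apply (hasFDerivAt_of_contDiffOn h.smooth_hderiv h.isOpen hx) w
  have hz := hasFDerivAt_of_contDiffOn h.smooth h.isOpen hx
  have hdz := hasFDerivAt_apply
    (hasFDerivAt_of_contDiffOn (contDiffOn_fderiv h.smooth h.isOpen) h.isOpen hx) w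
  have hω := hasFDerivAt_apply (hasFDerivAt_of_contDiffOn h.smooth_hopfForm h.isOpen hx) w
  have hderiv_H : fderiv ℝ (hderiv z) x v w = fderiv ℝ (fderiv ℝ z) x v w
      - (hopfForm z x w • fderiv ℝ z x v + fderiv ℝ (hopfForm z) x v w • z x) := by
    simpa using congrArg (fun A => A v) (hH.unique (hdz.sub (hω.smul hz)))
  have hsplit : fderiv ℝ z x v = hderiv z x v + hopfForm z x v • z x := by
    rw [hderiv_apply, sub_add_cancel]
  refine ⟨-(hopfForm z x w * hopfForm z x v) - fderiv ℝ (hopfForm z) x v w, ?_⟩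
  rw [hcovariant, hderiv_H, hsecond, hsplit]
  module

lemma herm_hcovariant (h : IsUnitLift D z) (hx : x ∈ D) (v w u : E) :
    herm (hcovariant z x v w) (hderiv z x u) = herm (hsecond z x v w) (hderiv z x u) := by
  obtain ⟨c, hc⟩ := h.exists_hcovariant_eq hx v w
  rw [hc, herm_add_left, herm_smul_left, h.herm_hderiv hx, mul_zero, add_zero]

variable [FiniteDimensional ℝ E]

lemma fderiv_hmetric (h : IsUnitLift D z) (hx : x ∈ D) (v w u : E) :
    fderiv ℝ (hmetric z) x v w u = (herm (hcovariant z x v w) (hderiv z x u)).re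
      + (herm (hcovariant z x v u) (hderiv z x w)).re := by
  have hH := hasFDerivAt_of_contDiffOn h.smooth_hderiv h.isOpen hx
  have hproduct := Complex.reCLM.hasFDerivAt.comp x
    (hermL.hasFDerivAt_of_bilinear (hasFDerivAt_apply hH w) (hasFDerivAt_apply hH u))
  have hG := hasFDerivAt_of_contDiffOn h.smooth_hmetric h.isOpen hx
  have hGwu := (hasFDerivAt_apply hG w).clm_apply (hasFDerivAt_const u x)
  have hleibniz : fderiv ℝ (hmetric z) x v w u
      = (herm (hderiv z x w) (fderiv ℝ (hderiv z) x v u)).re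
        + (herm (fderiv ℝ (hderiv z) x v w) (hderiv z x u)).re := by
    simpa using congrArg (fun A => A v) (hGwu.unique hproduct)
  have hcomm : (herm (hderiv z x w) (hderiv z x u)).im
      = -(herm (hderiv z x u) (hderiv z x w)).im := by
    rw [← conj_herm, Complex.conj_im]
  -- The Hopf connection is imaginary, so its two contributions cancel.
  rw [hleibniz, herm_re_comm (hderiv z x w), hcovariant, hcovariant]
  simp only [herm_sub_left, herm_smul_left, Complex.sub_re, Complex.mul_re, Complex.conj_re,
    Complex.conj_im, h.hopfForm_re hx, hcomm]
  ring

/-- O'Neill's formula: `hcovariant` lifts the Levi-Civita connection of the base. -/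
lemma hmetric_christoffel (h : IsUnitLift D z) (hx : x ∈ D) (hi : (hmetric z x).IsInvertible)
    (v w u : E) :
    hmetric z x (christoffel (hmetric z) x v w) u
      = (herm (hcovariant z x v w) (hderiv z x u)).re := by
  rw [christoffel_koszul hi]
  simp only [h.fderiv_hmetric hx, h.herm_hcovariant hx]
  rw [h.hsecond_symm hx w v, h.hsecond_symm hx u v, h.hsecond_symm hx u w]
  ring

end IsUnitLift

end UnitLift

/-! ### The Fubini–Study metric -/

/-- The section of the Hopf fibration whose values are positive multiples of `homog k w`. -/
def unitSection (k : Fin 2) (w : ℂ × ℂ) : Fin 3 → ℂ := (Real.sqrt (lenSq k w))⁻¹ • homog k w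

lemma unitSection_eq_unitPoint (k : Fin 2) {w : ℂ × ℂ} (hw : 0 < lenSq k w) :
    unitSection k w = (unitPoint k w).1 := by
  rw [unitPoint_val k hw, unitSection, ← Complex.coe_smul, Complex.ofReal_inv]

lemma contDiff_lenSq (k : Fin 2) : ContDiff ℝ ∞ (lenSq k) :=
  Complex.reCLM.contDiff.comp
    ((hermL.contDiff.comp (contDiff_homog k)).clm_apply (contDiff_homog k))

lemma smooth_invSqrt_lenSq (k : Fin 2) :
    ContDiffOn ℝ ∞ (fun w => (Real.sqrt (lenSq k w))⁻¹) {w | 0 < lenSq k w} :=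
  ((contDiff_lenSq k).contDiffOn.sqrt fun _ hw => ne_of_gt hw).inv
    fun _ hw => (Real.sqrt_pos.mpr hw).ne'

lemma isUnitLift_unitSection (k : Fin 2) : IsUnitLift {w | 0 < lenSq k w} (unitSection k) where
  isOpen := isOpen_lt continuous_const (continuous_lenSq k)
  smooth := (smooth_invSqrt_lenSq k).smul (contDiff_homog k).contDiffOn
  unit w hw := by rw [unitSection_eq_unitPoint k hw]; exact (unitPoint k w).2

lemma hasFDerivAt_homog (k : Fin 2) (w : ℂ × ℂ) :
    HasFDerivAt (homog k) ((LinearMap.toContinuousLinearMap (planeIncl k)).restrictScalars ℝ) w :=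
  ((LinearMap.toContinuousLinearMap (planeIncl k)).restrictScalars ℝ).hasFDerivAt.add_const _

lemma horizontalLift_apply (k : Fin 2) (w v : ℂ × ℂ) :
    horizontalLift k w v = ((Real.sqrt (lenSq k w) : ℂ)⁻¹) •
        (planeIncl k v - (herm (homog k w) (planeIncl k v) / lenSq k w) • homog k w) := rfl

lemma horizontalLift_smul (k : Fin 2) (w v : ℂ × ℂ) (c : ℂ) :
    horizontalLift k w (c • v) = c • horizontalLift k w v := by
  simp only [horizontalLift_apply, map_smul, herm_smul_right]
  module

lemma herm_homog (k : Fin 2) (w : ℂ × ℂ) : herm (homog k w) (homog k w) = lenSq k w := herm_self _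

lemma hderiv_unitSection (k : Fin 2) {w : ℂ × ℂ} (hw : 0 < lenSq k w) :
    hderiv (unitSection k) w = horizontalLift k w := by
  refine ContinuousLinearMap.ext fun v => ?_
  set r : ℝ := (Real.sqrt (lenSq k w))⁻¹ with hr
  have hrsq : (r : ℂ) ^ 2 * lenSq k w = 1 := by
    rw [hr, ← Complex.ofReal_pow, ← Complex.ofReal_mul, inv_pow, Real.sq_sqrt hw.le,
      inv_mul_cancel₀ hw.ne', Complex.ofReal_one]
  have hne : (lenSq k w : ℂ) ≠ 0 := Complex.ofReal_ne_zero.mpr hw.ne'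
  have hsection : unitSection k w = (r : ℂ) • homog k w := by
    rw [Complex.coe_smul, unitSection, hr]
  obtain ⟨t, ht⟩ : ∃ t : ℝ, fderiv ℝ (unitSection k) w v
      = (r : ℂ) • planeIncl k v + (t : ℂ) • homog k w := by
    have hprod := (hasFDerivAt_of_contDiffOn (smooth_invSqrt_lenSq k)
      (isUnitLift_unitSection k).isOpen hw).smul (hasFDerivAt_homog k w)
    refine ⟨fderiv ℝ (fun w => (Real.sqrt (lenSq k w))⁻¹) w v, ?_⟩
    rw [Complex.coe_smul, Complex.coe_smul]
    exact congrArg (fun A => A v) (HasFDerivAt.fderiv (f := unitSection k) hprod)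
  have hcoeff : (r : ℂ) * (herm (homog k w) (planeIncl k v) / lenSq k w)
      = r ^ 3 * herm (homog k w) (planeIncl k v) := by
    field_simp
    linear_combination -(r * herm (homog k w) (planeIncl k v)) * hrsq
  rw [hderiv_apply, hopfForm_apply, ht, hsection, horizontalLift_apply, ← Complex.ofReal_inv, ← hr]
  simp only [herm_smul_left, herm_add_right, herm_smul_right, herm_homog, Complex.conj_ofReal]
  match_scalars
  · ring
  · linear_combination -(t : ℂ) * hrsq + hcoeff

lemma fubiniStudy_apply (k : Fin 2) (w u v : ℂ × ℂ) :
    fubiniStudy k w u v = (herm (horizontalLift k w u) (horizontalLift k w v)).re := rfl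

lemma fubiniStudy_eq (k : Fin 2) {w : ℂ × ℂ} (hw : 0 < lenSq k w) :
    fubiniStudy k w = hmetric (unitSection k) w := by
  rw [fubiniStudy, hmetric, hderiv_unitSection k hw]

lemma exists_planeIncl_add (k : Fin 2) (w : ℂ × ℂ) (x : Fin 3 → ℂ) :
    ∃ (v : ℂ × ℂ) (c : ℂ), x = planeIncl k v + c • homog k w := by
  have mem_range (y : Fin 3 → ℂ) (hy : y k.succ = 0) : ∃ v, y = planeIncl k v := by
    fin_cases k
    · exact ⟨(y 0, y 2), by ext i; fin_cases i <;> simp_all [planeIncl]⟩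
    · exact ⟨(y 0, y 1), by ext i; fin_cases i <;> simp_all [planeIncl]⟩
  obtain ⟨v, hv⟩ := mem_range (x - x k.succ • homog k w) (by simp [homog_succ])
  exact ⟨v, x k.succ, by rw [← hv, sub_add_cancel]⟩

lemma planeIncl_injective (k : Fin 2) : Function.Injective (planeIncl k) := by
  rw [injective_iff_map_eq_zero]
  intro v hv
  fin_cases k
  · exact Prod.ext (by simpa [planeIncl] using congrFun hv 0)
      (by simpa [planeIncl] using congrFun hv 2)
  · exact Prod.ext (by simpa [planeIncl] using congrFun hv 0)
      (by simpa [planeIncl] using congrFun hv 1)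

lemma planeIncl_succ (k : Fin 2) (v : ℂ × ℂ) : planeIncl k v k.succ = 0 := by
  fin_cases k <;> simp [planeIncl]

lemma herm_homog_horizontalLift (k : Fin 2) {w : ℂ × ℂ} (hw : 0 < lenSq k w) (v : ℂ × ℂ) :
    herm (homog k w) (horizontalLift k w v) = 0 := by
  rw [horizontalLift_apply, herm_smul_right, herm_sub_right, herm_smul_right, herm_homog,
    div_mul_cancel₀ _ (Complex.ofReal_ne_zero.mpr hw.ne'), sub_self, mul_zero]

lemma horizontalLift_injective (k : Fin 2) {w : ℂ × ℂ} (hw : 0 < lenSq k w) :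
    Function.Injective (horizontalLift k w) := by
  rw [injective_iff_map_eq_zero]
  intro v hv
  have hr : (Real.sqrt (lenSq k w) : ℂ) ≠ 0 :=
    Complex.ofReal_ne_zero.mpr (Real.sqrt_pos.mpr hw).ne'
  rw [horizontalLift_apply, smul_eq_zero_iff_right (inv_ne_zero hr)] at hv
  have hcoeff : herm (homog k w) (planeIncl k v) / lenSq k w = 0 := by
    simpa [planeIncl_succ, homog_succ] using congrFun hv k.succ
  rw [hcoeff, zero_smul, sub_zero] at hv
  exact planeIncl_injective k (by rw [hv, map_zero])

lemma herm_eq_zero_of_re_horizontalLift (k : Fin 2) {w : ℂ × ℂ} {x : Fin 3 → ℂ}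
    (hx : ∀ u, (herm x (horizontalLift k w u)).re = 0) (u : ℂ × ℂ) :
    herm x (horizontalLift k w u) = 0 := by
  have hI := hx (Complex.I • u)
  rw [horizontalLift_smul, herm_smul_right, Complex.I_mul_re, neg_eq_zero] at hI
  exact Complex.ext (hx u) hI

lemma fubiniStudy_isInvertible (k : Fin 2) {w : ℂ × ℂ} (hw : 0 < lenSq k w) :
    (fubiniStudy k w).IsInvertible := by
  refine isInvertible_of_nondegenerate fun t ht => ?_
  have hr : (Real.sqrt (lenSq k w) : ℂ) ≠ 0 :=
    Complex.ofReal_ne_zero.mpr (Real.sqrt_pos.mpr hw).ne'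
  have hvertical : herm (horizontalLift k w t) (homog k w) = 0 := by
    rw [← conj_herm, herm_homog_horizontalLift k hw, map_zero]
  have hzero : ∀ x, herm (horizontalLift k w t) x = 0 := fun x => by
    obtain ⟨v, c, rfl⟩ := exists_planeIncl_add k w x
    have hhorizontal : herm (horizontalLift k w t) (horizontalLift k w v) = 0 :=
      herm_eq_zero_of_re_horizontalLift k ht v
    rw [horizontalLift_apply k w v, herm_smul_right, herm_sub_right, herm_smul_right, hvertical,
      mul_zero, sub_zero] at hhorizontal
    rw [herm_add_right, herm_smul_right, hvertical, mul_zero, add_zero]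
    exact (mul_eq_zero.mp hhorizontal).resolve_left (inv_ne_zero hr)
  refine horizontalLift_injective k hw ((eq_zero_of_forall_herm_eq_zero fun x => ?_).trans
    (map_zero _).symm)
  rw [← conj_herm, hzero, map_zero]

lemma isPseudoRiemannian_fubiniStudy (k : Fin 2) :
    IsPseudoRiemannian {w | 0 < lenSq k w} (fubiniStudy k) where
  isOpen := (isUnitLift_unitSection k).isOpen
  smooth := (isUnitLift_unitSection k).smooth_hmetric.congr fun _ hw => fubiniStudy_eq k hw
  symm w hw u v := by rw [fubiniStudy_eq k hw, hmetric_symm]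
  invertible _ hw := fubiniStudy_isInvertible k hw

lemma christoffel_congr {E : Type*} [NormedAddCommGroup E] [NormedSpace ℝ E]
    {G G' : E → E →L[ℝ] E →L[ℝ] ℝ} {x : E} (h : G =ᶠ[nhds x] G') (v w : E) :
    christoffel G x v w = christoffel G' x v w := by
  rw [christoffel, christoffel, h.fderiv_eq, h.eq_of_nhds]

lemma fubiniStudy_christoffel (k : Fin 2) {w : ℂ × ℂ} (hw : 0 < lenSq k w) (u v t : ℂ × ℂ) :
    fubiniStudy k w (christoffel (fubiniStudy k) w u v) t
      = (herm (hcovariant (unitSection k) w u v) (hderiv (unitSection k) w t)).re := by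
  have hsection := isUnitLift_unitSection k
  have heq : fubiniStudy k =ᶠ[nhds w] hmetric (unitSection k) :=
    Filter.eventually_of_mem (hsection.isOpen.mem_nhds hw) fun _ hy => fubiniStudy_eq k hy
  rw [christoffel_congr heq, fubiniStudy_eq k hw]
  exact hsection.hmetric_christoffel hw (heq.eq_of_nhds ▸ fubiniStudy_isInvertible k hw) u v t

/-! ### Surfaces in an affine chart -/

/-- A smooth map from an open set of the plane into an affine chart of `CP21`. -/
structure IsChartSurface (k : Fin 2) (D : Set ℝ²) (f : ℝ² → ℂ × ℂ) : Prop where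
  isOpen : IsOpen D
  smooth : ContDiffOn ℝ ∞ f D
  pos : ∀ y ∈ D, 0 < lenSq k (f y)

/-- The lift to the pseudosphere of a surface in an affine chart. -/
def surfaceLift (k : Fin 2) (f : ℝ² → ℂ × ℂ) (y : ℝ²) : Fin 3 → ℂ := unitSection k (f y)

namespace IsChartSurface

variable {k : Fin 2} {D : Set ℝ²} {f : ℝ² → ℂ × ℂ} {y : ℝ²}

lemma isUnitLift (h : IsChartSurface k D f) : IsUnitLift D (surfaceLift k f) where
  isOpen := h.isOpen
  smooth := (isUnitLift_unitSection k).smooth.comp h.smooth h.pos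
  unit y hy := (isUnitLift_unitSection k).unit (f y) (h.pos y hy)

lemma hasFDerivAt (h : IsChartSurface k D f) (hy : y ∈ D) : HasFDerivAt f (fderiv ℝ f y) y :=
  hasFDerivAt_of_contDiffOn h.smooth h.isOpen hy

lemma fderiv_surfaceLift (h : IsChartSurface k D f) (hy : y ∈ D) :
    fderiv ℝ (surfaceLift k f) y = (fderiv ℝ (unitSection k) (f y)).comp (fderiv ℝ f y) :=
  have hsection := isUnitLift_unitSection k
  ((hasFDerivAt_of_contDiffOn hsection.smooth hsection.isOpen (h.pos y hy)).comp y
    (h.hasFDerivAt hy)).fderiv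

lemma hopfForm_surfaceLift (h : IsChartSurface k D f) (hy : y ∈ D) (v : ℝ²) :
    hopfForm (surfaceLift k f) y v = hopfForm (unitSection k) (f y) (fderiv ℝ f y v) := by
  rw [hopfForm_apply, h.fderiv_surfaceLift hy]
  rfl

lemma hderiv_surfaceLift_eq_comp (h : IsChartSurface k D f) (hy : y ∈ D) (v : ℝ²) :
    hderiv (surfaceLift k f) y v = hderiv (unitSection k) (f y) (fderiv ℝ f y v) := by
  rw [hderiv_apply, h.fderiv_surfaceLift hy, h.hopfForm_surfaceLift hy]
  rfl

lemma hderiv_surfaceLift (h : IsChartSurface k D f) (hy : y ∈ D) (v : ℝ²) :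
    hderiv (surfaceLift k f) y v = horizontalLift k (f y) (fderiv ℝ f y v) := by
  rw [h.hderiv_surfaceLift_eq_comp hy, hderiv_unitSection k (h.pos y hy)]

lemma inducedMetric_eq (h : IsChartSurface k D f) (hy : y ∈ D) :
    inducedMetric (fubiniStudy k) f y = hmetric (surfaceLift k f) y := by
  ext v w
  rw [hmetric_apply, h.hderiv_surfaceLift hy, h.hderiv_surfaceLift hy]
  rfl

lemma smooth_inducedMetric (h : IsChartSurface k D f) :
    ContDiffOn ℝ ∞ (inducedMetric (fubiniStudy k) f) D :=
  h.isUnitLift.smooth_hmetric.congr fun _ hy => h.inducedMetric_eq hy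

lemma inducedMetric_symm (h : IsChartSurface k D f) (hy : y ∈ D) (v w : ℝ²) :
    inducedMetric (fubiniStudy k) f y v w = inducedMetric (fubiniStudy k) f y w v := by
  rw [h.inducedMetric_eq hy, hmetric_symm]

lemma hcovariant_surfaceLift (h : IsChartSurface k D f) (hy : y ∈ D) (v w : ℝ²) :
    hcovariant (surfaceLift k f) y v w
      = hcovariant (unitSection k) (f y) (fderiv ℝ f y v) (fderiv ℝ f y w)
        + hderiv (unitSection k) (f y) (fderiv ℝ (fderiv ℝ f) y v w) := by
  have hsection := isUnitLift_unitSection k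
  have hdf := hasFDerivAt_apply
    (hasFDerivAt_of_contDiffOn (contDiffOn_fderiv h.smooth h.isOpen) h.isOpen hy) w
  have hH := hasFDerivAt_apply
    (hasFDerivAt_of_contDiffOn h.isUnitLift.smooth_hderiv h.isOpen hy) w
  have hcomp := (((hasFDerivAt_of_contDiffOn hsection.smooth_hderiv hsection.isOpen
    (h.pos y hy)).comp y (h.hasFDerivAt hy)).clm_apply hdf).congr_of_eventuallyEq
      (Filter.eventually_of_mem (h.isOpen.mem_nhds hy) fun x hx =>
        h.hderiv_surfaceLift_eq_comp hx w)
  have hderiv_H : fderiv ℝ (hderiv (surfaceLift k f)) y v w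
      = fderiv ℝ (hderiv (unitSection k)) (f y) (fderiv ℝ f y v) (fderiv ℝ f y w)
        + hderiv (unitSection k) (f y) (fderiv ℝ (fderiv ℝ f) y v w) := by
    simpa [add_comm] using congrArg (fun A => A v) (hH.unique hcomp)
  rw [hcovariant, hderiv_H, h.hopfForm_surfaceLift hy, h.hderiv_surfaceLift_eq_comp hy, hcovariant]
  abel

lemma fubiniStudy_covariant (h : IsChartSurface k D f) (hy : y ∈ D) (v w : ℝ²) (t : ℂ × ℂ) :
    fubiniStudy k (f y) (fderiv ℝ (fderiv ℝ f) y v w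
        + christoffel (fubiniStudy k) (f y) (fderiv ℝ f y v) (fderiv ℝ f y w)) t
      = (herm (hcovariant (surfaceLift k f) y v w) (horizontalLift k (f y) t)).re := by
  have hpos := h.pos y hy
  rw [map_add, add_apply, fubiniStudy_christoffel k hpos, fubiniStudy_apply,
    ← hderiv_unitSection k hpos, h.hcovariant_surfaceLift hy, herm_add_left, Complex.add_re,
    add_comm]

lemma isNullPair_of_isWirtingerAngle (h : IsChartSurface k D f) (hy : y ∈ D) {α : ℝ}
    (hα : IsWirtingerAngle α (fubiniStudy k) f y) :
    ∃ e₁ e₂, IsNullPair (inducedMetric (fubiniStudy k) f y) e₁ e₂ ∧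
      (∀ X, fubiniStudy k (f y) (Complex.I • fderiv ℝ f y e₁) (fderiv ℝ f y X)
        = Real.sinh α * inducedMetric (fubiniStudy k) f y e₁ X) ∧
      ∀ X, fubiniStudy k (f y) (Complex.I • fderiv ℝ f y e₂) (fderiv ℝ f y X)
        = -Real.sinh α * inducedMetric (fubiniStudy k) f y e₂ X := by
  obtain ⟨e₁, e₂, h11, h22, h12, hJ₁, hJ₂⟩ := hα
  have tangential (c : ℝ) (e X : ℝ²)
      (hJ : fubiniStudy k (f y) (Complex.I • fderiv ℝ f y e - fderiv ℝ f y (c • e))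
        (fderiv ℝ f y X) = 0) :
      fubiniStudy k (f y) (Complex.I • fderiv ℝ f y e) (fderiv ℝ f y X)
        = c * inducedMetric (fubiniStudy k) f y e X := by
    rw [map_sub, map_smul _ c, map_smul _ c] at hJ
    exact sub_eq_zero.mp hJ
  exact ⟨e₁, e₂, ⟨h.inducedMetric_symm hy, h11, h22, h12⟩, fun X => tangential _ e₁ X (hJ₁ X),
    fun X => tangential _ e₂ X (hJ₂ X)⟩

end IsChartSurface

/-- The Kähler function of the surface with lift `z`: the value of the Kähler form on the
coordinate frame. -/
def kaehlerFunction (z : ℝ² → Fin 3 → ℂ) (y : ℝ²) : ℝ :=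
  (herm (hderiv z y 𝐞₀) (hderiv z y 𝐞₁)).im

lemma herm_hderiv_im (z : ℝ² → Fin 3 → ℂ) (y v w : ℝ²) :
    (herm (hderiv z y v) (hderiv z y w)).im
      = (v 0 * w 1 - v 1 * w 0) * kaehlerFunction z y := by
  have hself (x : Fin 3 → ℂ) : (herm x x).im = 0 := by rw [herm_self, Complex.ofReal_im]
  have hswap : (herm (hderiv z y 𝐞₁) (hderiv z y 𝐞₀)).im = -kaehlerFunction z y := by
    rw [← conj_herm, Complex.conj_im, kaehlerFunction]
  rw [map_eq_smul_add_smul _ v, map_eq_smul_add_smul _ w]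
  simp only [herm_add_left, herm_add_right, herm_real_smul_left, herm_real_smul_right,
    Complex.add_im, Complex.im_ofReal_mul, hself, hswap]
  rw [← kaehlerFunction]
  ring

/-- A surface in an affine chart, parametrized by flat null coordinates. -/
structure IsNullChartSurface (k : Fin 2) (D : Set ℝ²) (f : ℝ² → ℂ × ℂ) : Prop
    extends IsChartSurface k D f where
  inducedMetric_apply : ∀ y ∈ D, ∀ v w,
    inducedMetric (fubiniStudy k) f y v w = -(v 0 * w 1 + v 1 * w 0)

namespace IsNullChartSurface

variable {k : Fin 2} {D : Set ℝ²} {f : ℝ² → ℂ × ℂ} {y : ℝ²}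

lemma christoffel_inducedMetric (h : IsNullChartSurface k D f) (hy : y ∈ D) (v w : ℝ²) :
    christoffel (inducedMetric (fubiniStudy k) f) y v w = 0 := by
  have hconst : inducedMetric (fubiniStudy k) f =ᶠ[nhds y]
      fun _ => inducedMetric (fubiniStudy k) f y :=
    Filter.eventually_of_mem (h.isOpen.mem_nhds hy) fun x hx =>
      ContinuousLinearMap.ext fun v => ContinuousLinearMap.ext fun w => by
        rw [h.inducedMetric_apply x hx, h.inducedMetric_apply y hy]
  rw [christoffel_congr hconst, christoffel, fderiv_fun_const]
  simp

lemma secondFundamentalForm_eq (h : IsNullChartSurface k D f) (hy : y ∈ D) (v w : ℝ²) :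
    secondFundamentalForm (fubiniStudy k) f y v w = fderiv ℝ (fderiv ℝ f) y v w
      + christoffel (fubiniStudy k) (f y) (fderiv ℝ f y v) (fderiv ℝ f y w) := by
  have hdf := hasFDerivAt_of_contDiffOn (contDiffOn_fderiv h.smooth h.isOpen) h.isOpen hy
  rw [secondFundamentalForm, h.christoffel_inducedMetric hy, map_zero, sub_zero,
    fderiv_apply_apply hdf.differentiableAt]

lemma secondFundamentalForm_symm (h : IsNullChartSurface k D f) (hy : y ∈ D) (v w : ℝ²) :
    secondFundamentalForm (fubiniStudy k) f y v w
      = secondFundamentalForm (fubiniStudy k) f y w v := by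
  rw [h.secondFundamentalForm_eq hy, h.secondFundamentalForm_eq hy,
    second_fderiv_symm h.smooth h.isOpen hy,
    (isPseudoRiemannian_fubiniStudy k).christoffel_symm (h.pos y hy)]

lemma meanCurvature_eq (h : IsNullChartSurface k D f) (hy : y ∈ D) :
    meanCurvature (fubiniStudy k) f y = -secondFundamentalForm (fubiniStudy k) f y 𝐞₀ 𝐞₁ := by
  have hinv : (Matrix.of fun i j : Fin 2 => inducedMetric (fubiniStudy k) f y
      (EuclideanSpace.single i 1) (EuclideanSpace.single j 1))⁻¹ = !![0, -1; -1, 0] := by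
    apply Matrix.inv_eq_right_inv
    ext i j
    fin_cases i <;> fin_cases j <;> simp [Matrix.mul_apply, h.inducedMetric_apply y hy]
  rw [meanCurvature, hinv]
  simp only [Fin.sum_univ_two, Matrix.of_apply, Matrix.cons_val', Matrix.cons_val_zero,
    Matrix.cons_val_one, Matrix.cons_val_fin_one]
  rw [h.secondFundamentalForm_symm hy 𝐞₁ 𝐞₀]
  module

lemma kaehlerFunction_sq (h : IsNullChartSurface k D f) (hy : y ∈ D) {α : ℝ}
    (hα : IsWirtingerAngle α (fubiniStudy k) f y) :
    kaehlerFunction (surfaceLift k f) y ^ 2 = Real.sinh α ^ 2 := by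
  obtain ⟨e₁, e₂, hnull, hJ, -⟩ := h.isNullPair_of_isWirtingerAngle hy hα
  have hκ : (e₁ 0 * e₂ 1 - e₁ 1 * e₂ 0) * kaehlerFunction (surfaceLift k f) y = -Real.sinh α := by
    have hJ₂ := hJ e₂
    rw [hnull.pq, fubiniStudy_apply, horizontalLift_smul, ← h.hderiv_surfaceLift hy,
      ← h.hderiv_surfaceLift hy, herm_smul_left, Complex.conj_I, neg_mul, Complex.neg_re,
      Complex.I_mul_re, neg_neg, herm_hderiv_im] at hJ₂
    linarith
  have hdet : (e₁ 0 * e₂ 1 - e₁ 1 * e₂ 0) ^ 2 = 1 := by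
    have h11 := hnull.pp
    have h12 := hnull.pq
    rw [h.inducedMetric_apply y hy] at h11 h12
    linear_combination (-(e₁ 0 * e₂ 1 + e₁ 1 * e₂ 0) - 1) * h12 + 2 * e₂ 0 * e₂ 1 * h11
  rw [← neg_sq (Real.sinh α), ← hκ, mul_pow, hdet, one_mul]

lemma exists_kaehlerFunction_eq (h : IsNullChartSurface k D f) (hD : IsPreconnected D) {α : ℝ}
    (hα : ∀ y ∈ D, IsWirtingerAngle α (fubiniStudy k) f y) :
    ∃ κ : ℝ, κ ^ 2 = Real.sinh α ^ 2 ∧ ∀ y ∈ D, kaehlerFunction (surfaceLift k f) y = κ := by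
  have hsq (y) (hy : y ∈ D) := h.kaehlerFunction_sq hy (hα y hy)
  rcases eq_or_ne (Real.sinh α) 0 with hzero | hzero
  · refine ⟨0, by rw [hzero], fun y hy => ?_⟩
    simpa [hzero] using hsq y hy
  have hH (v : ℝ²) : ContinuousOn (fun y => hderiv (surfaceLift k f) y v) D :=
    h.isUnitLift.smooth_hderiv.continuousOn.clm_apply continuousOn_const
  have hcont : ContinuousOn (kaehlerFunction (surfaceLift k f)) D :=
    Complex.continuous_im.comp_continuousOn
      ((hermL.continuous.comp_continuousOn (hH 𝐞₀)).clm_apply (hH 𝐞₁))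
  rcases hD.eq_or_eq_neg_of_sq_eq hcont (continuousOn_const (c := Real.sinh α)) hsq
    (fun _ => hzero) with heq | heq
  · exact ⟨Real.sinh α, rfl, heq⟩
  · exact ⟨-Real.sinh α, neg_sq _, heq⟩

lemma herm_hcovariant_eq_zero (h : IsNullChartSurface k D f) (hy : y ∈ D)
    (hmin : meanCurvature (fubiniStudy k) f y = 0) (t : ℝ²) :
    herm (hcovariant (surfaceLift k f) y 𝐞₀ 𝐞₁) (hderiv (surfaceLift k f) y t) = 0 := by
  rw [h.meanCurvature_eq hy, neg_eq_zero, h.secondFundamentalForm_eq hy] at hmin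
  rw [h.hderiv_surfaceLift hy]
  refine herm_eq_zero_of_re_horizontalLift k (fun u => ?_) _
  rw [← h.fubiniStudy_covariant hy, hmin, map_zero, zero_apply]

lemma isNullFrame (h : IsNullChartSurface k D f) (hy : y ∈ D) :
    IsNullFrame (-1 + kaehlerFunction (surfaceLift k f) y * Complex.I) (surfaceLift k f y)
      (hderiv (surfaceLift k f) y 𝐞₀) (hderiv (surfaceLift k f) y 𝐞₁) := by
  have hre (v w : ℝ²) : (herm (hderiv (surfaceLift k f) y v) (hderiv (surfaceLift k f) y w)).re
      = -(v 0 * w 1 + v 1 * w 0) := by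
    rw [← hmetric_apply, ← h.inducedMetric_eq hy, h.inducedMetric_apply y hy]
  have hz := h.isUnitLift
  refine ⟨fun h0 => ?_, hz.unit y hy, hz.herm_hderiv hy _, hz.herm_hderiv hy _, ?_, ?_, ?_⟩
  · simpa using congrArg Complex.re h0
  · exact Complex.ext (by simp [hre]) (by simp [herm_hderiv_im])
  · exact Complex.ext (by simp [hre]) (by simp [herm_hderiv_im])
  · exact Complex.ext (by simp [hre]) (by simp [kaehlerFunction])

lemma exists_isMinimalSlantLift (h : IsNullChartSurface k D f) (hD : IsPreconnected D)
    (hmin : ∀ y ∈ D, meanCurvature (fubiniStudy k) f y = 0) {α : ℝ}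
    (hα : ∀ y ∈ D, IsWirtingerAngle α (fubiniStudy k) f y) :
    ∃ κ : ℝ, κ ^ 2 = Real.sinh α ^ 2 ∧
      IsMinimalSlantLift D (-1 + κ * Complex.I) (surfaceLift k f)
        (fun y => hderiv (surfaceLift k f) y 𝐞₀) (fun y => hderiv (surfaceLift k f) y 𝐞₁)
        (fun y => hopfForm (surfaceLift k f) y 𝐞₀)
        (fun y => hopfForm (surfaceLift k f) y 𝐞₁) := by
  obtain ⟨κ, hκ, hκ_eq⟩ := h.exists_kaehlerFunction_eq hD hα
  have hz := h.isUnitLift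
  have hH (v : ℝ²) : ContDiffOn ℝ ∞ (fun y => hderiv (surfaceLift k f) y v) D :=
    hz.smooth_hderiv.clm_apply contDiffOn_const
  have hform (v : ℝ²) : ContDiffOn ℝ ∞ (fun y => hopfForm (surfaceLift k f) y v) D :=
    hz.smooth_hopfForm.clm_apply contDiffOn_const
  have hmixed (y) (hy : y ∈ D) (t : ℝ²) : herm (hderiv (surfaceLift k f) y t)
      (fderiv ℝ (fun x => hderiv (surfaceLift k f) x 𝐞₁) y 𝐞₀
        - hopfForm (surfaceLift k f) y 𝐞₀ • hderiv (surfaceLift k f) y 𝐞₁) = 0 := by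
    have hdiff := (hasFDerivAt_of_contDiffOn hz.smooth_hderiv h.isOpen hy).differentiableAt
    rw [fderiv_apply_apply hdiff, ← hcovariant, ← conj_herm,
      h.herm_hcovariant_eq_zero hy (hmin y hy), map_zero]
  refine ⟨κ, hκ, h.isOpen, hH _, hH _, hform _, hform _, fun y hy => ?_, fun y hy => ?_,
    fun y hy => hmixed y hy _, fun y hy => hmixed y hy _⟩
  · exact hκ_eq y hy ▸ h.isNullFrame hy
  · exact (hasPartialsAt_of_contDiffOn hz.smooth h.isOpen hy).congr
      (by rw [hderiv_apply, sub_add_cancel]) (by rw [hderiv_apply, sub_add_cancel])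

end IsNullChartSurface

/-! ### Local model charts -/

lemma exists_convex_flat_null_coordinates {D : Set ℝ²} {G : ℝ² → ℝ² →L[ℝ] ℝ² →L[ℝ] ℝ}
    (hD : IsOpen D) (hG : ContDiffOn ℝ ∞ G D) (hs : ∀ y ∈ D, ∀ v w, G y v w = G y w v)
    (hflat : ∀ y ∈ D, ∀ u v w, curvature G y u v w = 0) {x a b : ℝ²} (hx : x ∈ D)
    (hab : IsNullPair (G x) a b) :
    ∃ e : OpenPartialHomeomorph ℝ² ℝ², x ∈ e.source ∧ e.source ⊆ D ∧ Convex ℝ e.target ∧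
      ContDiffOn ℝ ∞ e e.source ∧ ContDiffOn ℝ ∞ e.symm e.target ∧
      ∀ y ∈ e.source, ∀ v w, G y v w
        = -(fderiv ℝ e y v 0 * fderiv ℝ e y w 1 + fderiv ℝ e y v 1 * fderiv ℝ e y w 0) := by
  obtain ⟨e, hxe, hsub, he_smooth, he_symm, he⟩ :=
    exists_flat_null_coordinates hD hG hs hflat hx hab
  obtain ⟨r, hr, hball⟩ := Metric.isOpen_iff.mp e.open_target (e x) (e.map_source hxe)
  have hmem : e x ∈ Metric.ball (e x) r := Metric.mem_ball_self hr
  have hconvex := convex_ball (e x) r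
  have hopen : IsOpen (Metric.ball (e x) r) := Metric.isOpen_ball
  generalize Metric.ball (e x) r = B at hball hmem hconvex hopen
  have hsource : (e ≫ₕ OpenPartialHomeomorph.ofSet B hopen).source ⊆ e.source := by
    rw [OpenPartialHomeomorph.trans_source]
    exact Set.inter_subset_left
  have htarget : (e ≫ₕ OpenPartialHomeomorph.ofSet B hopen).target = B := by
    rw [OpenPartialHomeomorph.trans_target]
    exact Set.inter_eq_left.mpr hball
  refine ⟨e ≫ₕ OpenPartialHomeomorph.ofSet B hopen, ?_, hsource.trans hsub, ?_,
    he_smooth.mono hsource, ?_, fun y hy => he y (hsource hy)⟩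
  · rw [OpenPartialHomeomorph.trans_source]
    exact ⟨hxe, hmem⟩
  · rwa [htarget]
  · rw [htarget]
    exact he_symm.mono hball

lemma IsChartSurface.isNullChartSurface_comp_symm {k : Fin 2} {D : Set ℝ²} {f : ℝ² → ℂ × ℂ}
    (h : IsChartSurface k D f) {e : OpenPartialHomeomorph ℝ² ℝ²} (hsub : e.source ⊆ D)
    (he : ContDiffOn ℝ ∞ e e.source) (he_symm : ContDiffOn ℝ ∞ e.symm e.target)
    (hnull : ∀ y ∈ e.source, ∀ v w, inducedMetric (fubiniStudy k) f y v w
        = -(fderiv ℝ e y v 0 * fderiv ℝ e y w 1 + fderiv ℝ e y v 1 * fderiv ℝ e y w 0)) :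
    IsNullChartSurface k e.target (f ∘ e.symm) where
  isOpen := e.open_target
  smooth := h.smooth.comp he_symm fun _ hy => hsub (e.map_target hy)
  pos y hy := h.pos _ (hsub (e.map_target hy))
  inducedMetric_apply y hy v w := by
    have hy' := e.map_target hy
    have hsymm := hasFDerivAt_of_contDiffOn he_symm e.open_target hy
    have hcomp : HasFDerivAt (f ∘ e.symm) _ y := (h.hasFDerivAt (hsub hy')).comp y hsymm
    have hid := ((hasFDerivAt_of_contDiffOn he e.open_source hy').comp y hsymm).unique
      ((hasFDerivAt_id y).congr_of_eventuallyEq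
        (Filter.eventually_of_mem (e.open_target.mem_nhds hy) fun u hu => e.right_inv hu))
    have hinverse (v : ℝ²) : fderiv ℝ e (e.symm y) (fderiv ℝ e.symm y v) = v :=
      DFunLike.congr_fun hid v
    have hpull : inducedMetric (fubiniStudy k) (f ∘ e.symm) y v w
        = inducedMetric (fubiniStudy k) f (e.symm y) (fderiv ℝ e.symm y v)
          (fderiv ℝ e.symm y w) := by
      rw [inducedMetric, hcomp.fderiv]
      rfl
    rw [hpull, hnull _ hy', hinverse, hinverse]

section Charts

variable {M : Type*} [TopologicalSpace M] [ChartedSpace ℝ² M] {L : M → CP21}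

lemma isChartSurface_of_contMDiff (hL : ContMDiff (𝓡 2) 𝓘(ℝ, ℂ × ℂ) ∞ L)
    {φ : OpenPartialHomeomorph M ℝ²} (hφ : φ ∈ IsManifold.maximalAtlas (𝓡 2) ∞ M) (k : Fin 2) :
    IsChartSurface k (φ.target ∩ φ.symm ⁻¹' (L ⁻¹' affineDomain k))
      (fun y => affineChart k (L (φ.symm y))) where
  isOpen := φ.symm.isOpen_inter_preimage ((isOpen_affineDomain k).preimage hL.continuous)
  smooth := by
    have hchart : affineChart k ∈ IsManifold.maximalAtlas 𝓘(ℝ, ℂ × ℂ) ∞ CP21 :=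
      IsManifold.subset_maximalAtlas (Set.mem_range_self k)
    have hLφ := hL.comp_contMDiffOn (contMDiffOn_symm_of_mem_maximalAtlas hφ)
    exact contMDiffOn_iff_contDiffOn.mp ((contMDiffOn_of_mem_maximalAtlas hchart).comp
      (hLφ.mono Set.inter_subset_left) fun _ hy => hy.2)
  pos _ hy := (affineChart k).map_source hy.2

lemma isLagrangian_of_sinh_eq_zero (hL : ContMDiff (𝓡 2) 𝓘(ℝ, ℂ × ℂ) ∞ L) {θ : ℝ}
    (hslant : InCharts L (IsWirtingerAngle θ)) (hθ : Real.sinh θ = 0) : IsLagrangian L := by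
  intro φ hφ k u hu hk X Y
  obtain ⟨e₁, e₂, hnull, hJ₁, hJ₂⟩ := (isChartSurface_of_contMDiff hL hφ k
    ).isNullPair_of_isWirtingerAngle ⟨hu, hk⟩ (hslant φ hφ k u hu hk)
  rw [← hnull.coordinates_expand X]
  simp only [map_add, map_smul, smul_add, smul_comm Complex.I, add_apply, smul_apply, hJ₁, hJ₂, hθ,
    neg_zero, zero_mul, smul_zero, add_zero]

/-- A chart of the surface with convex image in which the surface lies in an affine chart of
`CP21` and is parametrized by flat null coordinates. -/
structure IsNullChart (L : M → CP21) (k : Fin 2) (ψ : OpenPartialHomeomorph M ℝ²) : Prop where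
  mem_atlas : ψ ∈ IsManifold.maximalAtlas (𝓡 2) ∞ M
  convex : Convex ℝ ψ.target
  mem_domain : ∀ y ∈ ψ.target, L (ψ.symm y) ∈ affineDomain k
  null : IsNullChartSurface k ψ.target (fun y => affineChart k (L (ψ.symm y)))

lemma IsNullChart.sinh_eq_zero_and_isMinimalSlantLift {k : Fin 2} {ψ : OpenPartialHomeomorph M ℝ²}
    (h : IsNullChart L k ψ) (hne : ψ.target.Nonempty) {θ : ℝ}
    (hslant : InCharts L (IsWirtingerAngle θ)) (hmin : IsMinimal L) :
    Real.sinh θ = 0 ∧ ∃ X Y a₁ a₂, IsMinimalSlantLift ψ.target (-1)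
      (surfaceLift k fun y => affineChart k (L (ψ.symm y))) X Y a₁ a₂ := by
  obtain ⟨κ, hκ, hlift⟩ := h.null.exists_isMinimalSlantLift h.convex.isPreconnected
    (fun y hy => hmin ψ h.mem_atlas k y hy (h.mem_domain y hy))
    (fun y hy => hslant ψ h.mem_atlas k y hy (h.mem_domain y hy))
  have hκ_zero : κ = 0 := by
    have him := congrArg Complex.im (hlift.conj_eq_self hne)
    simp only [map_add, map_neg, map_one, map_mul, Complex.conj_ofReal, Complex.conj_I,
      Complex.add_im, Complex.neg_im, Complex.one_im, Complex.mul_im, Complex.ofReal_re,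
      Complex.ofReal_im, Complex.I_im, Complex.I_re] at him
    linarith
  subst hκ_zero
  have hcoeff : (-1 : ℂ) + ((0 : ℝ) : ℂ) * Complex.I = -1 := by simp
  rw [hcoeff] at hlift
  exact ⟨by simpa using hκ.symm, _, _, _, _, hlift⟩

/-- A chart in which the surface is the model surface, moved by `A`. -/
structure IsModelChart (L : M → CP21) (A : U12) (φ : OpenPartialHomeomorph M ℝ²) : Prop where
  mem_atlas : φ ∈ IsManifold.maximalAtlas (𝓡 2) ∞ M
  eq_model : ∀ q ∈ φ.source, L q = A.congruence (hopf (Ltilde 1 (φ q 0) (φ q 1)))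

lemma IsModelChart.isOverlap {A B : U12} {φ ψ : OpenPartialHomeomorph M ℝ²}
    (hφ : IsModelChart L A φ) (hψ : IsModelChart L B ψ) :
    ∃ X Y X' Y', IsOverlap (φ.symm ≫ₕ ψ).source (φ.symm ≫ₕ ψ)
      (fun u => A.toEquiv (modelCurve 1 1 1 u)) X Y
      (fun u => B.toEquiv (modelCurve 1 1 1 u)) X' Y' := by
  refine ⟨_, _, _, _, (φ.symm ≫ₕ ψ).open_source, ?_, (isModelSolution_modelCurve _).map A,
    (isModelSolution_modelCurve _).map B, fun u hu => ?_⟩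
  · rw [OpenPartialHomeomorph.trans_source]
    exact contMDiffOn_iff_contDiffOn.mp ((contMDiffOn_of_mem_maximalAtlas hψ.mem_atlas).comp
      ((contMDiffOn_symm_of_mem_maximalAtlas hφ.mem_atlas).mono Set.inter_subset_left)
      fun _ hx => hx.2)
  · rw [OpenPartialHomeomorph.trans_source] at hu
    have heq := hφ.eq_model _ (φ.map_target hu.1)
    rw [hψ.eq_model _ hu.2, φ.right_inv hu.1] at heq
    obtain ⟨c, -, hc⟩ := hopf_eq_iff.mp heq
    refine ⟨c, ?_⟩
    rw [modelCurve_eq_Ltilde, modelCurve_eq_Ltilde]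
    exact hc

variable [IsManifold (𝓡 2) ∞ M]

lemma trans_mem_maximalAtlas {φ : OpenPartialHomeomorph M ℝ²}
    (hφ : φ ∈ IsManifold.maximalAtlas (𝓡 2) ∞ M) {e : OpenPartialHomeomorph ℝ² ℝ²}
    (he : ContDiffOn ℝ ∞ e e.source) (he_symm : ContDiffOn ℝ ∞ e.symm e.target) :
    φ ≫ₕ e ∈ IsManifold.maximalAtlas (𝓡 2) ∞ M := by
  rw [IsManifold.mem_maximalAtlas_iff_contMDiffOn] at hφ ⊢
  rw [OpenPartialHomeomorph.trans_source, OpenPartialHomeomorph.trans_target]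
  exact ⟨(contMDiffOn_iff_contDiffOn.mpr he).comp (hφ.1.mono Set.inter_subset_left)
      fun _ hx => hx.2,
    hφ.2.comp ((contMDiffOn_iff_contDiffOn.mpr he_symm).mono Set.inter_subset_left)
      fun _ hx => hx.2⟩

lemma exists_isNullChart (hL : ContMDiff (𝓡 2) 𝓘(ℝ, ℂ × ℂ) ∞ L) {θ : ℝ}
    (hslant : InCharts L (IsWirtingerAngle θ)) (hflat : IsFlat L) (p : M) :
    ∃ k ψ, p ∈ ψ.source ∧ IsNullChart L k ψ := by
  obtain ⟨k, hk⟩ := exists_mem_affineDomain (L p)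
  set φ := chartAt ℝ² p
  have hφ : φ ∈ IsManifold.maximalAtlas (𝓡 2) ∞ M := IsManifold.chart_mem_maximalAtlas p
  have hpφ : p ∈ φ.source := mem_chart_source _ p
  have h := isChartSurface_of_contMDiff hL hφ k
  have hp : φ p ∈ φ.target ∩ φ.symm ⁻¹' (L ⁻¹' affineDomain k) :=
    ⟨φ.map_source hpφ, by simpa [φ.left_inv hpφ] using hk⟩
  obtain ⟨e₁, e₂, hnull, -⟩ := h.isNullPair_of_isWirtingerAngle hp (hslant φ hφ k (φ p) hp.1 hp.2)
  obtain ⟨e, hpe, hsub, hconv, he, he_symm, hmetric⟩ := exists_convex_flat_null_coordinates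
    h.isOpen h.smooth_inducedMetric (fun _ hy => h.inducedMetric_symm hy)
    (fun y hy => hflat φ hφ k y hy.1 hy.2) hp hnull
  have htarget : (φ ≫ₕ e).target = e.target := by
    rw [OpenPartialHomeomorph.trans_target]
    exact Set.inter_eq_left.mpr fun y hy => (hsub (e.map_target hy)).1
  refine ⟨k, φ ≫ₕ e, ?_, trans_mem_maximalAtlas hφ he he_symm, htarget ▸ hconv,
    htarget ▸ fun y hy => (hsub (e.map_target hy)).2,
    htarget ▸ h.isNullChartSurface_comp_symm hsub he he_symm hmetric⟩
  rw [OpenPartialHomeomorph.trans_source]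
  exact ⟨hpφ, hpe⟩

lemma IsNullChart.exists_isModelChart {k : Fin 2} {ψ : OpenPartialHomeomorph M ℝ²}
    (h : IsNullChart L k ψ) (hne : ψ.target.Nonempty) {X Y : ℝ² → Fin 3 → ℂ} {a₁ a₂ : ℝ² → ℂ}
    (hlift : IsMinimalSlantLift ψ.target (-1)
      (surfaceLift k fun y => affineChart k (L (ψ.symm y))) X Y a₁ a₂) :
    ∃ A φ, φ.source = ψ.source ∧ IsModelChart L A φ := by
  obtain ⟨s, hs, A, hA⟩ := hlift.exists_congruence h.convex hne
  refine ⟨A, ψ ≫ₕ (planeScale s hs).symm.toHomeomorph.toOpenPartialHomeomorph, by simp,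
    trans_mem_maximalAtlas h.mem_atlas (planeScale s hs).symm.contDiff.contDiffOn
      (planeScale s hs).contDiff.contDiffOn, fun q hq => ?_⟩
  have hq : q ∈ ψ.source := by simpa using hq
  set u := (planeScale s hs).symm (ψ q) with hu_def
  have hu : planeScale s hs u = ψ q := by rw [hu_def, ContinuousLinearEquiv.apply_symm_apply]
  obtain ⟨c, hc, hcA⟩ := hA u (hu ▸ ψ.map_source hq)
  have hdomain := h.mem_domain _ (ψ.map_source hq)
  have hpos := h.null.pos _ (ψ.map_source hq)
  rw [hu, modelCurve_eq_Ltilde, surfaceLift, unitSection_eq_unitPoint k hpos] at hcA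
  rw [ψ.left_inv hq] at hdomain hcA
  calc L q = hopf (unitPoint k (affineChart k (L q))) := ((affineChart k).left_inv hdomain).symm
    _ = A.congruence (hopf (Ltilde 1 (u 0) (u 1))) := by
      rw [U12.congruence_hopf]
      exact hopf_eq_iff.mpr ⟨c, hc, hcA.symm⟩

lemma sinh_eq_zero_and_exists_isModelChart (hL : ContMDiff (𝓡 2) 𝓘(ℝ, ℂ × ℂ) ∞ L) {θ : ℝ}
    (hslant : InCharts L (IsWirtingerAngle θ)) (hmin : IsMinimal L) (hflat : IsFlat L) (p : M) :
    Real.sinh θ = 0 ∧ ∃ A φ, p ∈ φ.source ∧ IsModelChart L A φ := by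
  obtain ⟨k, ψ, hp, hψ⟩ := exists_isNullChart hL hslant hflat p
  have hne : ψ.target.Nonempty := ⟨_, ψ.map_source hp⟩
  obtain ⟨hθ, X, Y, a₁, a₂, hlift⟩ := hψ.sinh_eq_zero_and_isMinimalSlantLift hne hslant hmin
  obtain ⟨A, φ, hsource, hφ⟩ := hψ.exists_isModelChart hne hlift
  exact ⟨hθ, A, φ, hsource ▸ hp, hφ⟩

/-! ### Globalization -/

lemma IsModelChart.of_overlap {A B : U12} {φ ψ : OpenPartialHomeomorph M ℝ²}
    (hφ : IsModelChart L A φ) (hψ : IsModelChart L B ψ)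
    (hne : (φ.source ∩ ψ.source).Nonempty) : ∃ χ, χ.source = φ.source ∧ IsModelChart L B χ := by
  obtain ⟨X, Y, X', Y', hoverlap⟩ := hφ.isOverlap hψ
  have hne' : (φ.symm ≫ₕ ψ).source.Nonempty := by
    obtain ⟨r, hr, hr'⟩ := hne
    refine ⟨φ r, ?_⟩
    rw [OpenPartialHomeomorph.trans_source]
    exact ⟨φ.map_source hr, by simpa [φ.left_inv hr] using hr'⟩
  obtain ⟨R, b, c, hc, hRb⟩ := hoverlap.exists_affine_change hne'
  refine ⟨φ ≫ₕ (R.toHomeomorph.trans (Homeomorph.addRight b)).toOpenPartialHomeomorph, by simp,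
    trans_mem_maximalAtlas hφ.mem_atlas (R.contDiff.add contDiff_const).contDiffOn
      (R.symm.contDiff.comp (contDiff_id.add contDiff_const)).contDiffOn, fun q hq => ?_⟩
  have hchange := hRb (φ q)
  rw [modelCurve_eq_Ltilde, modelCurve_eq_Ltilde] at hchange
  rw [hφ.eq_model q (by simpa using hq)]
  exact (hopf_eq_iff.mpr ⟨c, hc, hchange⟩).symm

lemma exists_global_congruence [ConnectedSpace M]
    (h : ∀ p : M, ∃ A φ, p ∈ φ.source ∧ IsModelChart L A φ) :
    ∃ A : U12, ∀ p : M, ∃ φ, p ∈ φ.source ∧ IsModelChart L A φ := by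
  obtain ⟨p₀⟩ : Nonempty M := inferInstance
  obtain ⟨A, φ₀, hp₀, hφ₀⟩ := h p₀
  have hclopen : IsClopen {p : M | ∃ φ, p ∈ φ.source ∧ IsModelChart L A φ} := by
    constructor
    · rw [← isOpen_compl_iff, isOpen_iff_mem_nhds]
      intro p hp
      obtain ⟨B, ψ, hpψ, hψ⟩ := h p
      refine Filter.mem_of_superset (ψ.open_source.mem_nhds hpψ) ?_
      rintro r hr ⟨φ, hrφ, hφ⟩
      obtain ⟨χ, hχ, hχA⟩ := hψ.of_overlap hφ ⟨r, hr, hrφ⟩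
      exact hp ⟨χ, hχ ▸ hpψ, hχA⟩
    · rw [isOpen_iff_mem_nhds]
      rintro p ⟨φ, hp, hφ⟩
      exact Filter.mem_of_superset (φ.open_source.mem_nhds hp) fun q hq => ⟨φ, hq, hφ⟩
  exact ⟨A, Set.eq_univ_iff_forall.mp (hclopen.eq_univ ⟨p₀, φ₀, hp₀, hφ₀⟩)⟩

end Charts

end SlantCP

end

theorem theorem6p1 {M : Type*} [TopologicalSpace M]
    [ChartedSpace (EuclideanSpace ℝ (Fin 2)) M] [IsManifold (𝓡 2) ∞ M] [ConnectedSpace M]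
    (L : M → SlantCP.CP21) (hL : ContMDiff (𝓡 2) 𝓘(ℝ, ℂ × ℂ) ∞ L)
    (hslant : SlantCP.IsSlant L) (hmin : SlantCP.IsMinimal L) (hflat : SlantCP.IsFlat L) :
    SlantCP.IsLagrangian L ∧
      ∃ a : ℝ, a ≠ 0 ∧ ∃ A : SlantCP.U12, ∀ p : M,
        ∃ φ ∈ IsManifold.maximalAtlas (𝓡 2) ∞ M, p ∈ φ.source ∧
          ∀ q ∈ φ.source,
            L q = A.congruence (SlantCP.hopf (SlantCP.Ltilde a (φ q 0) (φ q 1))) := by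
  obtain ⟨θ, hθ⟩ := hslant
  have hlocal := SlantCP.sinh_eq_zero_and_exists_isModelChart hL hθ hmin hflat
  obtain ⟨p₀⟩ : Nonempty M := inferInstance
  obtain ⟨A, hA⟩ := SlantCP.exists_global_congruence fun p => (hlocal p).2
  refine ⟨SlantCP.isLagrangian_of_sinh_eq_zero hL hθ (hlocal p₀).1, 1, one_ne_zero, A, fun p => ?_⟩
  obtain ⟨φ, hp, hφ⟩ := hA p
  exact ⟨φ, hφ.mem_atlas, hp, hφ.eq_model⟩
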